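/- **Theorem (Soundness & Completeness).** Let $\mathcal V$ be a commutative unital quantale with tensor $\otimes$ and unit $k$ which is integral ($k=\top$) and whose underlying complete lattice is continuous, i.e. $x=\bigvee\{y\mid y\ll x\}$ for all $x$, where $y\ll x$ means that whenever $x\le\bigvee X$ there is a finite $A\subseteq X$ with $y\le\bigvee A$. Let $B\subseteq\mathcal V$ be a basis (for each $x$ the set $B\cap\{y\mid y\ll x\}$ is directed with least upper bound $x$) that is closed under finite joins and under $\otimes$ and contains $k$. *Calculus.* Fix a class $G$ of ground types and a class $\Sigma$ of operation symbols $f:A_1,\dots,A_n\to A$ with $n\ge1$. Types are generated from $G$ by $\mathsf I$, $A\otimes A'$ and $A\multimap A'$. Contexts are lists of typed variables without repetition; terms are taken up to renaming of bound variables. The judgements $\Gamma\rhd v:A$ are those of the linear $\lambda$-calculus: $x:A\rhd x:A$; $-\rhd\ast:\mathsf I$; if $\Gamma_i\rhd v_i:A_i$ and $f:A_1,\dots,A_n\to A$ then $E\rhd f(v_1,\dots,v_n):A$; if $\Gamma\rhd v:A$ and $\Delta\rhd w:A'$ then $E\rhd v\otimes w:A\otimes A'$; if $\Gamma\rhd v:A\otimes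 A'$ and $\Delta,x:A,y:A'\rhd w:C$ then $E\rhd\mathsf{pm}\ v\ \mathsf{to}\ x\otimes y.\,w:C$; if $\Gamma\rhd v:\mathsf I$ and $\Delta\rhd w:A$ then $E\rhd v\ \mathsf{to}\ \ast.\,w:A$; if $\Gamma,x:A\rhd v:A'$ then $\Gamma\rhd\lambda x:A.\,v:A\multimap A'$; if $\Gamma\rhd v:A\multimap A'$ and $\Delta\rhd w:A$ then $E\rhd v\,w:A'$. Here $E$ is any context that is a shuffle of the contexts of the premises (an interleaving that preserves the order within each). *Theories.* A $\mathcal V$-equation-in-context is an expression $\Gamma\rhd v=_q w:A$ with $q\in B$, $\Gamma\rhd v:A$ and $\Gamma\rhd w:A$. A linear $\mathcal V\lambda$-theory $\mathscr T=((G,\Sigma),Ax)$ is given by a class $Ax$ of $\mathcal V$-equations-in-context (the axioms). Its theorems form the smallest class of $\mathcal V$-equations-in-context that contains $Ax$, that contains $v=_\top w$ and $w=_\top v$ for each (well-typed) instance $v=w$ of $$\begin{gathered}\mathsf{pm}\ v\otimes w\ \mathsf{to}\ x\otimes y.\,u=u[v/x,w/y],\qquad \mathsf{pm}\ v\ \mathsf{to}\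 x\otimes y.\,u[x\otimes y/z]=u[v/z],\\ \ast\ \mathsf{to}\ \ast.\,v=v,\qquad v\ \mathsf{to}\ \ast.\,w[\ast/z]=w[v/z],\qquad (\lambda x:A.\,v)\,w=v[w/x],\qquad \lambda x:A.\,(v\,x)=v,\\ u[v\ \mathsf{to}\ \ast.\,w/z]=v\ \mathsf{to}\ \ast.\,u[w/z],\qquad u[\mathsf{pm}\ v\ \mathsf{to}\ x\otimes y.\,w/z]=\mathsf{pm}\ v\ \mathsf{to}\ x\otimes y.\,u[w/z],\end{gathered}$$ and that is closed under the following rules (all labels in $B$): - (refl) $v=_\top v$; (trans) from $v=_q w$ and $w=_r u$ infer $v=_{q\otimes r}u$; (weak) from $v=_q w$ and $r\le q$ infer $v=_r w$; - (arch) if $v=_r w$ for all $r\in B$ with $r\ll q$, then $v=_q w$; - (join) if $v=_{q_i}w$ for $i=1,\dots,n$ ($n\ge0$), then $v=_{\bigvee_i q_i}w$; - compatibility with every term former, the labels of the premises being multiplied with $\otimes$ (for $\lambda$-abstraction the label is unchanged); - if $\Gamma\rhd v=_q w:A$ and $\Delta$ is a permutation of $\Gamma$, then $\Delta\rhd v=_q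 w:A$; - if $\Gamma,x:A\rhd v=_q w:A'$ and $\Delta\rhd v'=_r w':A$, then $\Gamma,\Delta\rhd v[v'/x]=_{q\otimes r}w[w'/x]:A'$. *Varietal theories.* For types $A,A'$ the terms $v$ with $x:A\rhd v:A'$, with $a(v,w)=\bigvee\{q\mid x:A\rhd v=_q w:A'\text{ is a theorem}\}$, form a $\mathcal V$-category ($k\le a(v,v)$ and $a(v,w)\otimes a(w,u)\le a(v,u)$), possibly large. The theory is *varietal* if for all $A,A'$ the quotient of this class by the relation "$k\le a(v,w)$ and $k\le a(w,v)$" is small. *Models.* A $\mathcal V\text{-}\mathsf{Cat}_{\mathsf{sep}}$-enriched autonomous category is a (locally small) symmetric monoidal closed category $\mathsf C$ whose hom-sets carry the structure of $\mathcal V$-categories $(\mathsf C(X,Y),a)$ that are separated ($k\le a(f,g)$ and $k\le a(g,f)$ imply $f=g$), such that $a(f,f')\otimes a(g,g')\le a(g\cdot f,g'\cdot f')$ for composition, $a(f,f')\otimes a(g,g')\le a(f\otimes g,f'\otimes g')$ for the tensor, and the bijections $\mathsf C(Y\otimes X,Z)\cong\mathsf C(Y,X\multimap Z)$ preserve $a$.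 Given an object $[\![X]\!]$ for each $X\in G$, types and contexts are interpreted by $\mathsf I$, $\otimes$ and $\multimap$ of $\mathsf C$; given moreover a morphism $[\![f]\!]:[\![A_1]\!]\otimes\cdots\otimes[\![A_n]\!]\to[\![A]\!]$ for each $f\in\Sigma$, each judgement has its standard interpretation $[\![\Gamma\rhd v:A]\!]:[\![\Gamma]\!]\to[\![A]\!]$. A $\mathcal V$-equation $\Gamma\rhd v=_q w:A$ is *satisfied* if $q\le a([\![\Gamma\rhd v:A]\!],[\![\Gamma\rhd w:A]\!])$, and the interpretation is a *model* of $\mathscr T$ if it satisfies all axioms in $Ax$. *Claim.* If $\mathscr T$ is a varietal linear $\mathcal V\lambda$-theory, then a $\mathcal V$-equation-in-context $\Gamma\rhd v=_q w:A$ is a theorem of $\mathscr T$ if and only if it is satisfied by all models of $\mathscr T$. -/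

import Mathlib

open CategoryTheory MonoidalCategory

universe u₁ u₂ u₃ w c

namespace VLambda

/-! ### Quantales, the way-below relation and bases -/

section Order

variable {L : Type u₃} [CompleteLattice L]

/-- `y` is way below `x`. -/
def WayBelow (y x : L) : Prop :=
  ∀ X : Set L, x ≤ sSup X → ∃ A : Set L, A.Finite ∧ A ⊆ X ∧ y ≤ sSup A

variable (L) in
/-- The complete lattice `L` is continuous. -/
def IsContinuousLattice : Prop :=
  ∀ x : L, x = sSup {y | WayBelow y x}

/-- `B` is a basis of `L`. -/
def IsBasis (B : Set L) : Prop :=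
  ∀ x : L, (B ∩ {y | WayBelow y x}).Nonempty ∧
    DirectedOn (· ≤ ·) (B ∩ {y | WayBelow y x}) ∧ IsLUB (B ∩ {y | WayBelow y x}) x

/-- `B` is closed under finite joins (the empty one included) and under the multiplication of the
quantale, and it contains the unit. -/
structure IsClosedUnderOps [CommMonoid L] (B : Set L) : Prop where
  join_mem : ∀ A : Set L, A.Finite → A ⊆ B → sSup A ∈ B
  mul_mem : ∀ q ∈ B, ∀ r ∈ B, q * r ∈ B
  one_mem : (1 : L) ∈ B

end Order

/-! ### Categories enriched in a quantale -/

section VCategories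

variable {V : Type u₃} [CompleteLattice V] [CommMonoid V]

variable (V) in
/-- The structure of a `V`-category on `X`. -/
structure VCat (X : Type*) where
  hom : X → X → V
  one_le : ∀ x, 1 ≤ hom x x
  mul_le : ∀ x y z, hom x y * hom y z ≤ hom x z

namespace VCat

variable {X Y : Type*}

/-- Separation: the natural order is antisymmetric. -/
def IsSeparated (a : VCat V X) : Prop :=
  ∀ x y, 1 ≤ a.hom x y → 1 ≤ a.hom y x → x = y

/-- The function `f` is a `V`-functor from `(X, a)` to `(Y, b)`. -/
def IsVFunctor (a : VCat V X) (b : VCat V Y) (f : X → Y) : Prop :=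
  ∀ x x', a.hom x x' ≤ b.hom (f x) (f x')

/-- The bijection `e` is an isomorphism of `V`-categories. -/
def IsVIso (a : VCat V X) (b : VCat V Y) (e : X ≃ Y) : Prop :=
  IsVFunctor a b e ∧ IsVFunctor b a e.symm

/-- The tensor product of two `V`-categories. -/
def tensor [IsQuantale V] (a : VCat V X) (b : VCat V Y) : VCat V (X × Y) where
  hom p p' := a.hom p.1 p'.1 * b.hom p.2 p'.2
  one_le p := by
    calc (1 : V) = 1 * 1 := (one_mul 1).symm
      _ ≤ _ := mul_le_mul' (a.one_le _) (b.one_le _)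
  mul_le p p' p'' := by
    rw [mul_mul_mul_comm]
    exact mul_le_mul' (a.mul_le _ _ _) (b.mul_le _ _ _)

/-- The equivalence relation whose quotient is the separated `V`-category generated by `(X, a)`. -/
def setoid [IsQuantale V] (a : VCat V X) : Setoid X where
  r x y := 1 ≤ a.hom x y ∧ 1 ≤ a.hom y x
  iseqv :=
    { refl := fun x => ⟨a.one_le x, a.one_le x⟩
      symm := fun h => ⟨h.2, h.1⟩
      trans := fun {x y z} h h' =>
        ⟨(one_mul (1 : V)).symm.le.trans ((mul_le_mul' h.1 h'.1).trans (a.mul_le x y z)),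
          (one_mul (1 : V)).symm.le.trans ((mul_le_mul' h'.2 h.2).trans (a.mul_le z y x))⟩ }

end VCat

end VCategories

/-! ### Autonomous categories and their enrichment -/

section Autonomous

variable {C : Type*} [Category.{w} C] [MonoidalCategory C] [SymmetricCategory C] [MonoidalClosed C]

/-- The hom-bijection of the adjunction `(- ⊗ X) ⊣ (X ⊸ -)` (right transposition). -/
def transpose (Y X Z : C) : (Y ⊗ X ⟶ Z) ≃ (Y ⟶ (ihom X).obj Z) :=
  ((β_ Y X).homCongr (Iso.refl Z)).trans ((ihom.adjunction X).homEquiv Y Z)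

/-- The application morphism, i.e. the counit of `(- ⊗ X) ⊣ (X ⊸ -)`. -/
def appHom (X Z : C) : (ihom X).obj Z ⊗ X ⟶ Z :=
  (transpose ((ihom X).obj Z) X Z).symm (𝟙 _)

variable (V : Type u₃) [CompleteLattice V] [CommMonoid V] [IsQuantale V] (C)

/-- An autonomous category (symmetric monoidal closed) enriched over separated `V`-categories:
the hom-sets are separated `V`-categories, composition and tensor are `V`-functors, and the
adjunctions `(- ⊗ X) ⊣ (X ⊸ -)` are given by isomorphisms of `V`-categories. -/
class VCatSepAutonomous where
  homVCat : ∀ X Y : C, VCat V (X ⟶ Y)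
  separated : ∀ X Y : C, (homVCat X Y).IsSeparated
  comp_vfunctor : ∀ X Y Z : C,
    ((homVCat X Y).tensor (homVCat Y Z)).IsVFunctor (homVCat X Z) (fun p => p.1 ≫ p.2)
  tensor_vfunctor : ∀ X Y X' Y' : C,
    ((homVCat X Y).tensor (homVCat X' Y')).IsVFunctor (homVCat (X ⊗ X') (Y ⊗ Y'))
      (fun p => p.1 ⊗ₘ p.2)
  adj_viso : ∀ Y X Z : C,
    (homVCat (Y ⊗ X) Z).IsVIso (homVCat Y ((ihom X).obj Z)) (transpose Y X Z)

end Autonomous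

/-! ### Syntax of the linear lambda calculus -/

/-- Types over a class `G` of ground types. -/
inductive Ty (G : Type u₁) : Type u₁
  | ground : G → Ty G
  | unit : Ty G
  | tensor : Ty G → Ty G → Ty G
  | lolli : Ty G → Ty G → Ty G

/-- Ground types and sorted operation symbols `f : A₁, …, Aₙ → A` with `n ≥ 1`. -/
structure Signature where
  Ground : Type u₁
  Op : Type u₂
  arity : Op → ℕ
  arity_pos : ∀ f, 1 ≤ arity f
  dom : ∀ f, Fin (arity f) → Ty Ground
  cod : Op → Ty Ground

/-- Terms up to renaming of bound variables: free variables carry names (natural numbers), bound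
variables are de Bruijn indices. `letPair` binds two variables (the second component has index
`0`, the first one index `1`), `lam` binds one. Named binders are `Tm.pm` and `Tm.abs` below. -/
inductive Tm (S : Signature.{u₁, u₂}) : Type (max u₁ u₂)
  | fvar : ℕ → Tm S
  | bvar : ℕ → Tm S
  | op : (f : S.Op) → (Fin (S.arity f) → Tm S) → Tm S
  | star : Tm S
  | letStar : Tm S → Tm S → Tm S
  | pair : Tm S → Tm S → Tm S
  | letPair : Tm S → Tm S → Tm S
  | lam : Ty S.Ground → Tm S → Tm S
  | app : Tm S → Tm S → Tm S

namespace Tm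

variable {S : Signature.{u₁, u₂}}

/-- Turn the free variable `x` into the bound variable of index `k`. -/
def close : ℕ → ℕ → Tm S → Tm S
  | k, x, fvar y => if y = x then bvar k else fvar y
  | _, _, bvar i => bvar i
  | k, x, op f vs => op f (fun i => close k x (vs i))
  | _, _, star => star
  | k, x, letStar v t => letStar (close k x v) (close k x t)
  | k, x, pair v t => pair (close k x v) (close k x t)
  | k, x, letPair v t => letPair (close k x v) (close (k + 2) x t)
  | k, x, lam A v => lam A (close (k + 1) x v)
  | k, x, app v t => app (close k x v) (close k x t)

/-- The term `λ x : A. v`. -/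
def abs (x : ℕ) (A : Ty S.Ground) (v : Tm S) : Tm S :=
  lam A (close 0 x v)

/-- The term `pm v to x ⊗ y. t`. -/
def pm (v : Tm S) (x y : ℕ) (t : Tm S) : Tm S :=
  letPair v (close 0 y (close 1 x t))

/-- Simultaneous substitution for free variables. It avoids capture because the terms that are
substituted (well-typed ones) have no dangling de Bruijn index. -/
def subst (σ : ℕ → Tm S) : Tm S → Tm S
  | fvar y => σ y
  | bvar i => bvar i
  | op f vs => op f (fun i => subst σ (vs i))
  | star => star
  | letStar v t => letStar (subst σ v) (subst σ t)
  | pair v t => pair (subst σ v) (subst σ t)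
  | letPair v t => letPair (subst σ v) (subst σ t)
  | lam A v => lam A (subst σ v)
  | app v t => app (subst σ v) (subst σ t)

/-- `v[t/x]`. -/
def subst₁ (v : Tm S) (x : ℕ) (t : Tm S) : Tm S :=
  v.subst (Function.update fvar x t)

/-- `v[t/x, s/y]`. -/
def subst₂ (v : Tm S) (x : ℕ) (t : Tm S) (y : ℕ) (s : Tm S) : Tm S :=
  v.subst (Function.update (Function.update fvar x t) y s)

end Tm

/-- Lists of typed variables. The head of the list is the rightmost variable, so that
`(x, A) :: Γ` stands for `Γ, x : A`. -/
abbrev Ctx (G : Type u₁) := List (ℕ × Ty G)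

/-- A list of typed variables is a typing context if no variable occurs twice. -/
def IsCtx {G : Type u₁} (Γ : Ctx G) : Prop :=
  (Γ.map Prod.fst).Nodup

/-- `Shuffle Γ Δ E`: the ways in which `E` is a shuffle of `Γ` and `Δ`. -/
inductive Shuffle {α : Type u₁} : List α → List α → List α → Type u₁
  | nil : Shuffle [] [] []
  | left {Γ Δ E : List α} (p : α) : Shuffle Γ Δ E → Shuffle (p :: Γ) Δ (p :: E)
  | right {Γ Δ E : List α} (p : α) : Shuffle Γ Δ E → Shuffle Γ (p :: Δ) (p :: E)

/-- `Shuffles n Γ E`: the ways in which `E` is a shuffle of `Γ 0, …, Γ (n - 1)`. -/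
inductive Shuffles {α : Type u₁} : (n : ℕ) → (Fin n → List α) → List α → Type u₁
  | nil (Γ : Fin 0 → List α) : Shuffles 0 Γ []
  | snoc {n : ℕ} {E' E : List α} (Γ : Fin (n + 1) → List α) :
      Shuffles n (fun i => Γ i.castSucc) E' → Shuffle E' (Γ (Fin.last n)) E →
      Shuffles (n + 1) Γ E

section Calculus

variable {S : Signature.{u₁, u₂}}

/-- Derivations of the judgement `Γ ▷ v : A`. -/
inductive Der : Ctx S.Ground → Tm S → Ty S.Ground → Type (max u₁ u₂)
  | var (x : ℕ) (A : Ty S.Ground) : Der [(x, A)] (.fvar x) A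
  | op {E : Ctx S.Ground} (f : S.Op) (Γ : Fin (S.arity f) → Ctx S.Ground)
      (v : Fin (S.arity f) → Tm S) (d : ∀ i, Der (Γ i) (v i) (S.dom f i))
      (s : Shuffles (S.arity f) Γ E) (hE : IsCtx E) : Der E (.op f v) (S.cod f)
  | star : Der [] .star .unit
  | pair {Γ Δ E : Ctx S.Ground} {v t : Tm S} {A B : Ty S.Ground}
      (d : Der Γ v A) (e : Der Δ t B) (s : Shuffle Γ Δ E) (hE : IsCtx E) :
      Der E (.pair v t) (.tensor A B)
  | pm {Γ Δ E : Ctx S.Ground} {v t : Tm S} {A B D : Ty S.Ground} {x y : ℕ}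
      (d : Der Γ v (.tensor A B)) (e : Der ((y, B) :: (x, A) :: Δ) t D)
      (s : Shuffle Γ Δ E) (hE : IsCtx E) : Der E (.pm v x y t) D
  | letStar {Γ Δ E : Ctx S.Ground} {v t : Tm S} {A : Ty S.Ground}
      (d : Der Γ v .unit) (e : Der Δ t A) (s : Shuffle Γ Δ E) (hE : IsCtx E) :
      Der E (.letStar v t) A
  | abs {Γ : Ctx S.Ground} {v : Tm S} {A B : Ty S.Ground} {x : ℕ}
      (d : Der ((x, A) :: Γ) v B) : Der Γ (.abs x A v) (.lolli A B)
  | app {Γ Δ E : Ctx S.Ground} {v t : Tm S} {A B : Ty S.Ground}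
      (d : Der Γ v (.lolli A B)) (e : Der Δ t A) (s : Shuffle Γ Δ E) (hE : IsCtx E) :
      Der E (.app v t) B

/-- The judgement `Γ ▷ v : A` is derivable. -/
def Typed (Γ : Ctx S.Ground) (v : Tm S) (A : Ty S.Ground) : Prop :=
  Nonempty (Der Γ v A)

/-- The equations-in-context `E ▷ v = t : A` that axiomatise autonomous categories. -/
inductive BaseEq : Ctx S.Ground → Tm S → Tm S → Ty S.Ground → Prop
  | pm_beta {Γ Δ Θ E : Ctx S.Ground} {v t u : Tm S} {A B D : Ty S.Ground} {x y : ℕ} :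
      Typed Γ v A → Typed Δ t B → Typed ((y, B) :: (x, A) :: Θ) u D →
      E.Perm (Γ ++ Δ ++ Θ) → IsCtx E →
      BaseEq E (.pm (.pair v t) x y u) (u.subst₂ x v y t) D
  | pm_eta {Γ Δ E : Ctx S.Ground} {v u : Tm S} {A B D : Ty S.Ground} {x y z : ℕ} :
      Typed Γ v (.tensor A B) → Typed ((z, .tensor A B) :: Δ) u D →
      IsCtx ((y, B) :: (x, A) :: Δ) → E.Perm (Γ ++ Δ) → IsCtx E →
      BaseEq E (.pm v x y (u.subst₁ z (.pair (.fvar x) (.fvar y)))) (u.subst₁ z v) D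
  | star_beta {Γ : Ctx S.Ground} {v : Tm S} {A : Ty S.Ground} :
      Typed Γ v A → BaseEq Γ (.letStar .star v) v A
  | star_eta {Γ Δ E : Ctx S.Ground} {v t : Tm S} {A : Ty S.Ground} {z : ℕ} :
      Typed Γ v .unit → Typed ((z, .unit) :: Δ) t A → E.Perm (Γ ++ Δ) → IsCtx E →
      BaseEq E (.letStar v (t.subst₁ z .star)) (t.subst₁ z v) A
  | abs_beta {Γ Δ E : Ctx S.Ground} {v t : Tm S} {A B : Ty S.Ground} {x : ℕ} :
      Typed ((x, A) :: Γ) v B → Typed Δ t A → E.Perm (Γ ++ Δ) → IsCtx E →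
      BaseEq E (.app (.abs x A v) t) (v.subst₁ x t) B
  | abs_eta {Γ : Ctx S.Ground} {v : Tm S} {A B : Ty S.Ground} {x : ℕ} :
      Typed Γ v (.lolli A B) → IsCtx ((x, A) :: Γ) →
      BaseEq Γ (.abs x A (.app v (.fvar x))) v (.lolli A B)
  | letStar_comm {Γ Δ Θ E : Ctx S.Ground} {u v t : Tm S} {A D : Ty S.Ground} {z : ℕ} :
      Typed ((z, A) :: Γ) u D → Typed Δ v .unit → Typed Θ t A →
      E.Perm (Γ ++ Δ ++ Θ) → IsCtx E →
      BaseEq E (u.subst₁ z (.letStar v t)) (.letStar v (u.subst₁ z t)) D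
  | pm_comm {Γ Δ Θ E : Ctx S.Ground} {u v t : Tm S} {A B A' D : Ty S.Ground} {x y z : ℕ} :
      Typed ((z, A') :: Γ) u D → Typed Δ v (.tensor A B) →
      Typed ((y, B) :: (x, A) :: Θ) t A' → IsCtx ((y, B) :: (x, A) :: Γ) →
      E.Perm (Γ ++ Δ ++ Θ) → IsCtx E →
      BaseEq E (u.subst₁ z (.pm v x y t)) (.pm v x y (u.subst₁ z t)) D

end Calculus

/-! ### `V`-equations, theories and theorems -/

section Theories

variable {V : Type u₃} [CompleteLattice V] [CommMonoid V] [IsQuantale V]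

/-- A `V`-equation-in-context `ctx ▷ lhs =_label rhs : ty`, with label in `B`. -/
structure VEq (S : Signature.{u₁, u₂}) (B : Set V) where
  ctx : Ctx S.Ground
  lhs : Tm S
  rhs : Tm S
  ty : Ty S.Ground
  label : V
  label_mem : label ∈ B
  lhs_typed : Typed ctx lhs ty
  rhs_typed : Typed ctx rhs ty

variable {S : Signature.{u₁, u₂}} {B : Set V}

/-- `Thm Ax Γ v t A q`: the `V`-equation-in-context `Γ ▷ v =_q t : A` belongs to the smallest class
that contains `Ax` and is closed under the rules below. -/
inductive Thm (Ax : Set (VEq S B)) :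
    Ctx S.Ground → Tm S → Tm S → Ty S.Ground → V → Prop
  | ax (e : VEq S B) : e ∈ Ax → Thm Ax e.ctx e.lhs e.rhs e.ty e.label
  | base {Γ : Ctx S.Ground} {v t : Tm S} {A : Ty S.Ground} :
      BaseEq Γ v t A → Thm Ax Γ v t A ⊤
  | base_symm {Γ : Ctx S.Ground} {v t : Tm S} {A : Ty S.Ground} :
      BaseEq Γ v t A → Thm Ax Γ t v A ⊤
  | refl {Γ : Ctx S.Ground} {v : Tm S} {A : Ty S.Ground} :
      Typed Γ v A → Thm Ax Γ v v A ⊤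
  | trans {Γ : Ctx S.Ground} {v t u : Tm S} {A : Ty S.Ground} {q r : V} :
      Thm Ax Γ v t A q → Thm Ax Γ t u A r → Thm Ax Γ v u A (q * r)
  | weak {Γ : Ctx S.Ground} {v t : Tm S} {A : Ty S.Ground} {q r : V} :
      Thm Ax Γ v t A q → r ≤ q → r ∈ B → Thm Ax Γ v t A r
  | arch {Γ : Ctx S.Ground} {v t : Tm S} {A : Ty S.Ground} {q : V} :
      Typed Γ v A → Typed Γ t A → q ∈ B →
      (∀ r ∈ B, WayBelow r q → Thm Ax Γ v t A r) → Thm Ax Γ v t A q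
  | join {Γ : Ctx S.Ground} {v t : Tm S} {A : Ty S.Ground} {n : ℕ} {q : Fin n → V} :
      Typed Γ v A → Typed Γ t A → (∀ i, Thm Ax Γ v t A (q i)) → Thm Ax Γ v t A (⨆ i, q i)
  | pair {Γ Δ E : Ctx S.Ground} {v v' t t' : Tm S} {A A' : Ty S.Ground} {q r : V} :
      Thm Ax Γ v t A q → Thm Ax Δ v' t' A' r → Shuffle Γ Δ E → IsCtx E →
      Thm Ax E (.pair v v') (.pair t t') (.tensor A A') (q * r)
  | op {E : Ctx S.Ground} (f : S.Op) {Γ : Fin (S.arity f) → Ctx S.Ground}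
      {v t : Fin (S.arity f) → Tm S} {q : Fin (S.arity f) → V} :
      (∀ i, Thm Ax (Γ i) (v i) (t i) (S.dom f i) (q i)) → Shuffles (S.arity f) Γ E → IsCtx E →
      Thm Ax E (.op f v) (.op f t) (S.cod f) (∏ i, q i)
  | letStar {Γ Δ E : Ctx S.Ground} {v v' t t' : Tm S} {A : Ty S.Ground} {q r : V} :
      Thm Ax Γ v t .unit q → Thm Ax Δ v' t' A r → Shuffle Γ Δ E → IsCtx E →
      Thm Ax E (.letStar v v') (.letStar t t') A (q * r)
  | abs {Γ : Ctx S.Ground} {v t : Tm S} {A A' : Ty S.Ground} {x : ℕ} {q : V} :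
      Thm Ax ((x, A) :: Γ) v t A' q → Thm Ax Γ (.abs x A v) (.abs x A t) (.lolli A A') q
  | pm {Γ Δ E : Ctx S.Ground} {v v' t t' : Tm S} {A A' D : Ty S.Ground} {x y : ℕ} {q r : V} :
      Thm Ax Γ v t (.tensor A A') q → Thm Ax ((y, A') :: (x, A) :: Δ) v' t' D r →
      Shuffle Γ Δ E → IsCtx E → Thm Ax E (.pm v x y v') (.pm t x y t') D (q * r)
  | app {Γ Δ E : Ctx S.Ground} {v v' t t' : Tm S} {A A' : Ty S.Ground} {q r : V} :
      Thm Ax Γ v t (.lolli A A') q → Thm Ax Δ v' t' A r → Shuffle Γ Δ E → IsCtx E →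
      Thm Ax E (.app v v') (.app t t') A' (q * r)
  | perm {Γ Δ : Ctx S.Ground} {v t : Tm S} {A : Ty S.Ground} {q : V} :
      Thm Ax Γ v t A q → Δ.Perm Γ → Thm Ax Δ v t A q
  | subst {Γ Δ E : Ctx S.Ground} {v v' t t' : Tm S} {A A' : Ty S.Ground} {x : ℕ} {q r : V} :
      Thm Ax ((x, A) :: Γ) v t A' q → Thm Ax Δ v' t' A r → E.Perm (Γ ++ Δ) → IsCtx E →
      Thm Ax E (v.subst₁ x v') (t.subst₁ x t') A' (q * r)

variable (S B) in
/-- A linear `Vλ`-theory: a class of `V`-equations-in-context (the axioms). -/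
structure VTheory where
  Ax : Set (VEq S B)

namespace VTheory

/-- The `V`-equation-in-context `e` is a theorem of the theory. -/
def IsTheorem (T : VTheory S B) (e : VEq S B) : Prop :=
  Thm T.Ax e.ctx e.lhs e.rhs e.ty e.label

/-- The terms `v` with `x : A ▷ v : A'`, for a fixed variable `x`. -/
def Val (S : Signature.{u₁, u₂}) (A A' : Ty S.Ground) : Type (max u₁ u₂) :=
  {v : Tm S // Typed [(0, A)] v A'}

/-- The `V`-category of terms `x : A ▷ v : A'`, with `a(v, t) = ⋁ {q | v =_q t is a theorem}`. -/
def valVCat (T : VTheory S B) (A A' : Ty S.Ground) : VCat V (Val S A A') where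
  hom v t := sSup {q | Thm T.Ax [(0, A)] v.1 t.1 A' q}
  one_le v := le_top.trans (le_sSup (Thm.refl v.2))
  mul_le v t u := by
    rw [IsQuantale.sSup_mul_distrib]
    refine iSup₂_le fun q hq => ?_
    rw [IsQuantale.mul_sSup_distrib]
    exact iSup₂_le fun r hr => le_sSup (Thm.trans hq hr)

/-- The theory is varietal (relative to the universe `w` of sets): the separated quotients of the
`V`-categories of terms are small. -/
def IsVarietal (T : VTheory S B) : Prop :=
  ∀ A A' : Ty S.Ground, Small.{w} (Quotient (T.valVCat A A').setoid)

end VTheory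

end Theories

/-! ### Interpretation in autonomous categories and models -/

noncomputable section Semantics

variable {C : Type*} [Category.{w} C] [MonoidalCategory C]

/-- `(… (X 0 ⊗ X 1) ⊗ …) ⊗ X (n - 1)`, and the unit object for `n = 0`. -/
def nTensor : (n : ℕ) → (Fin n → C) → C
  | 0, _ => 𝟙_ C
  | 1, X => X 0
  | n + 2, X => nTensor (n + 1) (fun i => X i.castSucc) ⊗ X (Fin.last (n + 1))

/-- `f 0 ⊗ ⋯ ⊗ f (n - 1)`. -/
def nTensorHom : (n : ℕ) → {X Y : Fin n → C} → (∀ i, X i ⟶ Y i) → (nTensor n X ⟶ nTensor n Y)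
  | 0, _, _, _ => 𝟙 _
  | 1, _, _, f => f 0
  | n + 2, _, _, f => nTensorHom (n + 1) (fun i => f i.castSucc) ⊗ₘ f (Fin.last (n + 1))

/-- Appending a factor on the right: a left unitor if there is no other factor, and otherwise the
identity. -/
def nTensorSnoc : (n : ℕ) → (X : Fin (n + 1) → C) →
    (nTensor n (fun i => X i.castSucc) ⊗ X (Fin.last n) ≅ nTensor (n + 1) X)
  | 0, X => λ_ (X 0)
  | _ + 1, _ => Iso.refl _

variable [SymmetricCategory C] [MonoidalClosed C] {G : Type u₁}

/-- Interpretation of types. -/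
def tyObj (b : G → C) : Ty G → C
  | .ground X => b X
  | .unit => 𝟙_ C
  | .tensor A A' => tyObj b A ⊗ tyObj b A'
  | .lolli A A' => (ihom (tyObj b A)).obj (tyObj b A')

/-- Interpretation of contexts. -/
def ctxObj (b : G → C) : Ctx G → C
  | [] => 𝟙_ C
  | [p] => tyObj b p.2
  | p :: p' :: Γ => ctxObj b (p' :: Γ) ⊗ tyObj b p.2

/-- The housekeeping isomorphism `⟦Γ⟧ ⊗ ⟦A⟧ ≅ ⟦Γ, x : A⟧`. -/
def ctxSnoc (b : G → C) : (Γ : Ctx G) → (p : ℕ × Ty G) →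
    (ctxObj b Γ ⊗ tyObj b p.2 ≅ ctxObj b (p :: Γ))
  | [], p => λ_ (tyObj b p.2)
  | _ :: _, _ => Iso.refl _

/-- The housekeeping morphism `⟦E⟧ ⟶ ⟦Γ⟧ ⊗ ⟦Δ⟧` for a shuffle `E` of `Γ` and `Δ`: the composite of
the shuffling morphism `⟦E⟧ ⟶ ⟦Γ, Δ⟧` and the splitting morphism `⟦Γ, Δ⟧ ⟶ ⟦Γ⟧ ⊗ ⟦Δ⟧`. If the
rightmost variable comes from `Γ` it is moved past `Δ` by the symmetry. -/
def split (b : G → C) : {Γ Δ E : Ctx G} → Shuffle Γ Δ E → (ctxObj b E ⟶ ctxObj b Γ ⊗ ctxObj b Δ)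
  | _, _, _, .nil => (λ_ (𝟙_ C)).inv
  | _, _, _, .left (Γ := Γ) (Δ := Δ) (E := E) p s =>
      (ctxSnoc b E p).inv ≫ (split b s ▷ tyObj b p.2) ≫
        (α_ (ctxObj b Γ) (ctxObj b Δ) (tyObj b p.2)).hom ≫
        (ctxObj b Γ ◁ (β_ (ctxObj b Δ) (tyObj b p.2)).hom) ≫
        (α_ (ctxObj b Γ) (tyObj b p.2) (ctxObj b Δ)).inv ≫
        ((ctxSnoc b Γ p).hom ▷ ctxObj b Δ)
  | _, _, _, .right (Γ := Γ) (Δ := Δ) (E := E) p s =>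
      (ctxSnoc b E p).inv ≫ (split b s ▷ tyObj b p.2) ≫
        (α_ (ctxObj b Γ) (ctxObj b Δ) (tyObj b p.2)).hom ≫
        (ctxObj b Γ ◁ (ctxSnoc b Δ p).hom)

/-- The `n`-ary version of `split`. -/
def nSplit (b : G → C) : {n : ℕ} → {Γ : Fin n → Ctx G} → {E : Ctx G} → Shuffles n Γ E →
    (ctxObj b E ⟶ nTensor n (fun i => ctxObj b (Γ i)))
  | _, _, _, .nil _ => 𝟙 _
  | _, _, _, .snoc (n := n) Γ s s' =>
      split b s' ≫ (nSplit b s ▷ ctxObj b (Γ (Fin.last n))) ≫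
        (nTensorSnoc n (fun i => ctxObj b (Γ i))).hom

variable (C) (S : Signature.{u₁, u₂})

/-- An interpretation of the ground types and of the operation symbols. -/
structure Interp where
  obj : S.Ground → C
  op : ∀ f : S.Op, nTensor (S.arity f) (fun i => tyObj obj (S.dom f i)) ⟶ tyObj obj (S.cod f)

variable {C S}

/-- Interpretation of judgements, by recursion on derivations. -/
def Interp.sem (M : Interp C S) : {Γ : Ctx S.Ground} → {v : Tm S} → {A : Ty S.Ground} →
    Der Γ v A → (ctxObj M.obj Γ ⟶ tyObj M.obj A)
  | _, _, _, .var _ A => 𝟙 (tyObj M.obj A)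
  | _, _, _, .op f _ _ d s _ =>
      nSplit M.obj s ≫ nTensorHom (S.arity f) (fun i => M.sem (d i)) ≫ M.op f
  | _, _, _, .star => 𝟙 (𝟙_ C)
  | _, _, _, .pair d e s _ => split M.obj s ≫ (M.sem d ⊗ₘ M.sem e)
  | _, _, _, .pm (Δ := Δ) (A := A) (B := B) (x := x) (y := y) d e s _ =>
      split M.obj s ≫ (M.sem d ▷ ctxObj M.obj Δ) ≫
        (β_ (tyObj M.obj A ⊗ tyObj M.obj B) (ctxObj M.obj Δ)).hom ≫
        (α_ (ctxObj M.obj Δ) (tyObj M.obj A) (tyObj M.obj B)).inv ≫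
        ((ctxSnoc M.obj Δ (x, A)).hom ▷ tyObj M.obj B) ≫
        (ctxSnoc M.obj ((x, A) :: Δ) (y, B)).hom ≫ M.sem e
  | _, _, _, .letStar (Δ := Δ) d e s _ =>
      split M.obj s ≫ (M.sem d ▷ ctxObj M.obj Δ) ≫ (λ_ (ctxObj M.obj Δ)).hom ≫ M.sem e
  | _, _, _, .abs (Γ := Γ) (A := A) (B := B) (x := x) d =>
      transpose (ctxObj M.obj Γ) (tyObj M.obj A) (tyObj M.obj B)
        ((ctxSnoc M.obj Γ (x, A)).hom ≫ M.sem d)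
  | _, _, _, .app (A := A) (B := B) d e s _ =>
      split M.obj s ≫ (M.sem d ⊗ₘ M.sem e) ≫ appHom (tyObj M.obj A) (tyObj M.obj B)

variable {V : Type u₃} [CompleteLattice V] [CommMonoid V] [IsQuantale V] {B : Set V}

/-- The `V`-equation-in-context `Γ ▷ v =_q t : A` is satisfied: `q ≤ a(⟦v⟧, ⟦t⟧)`. (Derivations of
a judgement differ only in the names chosen for bound variables, which do not affect its
interpretation.) -/
def Interp.Satisfies [VCatSepAutonomous C V] (M : Interp C S) (e : VEq S B) : Prop :=
  ∀ (d : Der e.ctx e.lhs e.ty) (d' : Der e.ctx e.rhs e.ty),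
    e.label ≤ (VCatSepAutonomous.homVCat _ _ : VCat V _).hom (M.sem d) (M.sem d')

/-- The interpretation is a model of the theory. -/
def Interp.IsModel [VCatSepAutonomous C V] (M : Interp C S) (T : VTheory S B) : Prop :=
  ∀ e ∈ T.Ax, M.Satisfies e

end Semantics

end VLambda

/-! Soundness. The interpretation of a judgement is defined on derivations, so one must know that it
depends only on the term and that it turns substitution into composition. Both become manageable
when terms are interpreted over bracketed contexts (`Tree`) by a relation `Interp.Sem` in which
every housekeeping morphism is an arbitrary composite of structural isomorphisms (`Can`). The
coherence theorem `Can.unique` says that a structural morphism between trees without repeated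
variables is determined by its source and target. It is proved by pulling out one variable at a time
until only units remain. With linearity (the free variables of a subterm determine its share of the
context) it gives `Interp.Sem.unique`, while naturality of structural morphisms gives the
substitution lemma `Interp.Sem.subst`. Since derivations satisfy the relation (`Interp.sem_spec`),
every base equation reduces to a short identity in an autonomous category (`Interp.same_of_baseEq`).
Each rule on labels reduces to an inequality of the enrichment: a label `⊤` is reached because `⊤`
is the unit, and (arch) is sound because `q` is the least upper bound of the basis elements way
below it (`Interp.IsModel.holds`).

Completeness. The term model `Syn T` has types as objects and, as morphisms from `A` to `D`, closed
terms of type `A ⊸ D` up to provable equality with label `⊤` in both directions. Varietality allows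
these quotients to be shrunk to the universe of hom-sets. The tool is functional completeness
(`Pattern.exists_abstraction`). For a linear pattern `P` of type `A`, built from variables by `∗`
and `⊗`, the map `u ↦ u P` is, up to provable equality and preserving labels both ways, a bijection
from functions `A ⊸ D` to terms of type `D` that have the variables of `P` as well. Hence a morphism
out of a tensor product may be defined, and two of them compared, at a generic tuple of variables.
The equations of an autonomous category are therefore checked by letting morphisms act on elements,
that is, on terms-in-context. Pairing elements makes sense only if their variables are disjoint, so
an undefined element is added to make the operations total.

The distance of two morphisms is the supremum of the provable labels. In the canonical
interpretation a term interprets itself (`Syn.act_sem`), so the distance of `⟦v⟧` and `⟦t⟧` is the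
supremum of all `q` with `v =_q t` a theorem (`Syn.homDist_sem`). The axioms thus hold and the
interpretation is a model. Conversely, if `q` lies below that supremum, each `r ≪ q` in the basis
lies below a finite join of provable labels, so (join), (weak) and (arch) prove `v =_q t`
(`Thm.of_le_sSup`). -/

namespace VLambda

set_option linter.unusedSectionVars false

/-! ### Moving a factor of a tensor product to the right -/

section SwapRight

variable {C : Type*} [Category.{w} C] [MonoidalCategory C] [SymmetricCategory C]

/-- Moving the last but one factor to the end. -/
def swapRight (X Q T : C) : (X ⊗ Q) ⊗ T ⟶ (X ⊗ T) ⊗ Q :=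
  (α_ X Q T).hom ≫ X ◁ (β_ Q T).hom ≫ (α_ X T Q).inv

instance isIso_swapRight (X Q T : C) : IsIso (swapRight X Q T) := by
  unfold swapRight; infer_instance

theorem swapRight_naturality_left {X X' : C} (f : X ⟶ X') (Q T : C) :
    f ▷ Q ▷ T ≫ swapRight X' Q T = swapRight X Q T ≫ f ▷ T ▷ Q := by
  simp only [swapRight, Category.assoc, associator_naturality_left_assoc]
  rw [← associator_inv_naturality_left, whisker_exchange_assoc]

theorem swapRight_naturality_right (X Q : C) {T T' : C} (f : T ⟶ T') :
    (X ⊗ Q) ◁ f ≫ swapRight X Q T' = swapRight X Q T ≫ (X ◁ f) ▷ Q := by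
  simp only [swapRight, tensor_whiskerLeft, Category.assoc, Iso.inv_hom_id_assoc]
  rw [← whiskerLeft_comp_assoc, BraidedCategory.braiding_naturality_right]
  simp

/-- By the hexagon, moving `Q` past `Y ⊗ Z` is moving it past `Y` and then past `Z`. -/
theorem assoc_swapRight_left (X Q Y Z : C) :
    (α_ (X ⊗ Q) Y Z).hom ≫ swapRight X Q (Y ⊗ Z) =
      swapRight X Q Y ▷ Z ≫ swapRight (X ⊗ Y) Q Z ≫ (α_ X Y Z).hom ▷ Q := by
  simp only [swapRight, BraidedCategory.braiding_tensor_right_hom, comp_whiskerRight, Category.assoc]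
  monoidal

theorem assoc_swapRight_middle (X Y Q Z : C) :
    (α_ X (Y ⊗ Q) Z).hom ≫ X ◁ swapRight Y Q Z ≫ (α_ X (Y ⊗ Z) Q).inv =
      (α_ X Y Q).inv ▷ Z ≫ swapRight (X ⊗ Y) Q Z ≫ (α_ X Y Z).hom ▷ Q := by
  simp only [swapRight]
  monoidal

theorem braiding_swapRight (X Q T : C) :
    (β_ T (X ⊗ Q)).hom ≫ swapRight X Q T = (α_ T X Q).inv ≫ (β_ T X).hom ▷ Q := by
  simp only [swapRight, BraidedCategory.braiding_tensor_right_hom, Category.assoc]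
  simp [← whiskerLeft_comp_assoc]

theorem braiding_assoc_inv (X Q T : C) :
    (β_ (X ⊗ Q) T).hom ≫ (α_ T X Q).inv = swapRight X Q T ≫ (β_ X T).hom ▷ Q := by
  simp [swapRight, BraidedCategory.braiding_tensor_left_hom]

section

variable {S S' T T' Q R : C} {f : S ⟶ T} {e : S ⟶ S' ⊗ Q} {e' : T ⟶ T' ⊗ Q} {f' : S' ⟶ T'}

/-- The lemmas of this group with the shape `f ≫ e' = e ≫ f' ▷ Q` express that extracting a factor
`Q` after a structural morphism `f` amounts to extracting it before and applying a structural
morphism `f'` to what remains. They are the cases of `Can.extract`. -/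
theorem whiskerRight_extract (h : f ≫ e' = e ≫ f' ▷ Q) :
    f ▷ R ≫ e' ▷ R ≫ swapRight T' Q R = (e ▷ R ≫ swapRight S' Q R) ≫ (f' ▷ R) ▷ Q := by
  rw [Category.assoc, ← swapRight_naturality_left, ← comp_whiskerRight_assoc, h,
    comp_whiskerRight_assoc]

theorem whiskerLeft_extract (h : f ≫ e' = e ≫ f' ▷ Q) :
    R ◁ f ≫ R ◁ e' ≫ (α_ R T' Q).inv = (R ◁ e ≫ (α_ R S' Q).inv) ≫ (R ◁ f') ▷ Q := by
  rw [← whiskerLeft_comp_assoc, h]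
  simp

theorem whiskerRight_extract_right (e : R ⟶ S' ⊗ Q) :
    f ▷ R ≫ T ◁ e ≫ (α_ T S' Q).inv = (S ◁ e ≫ (α_ S S' Q).inv) ≫ (f ▷ S') ▷ Q := by
  rw [← whisker_exchange_assoc]
  simp

theorem whiskerLeft_extract_left (e : R ⟶ S' ⊗ Q) :
    R ◁ f ≫ e ▷ T ≫ swapRight S' Q T = (e ▷ S ≫ swapRight S' Q S) ≫ (S' ◁ f) ▷ Q := by
  rw [whisker_exchange_assoc, Category.assoc, swapRight_naturality_right]

theorem assoc_extract_left (e : S ⟶ S' ⊗ Q) :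
    (α_ S T R).hom ≫ e ▷ (T ⊗ R) ≫ swapRight S' Q (T ⊗ R) =
      ((e ▷ T ≫ swapRight S' Q T) ▷ R ≫ swapRight (S' ⊗ T) Q R) ≫ (α_ S' T R).hom ▷ Q := by
  rw [← associator_naturality_left_assoc, assoc_swapRight_left]
  simp

theorem assoc_extract_middle (e : T ⟶ T' ⊗ Q) :
    (α_ S T R).hom ≫ S ◁ (e ▷ R ≫ swapRight T' Q R) ≫ (α_ S (T' ⊗ R) Q).inv =
      ((S ◁ e ≫ (α_ S T' Q).inv) ▷ R ≫ swapRight (S ⊗ T') Q R) ≫ (α_ S T' R).hom ▷ Q := by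
  rw [whiskerLeft_comp, Category.assoc, ← associator_naturality_middle_assoc,
    assoc_swapRight_middle]
  simp

theorem assoc_extract_right (e : R ⟶ T' ⊗ Q) :
    (α_ S T R).hom ≫ S ◁ (T ◁ e ≫ (α_ T T' Q).inv) ≫ (α_ S (T ⊗ T') Q).inv =
      ((S ⊗ T) ◁ e ≫ (α_ (S ⊗ T) T' Q).inv) ≫ (α_ S T T').hom ▷ Q := by
  simp

theorem inv_extract {i : S ≅ T} {i' : S' ≅ T'} (h : i.hom ≫ e' = e ≫ i'.hom ▷ Q) :
    i.inv ≫ e = e' ≫ i'.inv ▷ Q := by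
  rw [Iso.inv_comp_eq, reassoc_of% h, ← comp_whiskerRight, Iso.hom_inv_id]
  simp

theorem unitor_extract (e : S ⟶ S' ⊗ Q) :
    (λ_ S).hom ≫ e = (𝟙_ C ◁ e ≫ (α_ (𝟙_ C) S' Q).inv) ≫ (λ_ S').hom ▷ Q := by
  simp

theorem braid_extract_left (e : T ⟶ T' ⊗ Q) :
    (β_ S T).hom ≫ e ▷ S ≫ swapRight T' Q S =
      (S ◁ e ≫ (α_ S T' Q).inv) ≫ (β_ S T').hom ▷ Q := by
  rw [← BraidedCategory.braiding_naturality_right_assoc, braiding_swapRight, Category.assoc]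

theorem braid_extract_right (e : S ⟶ S' ⊗ Q) :
    (β_ S T).hom ≫ T ◁ e ≫ (α_ T S' Q).inv =
      (e ▷ T ≫ swapRight S' Q T) ≫ (β_ S' T).hom ▷ Q := by
  rw [← BraidedCategory.braiding_naturality_left_assoc, braiding_assoc_inv, Category.assoc]

/-- Extracting a single leaf leaves a unit behind, while extracting the last variable of a context
leaves nothing. The right unitor accounts for the difference. -/
theorem snoc_extract_head (i : S ⊗ Q ≅ T) :
    i.hom ≫ i.inv = (S ◁ (λ_ Q).inv ≫ (α_ S (𝟙_ C) Q).inv) ≫ (ρ_ S).hom ▷ Q := by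
  rw [Iso.hom_inv_id]
  monoidal

theorem snoc_extract_tail (i : S ⊗ R ≅ T) (e : S ⊗ R ⟶ S' ⊗ Q) :
    i.hom ≫ i.inv ≫ e = e ≫ 𝟙 S' ▷ Q := by
  simp

theorem snoc_inv_extract_tail (i : S ⊗ R ≅ T) (e : S ⊗ R ⟶ S' ⊗ Q) :
    i.inv ≫ e = (i.inv ≫ e) ≫ 𝟙 S' ▷ Q := by
  simp

theorem isIso_tail (i : T ≅ S ⊗ R) (e : S ⟶ S' ⊗ Q) [IsIso e] :
    IsIso (i.hom ≫ e ▷ R ≫ swapRight S' Q R) := inferInstance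

end

section

variable {S S' T T' R : C} (u : S ⟶ 𝟙_ C) (v : T ⟶ 𝟙_ C) (x : R ⟶ 𝟙_ C)

/-- This identity and the next four are the cases of `Can.unitTree`: the canonical maps to the unit
are compatible with every generating structural morphism. -/
theorem unit_whiskerRight (f : S' ⟶ S) :
    ((f ≫ u) ⊗ₘ v) ≫ (λ_ (𝟙_ C)).hom = f ▷ T ≫ (u ⊗ₘ v) ≫ (λ_ (𝟙_ C)).hom := by
  simp [MonoidalCategory.tensorHom_def]

theorem unit_whiskerLeft (f : T' ⟶ T) :
    (u ⊗ₘ (f ≫ v)) ≫ (λ_ (𝟙_ C)).hom = S ◁ f ≫ (u ⊗ₘ v) ≫ (λ_ (𝟙_ C)).hom := by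
  simp [MonoidalCategory.tensorHom_def']

theorem unit_assoc :
    (((u ⊗ₘ v) ≫ (λ_ (𝟙_ C)).hom) ⊗ₘ x) ≫ (λ_ (𝟙_ C)).hom =
      (α_ S T R).hom ≫ (u ⊗ₘ ((v ⊗ₘ x) ≫ (λ_ (𝟙_ C)).hom)) ≫ (λ_ (𝟙_ C)).hom := by
  have h : (α_ S T R).hom ≫ (u ⊗ₘ (v ⊗ₘ x)) = ((u ⊗ₘ v) ⊗ₘ x) ≫ (α_ _ _ _).hom := by simp
  have h₁ : (u ⊗ₘ ((v ⊗ₘ x) ≫ (λ_ (𝟙_ C)).hom)) = (u ⊗ₘ (v ⊗ₘ x)) ≫ 𝟙_ C ◁ (λ_ (𝟙_ C)).hom := by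
    simp [← id_tensorHom]
  have h₂ : (((u ⊗ₘ v) ≫ (λ_ (𝟙_ C)).hom) ⊗ₘ x) = ((u ⊗ₘ v) ⊗ₘ x) ≫ (λ_ (𝟙_ C)).hom ▷ 𝟙_ C := by
    rw [← tensorHom_id, tensorHom_comp_tensorHom, Category.comp_id]
  rw [h₁, h₂, Category.assoc, Category.assoc, reassoc_of% h]
  monoidal

theorem unit_braid :
    (v ⊗ₘ u) ≫ (λ_ (𝟙_ C)).hom = (β_ T S).hom ≫ (u ⊗ₘ v) ≫ (λ_ (𝟙_ C)).hom := by
  rw [← BraidedCategory.braiding_naturality_assoc, braiding_leftUnitor, unitors_equal]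

theorem unit_unitor : (𝟙 (𝟙_ C) ⊗ₘ u) ≫ (λ_ (𝟙_ C)).hom = (λ_ S).hom ≫ u := by
  simp

end

end SwapRight

/-! ### Trees of typed variables and structural morphisms -/

section Coherence

/-- Bracketed contexts: trees whose leaves are typed variables or whole contexts. -/
inductive Tree (G : Type u₁) : Type u₁
  | nil : Tree G
  | leaf : ℕ × Ty G → Tree G
  | node : Tree G → Tree G → Tree G
  | ctx : Ctx G → Tree G

namespace Tree

variable {G : Type u₁}

/-- The typed variables of a tree; the head of the list is the rightmost one. -/
def leaves : Tree G → Ctx G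
  | nil => []
  | leaf p => [p]
  | node s t => leaves t ++ leaves s
  | ctx Γ => Γ

/-- The names of the variables of a tree. -/
def names (t : Tree G) : List ℕ := t.leaves.map Prod.fst

@[simp] theorem names_node (s t : Tree G) : (node s t).names = t.names ++ s.names := by
  simp [names, leaves]

@[simp] theorem names_nil : (nil : Tree G).names = [] := rfl

@[simp] theorem names_leaf (p : ℕ × Ty G) : (leaf p).names = [p.1] := rfl

@[simp] theorem names_ctx (Γ : Ctx G) : (ctx Γ).names = Γ.map Prod.fst := rfl

theorem mem_names_of_mem_leaves {t : Tree G} {p : ℕ × Ty G} (h : p ∈ t.leaves) :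
    p.1 ∈ t.names := List.mem_map_of_mem h

theorem leaves_nodup {t : Tree G} (h : t.names.Nodup) : t.leaves.Nodup := List.Nodup.of_map _ h

variable {C : Type*} [Category.{w} C] [MonoidalCategory C] [SymmetricCategory C] [MonoidalClosed C]

/-- Interpretation of trees. -/
noncomputable def obj (b : G → C) : Tree G → C
  | nil => 𝟙_ C
  | leaf p => tyObj b p.2
  | node s t => obj b s ⊗ obj b t
  | ctx Γ => ctxObj b Γ

end Tree

open VLambda.Tree

variable {G : Type u₁} {C : Type*} [Category.{w} C] [MonoidalCategory C] [SymmetricCategory C]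
  [MonoidalClosed C] {b : G → C}

/-- The structural morphisms between the interpretations of trees. -/
inductive Can (b : G → C) : ∀ s t : Tree G, (s.obj b ⟶ t.obj b) → Prop
  | id (s : Tree G) : Can b s s (𝟙 _)
  | comp {s t r : Tree G} {f : s.obj b ⟶ t.obj b} {g : t.obj b ⟶ r.obj b} :
      Can b s t f → Can b t r g → Can b s r (f ≫ g)
  | whiskerRight {s t : Tree G} {f : s.obj b ⟶ t.obj b} (r : Tree G) :
      Can b s t f → Can b (node s r) (node t r) (f ▷ r.obj b)
  | whiskerLeft {s t : Tree G} {f : s.obj b ⟶ t.obj b} (r : Tree G) :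
      Can b s t f → Can b (node r s) (node r t) (r.obj b ◁ f)
  | assoc (s t r : Tree G) : Can b (node (node s t) r) (node s (node t r)) (α_ _ _ _).hom
  | assoc_inv (s t r : Tree G) : Can b (node s (node t r)) (node (node s t) r) (α_ _ _ _).inv
  | unitor (s : Tree G) : Can b (node nil s) s (λ_ _).hom
  | unitor_inv (s : Tree G) : Can b s (node nil s) (λ_ _).inv
  | braid (s t : Tree G) : Can b (node s t) (node t s) (β_ _ _).hom
  | ctx_nil : Can b (ctx []) nil (𝟙 (𝟙_ C))
  | ctx_nil_inv : Can b nil (ctx []) (𝟙 (𝟙_ C))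
  | snoc (Γ : Ctx G) (p : ℕ × Ty G) : Can b (node (ctx Γ) (leaf p)) (ctx (p :: Γ)) (ctxSnoc b Γ p).hom
  | snoc_inv (Γ : Ctx G) (p : ℕ × Ty G) :
      Can b (ctx (p :: Γ)) (node (ctx Γ) (leaf p)) (ctxSnoc b Γ p).inv

namespace Can

theorem exists_inv {s t : Tree G} {f : s.obj b ⟶ t.obj b} (h : Can b s t f) :
    ∃ g, Can b t s g ∧ f ≫ g = 𝟙 _ ∧ g ≫ f = 𝟙 _ := by
  induction h with
  | id s => exact ⟨_, .id s, by simp⟩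
  | comp _ _ ih ih' =>
    obtain ⟨g, hg, h1, h2⟩ := ih
    obtain ⟨g', hg', h1', h2'⟩ := ih'
    exact ⟨_, hg'.comp hg, by simp [reassoc_of% h1', h1], by simp [reassoc_of% h2, h2']⟩
  | whiskerRight r _ ih =>
    obtain ⟨g, hg, h1, h2⟩ := ih
    exact ⟨_, hg.whiskerRight r, by simp [← comp_whiskerRight, h1, obj],
      by simp [← comp_whiskerRight, h2, obj]⟩
  | whiskerLeft r _ ih =>
    obtain ⟨g, hg, h1, h2⟩ := ih
    exact ⟨_, hg.whiskerLeft r, by simp [← MonoidalCategory.whiskerLeft_comp, h1, obj],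
      by simp [← MonoidalCategory.whiskerLeft_comp, h2, obj]⟩
  | assoc s t r => exact ⟨_, .assoc_inv s t r, Iso.hom_inv_id _, Iso.inv_hom_id _⟩
  | assoc_inv s t r => exact ⟨_, .assoc s t r, Iso.inv_hom_id _, Iso.hom_inv_id _⟩
  | unitor s => exact ⟨_, .unitor_inv s, Iso.hom_inv_id _, Iso.inv_hom_id _⟩
  | unitor_inv s => exact ⟨_, .unitor s, Iso.inv_hom_id _, Iso.hom_inv_id _⟩
  | braid s t =>
    exact ⟨_, .braid t s, SymmetricCategory.symmetry _ _, SymmetricCategory.symmetry _ _⟩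
  | ctx_nil => exact ⟨_, .ctx_nil_inv, Category.id_comp _, Category.id_comp _⟩
  | ctx_nil_inv => exact ⟨_, .ctx_nil, Category.id_comp _, Category.id_comp _⟩
  | snoc Γ p => exact ⟨_, .snoc_inv Γ p, Iso.hom_inv_id _, Iso.inv_hom_id _⟩
  | snoc_inv Γ p => exact ⟨_, .snoc Γ p, Iso.inv_hom_id _, Iso.hom_inv_id _⟩

theorem leaves_perm {s t : Tree G} {f : s.obj b ⟶ t.obj b} (h : Can b s t f) :
    s.leaves.Perm t.leaves := by
  induction h with
  | id s => exact .refl _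
  | comp _ _ ih ih' => exact ih.trans ih'
  | whiskerRight r _ ih => exact ih.append_left _
  | whiskerLeft r _ ih => exact ih.append_right _
  | assoc s t r => simp [leaves]
  | assoc_inv s t r => simp [leaves]
  | unitor s => simp [leaves]
  | unitor_inv s => simp [leaves]
  | braid s t => exact List.perm_append_comm
  | _ => simp [leaves]

theorem names_perm {s t : Tree G} {f : s.obj b ⟶ t.obj b} (h : Can b s t f) :
    s.names.Perm t.names := h.leaves_perm.map _

theorem tensor {s t s' t' : Tree G} {f : s.obj b ⟶ t.obj b} {g : s'.obj b ⟶ t'.obj b}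
    (h : Can b s t f) (h' : Can b s' t' g) : Can b (node s s') (node t t') (f ⊗ₘ g) := by
  rw [MonoidalCategory.tensorHom_def]
  exact (h.whiskerRight _).comp (h'.whiskerLeft _)

theorem unitor_right (s : Tree G) : Can b (node s nil) s (ρ_ _).hom := by
  rw [← braiding_leftUnitor]
  exact (Can.braid s nil).comp (.unitor s)

theorem unitor_right_inv (s : Tree G) : Can b s (node s nil) (ρ_ _).inv := by
  rw [← leftUnitor_inv_braiding]
  exact (Can.unitor_inv s).comp (.braid nil s)

end Can

/-! #### Existence -/

theorem exists_can_append (Γ Δ : Ctx G) : ∃ f, Can b (node (ctx Γ) (ctx Δ)) (ctx (Δ ++ Γ)) f := by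
  induction Δ with
  | nil => exact ⟨_, (Can.ctx_nil.whiskerLeft _).comp (.unitor_right _)⟩
  | cons p Δ ih =>
    obtain ⟨f, hf⟩ := ih
    exact ⟨_, (((Can.snoc_inv Δ p).whiskerLeft _).comp (.assoc_inv _ _ _)).comp
      ((hf.whiskerRight _).comp (.snoc _ p))⟩

theorem exists_can_ctx_leaves (t : Tree G) : ∃ f, Can b t (ctx t.leaves) f := by
  induction t with
  | nil => exact ⟨_, .ctx_nil_inv⟩
  | leaf p => exact ⟨_, (Can.unitor_inv _).comp ((Can.ctx_nil_inv.whiskerRight _).comp (.snoc [] p))⟩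
  | node s t ih ih' =>
    obtain ⟨f, hf⟩ := ih
    obtain ⟨g, hg⟩ := ih'
    obtain ⟨h, hh⟩ := exists_can_append (b := b) s.leaves t.leaves
    exact ⟨_, (hf.tensor hg).comp hh⟩
  | ctx Γ => exact ⟨_, .id _⟩

theorem exists_can_ctx_of_perm {Γ Δ : Ctx G} (h : Γ.Perm Δ) : ∃ f, Can b (ctx Γ) (ctx Δ) f := by
  induction h with
  | nil => exact ⟨_, .id _⟩
  | cons p _ ih =>
    obtain ⟨f, hf⟩ := ih
    exact ⟨_, (Can.snoc_inv _ p).comp ((hf.whiskerRight _).comp (.snoc _ p))⟩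
  | swap p q Γ =>
    exact ⟨_, ((Can.snoc_inv _ q).comp ((Can.snoc_inv _ p).whiskerRight _)).comp
      (((Can.assoc _ _ _).comp (((Can.braid _ _).whiskerLeft _).comp (.assoc_inv _ _ _))).comp
        (((Can.snoc _ q).whiskerRight _).comp (.snoc _ p)))⟩
  | trans _ _ ih ih' =>
    obtain ⟨f, hf⟩ := ih
    obtain ⟨g, hg⟩ := ih'
    exact ⟨_, hf.comp hg⟩

/-- Every tree can be flattened to the context of its leaves, and adjacent variables of a context
can be interchanged by the symmetry. -/
theorem exists_can {s t : Tree G} (h : s.leaves.Perm t.leaves) : ∃ f, Can b s t f := by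
  obtain ⟨f, hf⟩ := exists_can_ctx_leaves (b := b) s
  obtain ⟨g, hg⟩ := exists_can_ctx_leaves (b := b) t
  obtain ⟨g', hg', -⟩ := hg.exists_inv
  obtain ⟨k, hk⟩ := exists_can_ctx_of_perm (b := b) h
  exact ⟨_, (hf.comp hk).comp hg'⟩

/-! #### Uniqueness -/

/-- `Ext b q s s' e`: the morphism `e` extracts an occurrence of the variable `q` from `s`. -/
inductive Ext (b : G → C) (q : ℕ × Ty G) :
    ∀ s s' : Tree G, (s.obj b ⟶ s'.obj b ⊗ tyObj b q.2) → Prop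
  | leaf : Ext b q (leaf q) nil (λ_ _).inv
  | left {s s' : Tree G} {e : s.obj b ⟶ s'.obj b ⊗ tyObj b q.2} (t : Tree G) : Ext b q s s' e →
      Ext b q (node s t) (node s' t) (e ▷ t.obj b ≫ swapRight _ _ _)
  | right {t t' : Tree G} {e : t.obj b ⟶ t'.obj b ⊗ tyObj b q.2} (s : Tree G) : Ext b q t t' e →
      Ext b q (node s t) (node s t') (s.obj b ◁ e ≫ (α_ _ _ _).inv)
  | head (Γ : Ctx G) : Ext b q (ctx (q :: Γ)) (ctx Γ) (ctxSnoc b Γ q).inv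
  | tail {Γ : Ctx G} {s' : Tree G} {e : (ctx Γ).obj b ⟶ s'.obj b ⊗ tyObj b q.2} (p : ℕ × Ty G) :
      Ext b q (ctx Γ) s' e → Ext b q (ctx (p :: Γ)) (node s' (.leaf p))
        ((ctxSnoc b Γ p).inv ≫ e ▷ tyObj b p.2 ≫ swapRight _ _ _)

namespace Ext

variable {q : ℕ × Ty G}

theorem leaves_perm {s s' : Tree G} {e : s.obj b ⟶ s'.obj b ⊗ tyObj b q.2} (h : Ext b q s s' e) :
    s.leaves.Perm (q :: s'.leaves) := by
  induction h with
  | leaf => exact .refl _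
  | left t _ ih => exact (ih.append_left _).trans List.perm_middle
  | right s _ ih => exact ih.append_right _
  | head Γ => exact .refl _
  | tail p _ ih => exact (ih.cons p).trans (.swap _ _ _)

theorem exists_of_mem {s : Tree G} (h : q ∈ s.leaves) : ∃ s' e, Ext b q s s' e := by
  induction s with
  | nil => simp [leaves] at h
  | leaf p =>
    obtain rfl : q = p := by simpa [leaves] using h
    exact ⟨_, _, .leaf⟩
  | node s t ih ih' =>
    rcases List.mem_append.1 h with h | h
    · obtain ⟨_, _, h⟩ := ih' h
      exact ⟨_, _, .right s h⟩
    · obtain ⟨_, _, h⟩ := ih h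
      exact ⟨_, _, .left t h⟩
  | ctx Γ =>
    replace h : q ∈ Γ := h
    induction Γ with
    | nil => simp at h
    | cons p Γ ih =>
      by_cases hp : q = p
      · subst hp
        exact ⟨_, _, .head Γ⟩
      · obtain ⟨_, _, h⟩ := ih (by simpa [hp] using h)
        exact ⟨_, _, .tail p h⟩

theorem mem {s s' : Tree G} {e : s.obj b ⟶ s'.obj b ⊗ tyObj b q.2} (h : Ext b q s s' e) :
    q ∈ s.leaves := h.leaves_perm.symm.subset (by simp)

/-- If no leaf is repeated, `q` can be found in only one place. Equality is heterogeneous because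
the remaining tree is part of the codomain. -/
theorem unique {s s₁ : Tree G} {e₁ : s.obj b ⟶ s₁.obj b ⊗ tyObj b q.2} (h₁ : Ext b q s s₁ e₁)
    (hs : s.leaves.Nodup) {s₂ : Tree G} {e₂ : s.obj b ⟶ s₂.obj b ⊗ tyObj b q.2}
    (h₂ : Ext b q s s₂ e₂) : s₁ = s₂ ∧ e₁ ≍ e₂ := by
  induction h₁ generalizing s₂ with
  | leaf => cases h₂; exact ⟨rfl, .rfl⟩
  | left t h ih =>
    have hs' := List.nodup_append'.1 hs
    cases h₂ with
    | left _ h₂ => obtain ⟨rfl, h⟩ := ih hs'.2.1 h₂; cases h; exact ⟨rfl, .rfl⟩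
    | right _ h₂ => exact absurd h.mem (fun h' => hs'.2.2 h₂.mem h')
  | right t h ih =>
    have hs' := List.nodup_append'.1 hs
    cases h₂ with
    | left _ h₂ => exact absurd h.mem (fun h' => hs'.2.2 h' h₂.mem)
    | right _ h₂ => obtain ⟨rfl, h⟩ := ih hs'.1 h₂; cases h; exact ⟨rfl, .rfl⟩
  | head Γ =>
    cases h₂ with
    | head => exact ⟨rfl, .rfl⟩
    | tail _ h₂ => exact absurd h₂.mem (List.nodup_cons.1 hs).1
  | tail p h ih =>
    cases h₂ with
    | head => exact absurd h.mem (List.nodup_cons.1 hs).1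
    | tail _ h₂ =>
      obtain ⟨rfl, h⟩ := ih (List.nodup_cons.1 hs).2 h₂; cases h; exact ⟨rfl, .rfl⟩

theorem isIso {s s' : Tree G} {e : s.obj b ⟶ s'.obj b ⊗ tyObj b q.2} (h : Ext b q s s' e) :
    IsIso e := by
  induction h with
  | leaf => exact inferInstanceAs (IsIso (λ_ _).inv)
  | left t _ ih => exact inferInstanceAs (IsIso (_ ▷ _ ≫ swapRight _ _ _))
  | right s _ ih => exact inferInstanceAs (IsIso (_ ◁ _ ≫ (α_ _ _ _).inv))
  | head Γ => exact inferInstanceAs (IsIso (ctxSnoc b Γ q).inv)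
  | @tail Γ s' e p _ ih =>
    exact @isIso_tail _ _ _ _ _ _ _ _ _ (ctxSnoc b Γ p).symm e ih

end Ext

/-- Structural morphisms only rearrange leaves, so the leaf extracted from the target can be traced
back to the source. What remains is a structural morphism between trees with one leaf less, which is
the induction step of coherence. -/
theorem Can.extract {s t : Tree G} {f : s.obj b ⟶ t.obj b} (h : Can b s t f) {q : ℕ × Ty G}
    {t' : Tree G} {e' : t.obj b ⟶ t'.obj b ⊗ tyObj b q.2} (h' : Ext b q t t' e') :
    ∃ s' e f', Ext b q s s' e ∧ Can b s' t' f' ∧ f ≫ e' = e ≫ f' ▷ tyObj b q.2 := by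
  induction h generalizing t' with
  | id s => exact ⟨_, _, _, h', .id _, by simp⟩
  | comp _ _ ih ih' =>
    obtain ⟨_, _, _, h₁, h₂, h₃⟩ := ih' h'
    obtain ⟨_, _, _, h₁', h₂', h₃'⟩ := ih h₁
    exact ⟨_, _, _, h₁', h₂'.comp h₂, by simp [h₃, reassoc_of% h₃']⟩
  | whiskerRight r hc ih =>
    cases h' with
    | left _ h' =>
      obtain ⟨_, _, _, h₁, h₂, h₃⟩ := ih h'
      refine ⟨_, _, _, h₁.left r, h₂.whiskerRight r, ?_⟩
      exact whiskerRight_extract h₃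
    | right _ h' => exact ⟨_, _, _, h'.right _, hc.whiskerRight _, whiskerRight_extract_right _⟩
  | whiskerLeft r hc ih =>
    cases h' with
    | left _ h' => exact ⟨_, _, _, h'.left _, hc.whiskerLeft _, whiskerLeft_extract_left _⟩
    | right _ h' =>
      obtain ⟨_, _, _, h₁, h₂, h₃⟩ := ih h'
      refine ⟨_, _, _, h₁.right r, h₂.whiskerLeft r, ?_⟩
      exact whiskerLeft_extract h₃
  | assoc s t r =>
    cases h' with
    | left _ h' => exact ⟨_, _, _, (h'.left _).left _, .assoc _ _ _, assoc_extract_left _⟩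
    | right _ h' =>
      cases h' with
      | left _ h' => exact ⟨_, _, _, (h'.right _).left _, .assoc _ _ _, assoc_extract_middle _⟩
      | right _ h' => exact ⟨_, _, _, h'.right _, .assoc _ _ _, assoc_extract_right _⟩
  | assoc_inv s t r =>
    cases h' with
    | left _ h' =>
      cases h' with
      | left _ h' => exact ⟨_, _, _, h'.left _, .assoc_inv _ _ _, inv_extract (assoc_extract_left _)⟩
      | right _ h' => exact ⟨_, _, _, (h'.left _).right _, .assoc_inv _ _ _, inv_extract (assoc_extract_middle _)⟩
    | right _ h' => exact ⟨_, _, _, (h'.right _).right _, .assoc_inv _ _ _, inv_extract (assoc_extract_right _)⟩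
  | unitor s => exact ⟨_, _, _, h'.right _, .unitor _, unitor_extract _⟩
  | unitor_inv s =>
    cases h' with
    | left _ h' => cases h'
    | right _ h' => exact ⟨_, _, _, h', .unitor_inv _, inv_extract (unitor_extract _)⟩
  | braid s t =>
    cases h' with
    | left _ h' => exact ⟨_, _, _, h'.right _, .braid _ _, braid_extract_left _⟩
    | right _ h' => exact ⟨_, _, _, h'.left _, .braid _ _, braid_extract_right _⟩
  | ctx_nil => cases h'
  | ctx_nil_inv => cases h'
  | snoc Γ p =>
    cases h' with
    | head => exact ⟨_, _, _, Ext.leaf.right _, .unitor_right _, snoc_extract_head _⟩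
    | tail _ h' => exact ⟨_, _, _, h'.left _, .id _, snoc_extract_tail _ _⟩
  | snoc_inv Γ p =>
    cases h' with
    | left _ h' => exact ⟨_, _, _, h'.tail _, .id _, snoc_inv_extract_tail _ _⟩
    | right _ h' => cases h'; exact ⟨_, _, _, .head _, .unitor_right_inv _, inv_extract (snoc_extract_head _)⟩

/-- `UnitTree b s u`: the tree `s` has no leaves, and `u` is the composite of unitors to the unit. -/
inductive UnitTree (b : G → C) : ∀ s : Tree G, (s.obj b ⟶ 𝟙_ C) → Prop
  | nil : UnitTree b nil (𝟙 _)
  | ctx : UnitTree b (ctx []) (𝟙 (𝟙_ C))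
  | node {s t : Tree G} {u : s.obj b ⟶ 𝟙_ C} {v : t.obj b ⟶ 𝟙_ C} : UnitTree b s u →
      UnitTree b t v → UnitTree b (node s t) ((u ⊗ₘ v) ≫ (λ_ _).hom)

theorem UnitTree.exists_of_leaves {s : Tree G} (h : s.leaves = []) : ∃ u, UnitTree b s u := by
  induction s with
  | nil => exact ⟨_, .nil⟩
  | leaf p => simp [leaves] at h
  | node s t ih ih' =>
    obtain ⟨h', h⟩ := List.append_eq_nil_iff.1 h
    obtain ⟨_, h⟩ := ih h
    obtain ⟨_, h'⟩ := ih' h'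
    exact ⟨_, h.node h'⟩
  | ctx Γ => obtain rfl : Γ = [] := h; exact ⟨_, .ctx⟩

theorem UnitTree.unique {s : Tree G} {u v : s.obj b ⟶ 𝟙_ C} (h : UnitTree b s u)
    (h' : UnitTree b s v) : u = v := by
  induction h with
  | nil => cases h'; rfl
  | ctx => cases h'; rfl
  | node h₁ h₂ ih ih' =>
    cases h' with
    | node h₁' h₂' => rw [ih h₁', ih' h₂']

theorem UnitTree.isIso {s : Tree G} {u : s.obj b ⟶ 𝟙_ C} (h : UnitTree b s u) : IsIso u := by
  induction h with
  | nil => exact inferInstanceAs (IsIso (𝟙 (𝟙_ C)))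
  | ctx => exact inferInstanceAs (IsIso (𝟙 (𝟙_ C)))
  | node => exact inferInstanceAs (IsIso ((_ ⊗ₘ _) ≫ (λ_ _).hom))

/-- This is the base case of coherence: on trees without leaves, structural morphisms commute with
the canonical isomorphisms to the unit and so are determined by them. -/
theorem Can.unitTree {s t : Tree G} {f : s.obj b ⟶ t.obj b} (h : Can b s t f) {v : t.obj b ⟶ 𝟙_ C}
    (hv : UnitTree b t v) : UnitTree b s (f ≫ v) := by
  induction h with
  | id s => simpa using hv
  | comp _ _ ih ih' => simpa using ih (ih' hv)
  | whiskerRight r _ ih =>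
    cases hv with
    | node h h' => exact unit_whiskerRight (C := C) _ _ _ ▸ (ih h).node h'
  | whiskerLeft r _ ih =>
    cases hv with
    | node h h' => exact unit_whiskerLeft (C := C) _ _ _ ▸ h.node (ih h')
  | assoc s t r =>
    cases hv with
    | node h h' => cases h' with | node h' h'' => exact unit_assoc (C := C) _ _ _ ▸ (h.node h').node h''
  | assoc_inv s t r =>
    cases hv with
    | node h h'' =>
      cases h with
      | node h h' =>
        exact ((Iso.inv_comp_eq _).2 (unit_assoc (C := C) _ _ _)).symm ▸ h.node (h'.node h'')
  | unitor s =>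
    exact unit_unitor v ▸ (UnitTree.nil (b := b)).node hv
  | unitor_inv s =>
    cases hv with
    | node h h' => cases h; exact ((Iso.inv_comp_eq _).2 (unit_unitor (C := C) _)).symm ▸ h'
  | braid s t =>
    cases hv with
    | node h h' => exact unit_braid (C := C) _ _ ▸ h'.node h
  | ctx_nil => cases hv; exact (Category.comp_id (𝟙 (𝟙_ C))).symm ▸ UnitTree.ctx (b := b)
  | ctx_nil_inv => cases hv; exact (Category.comp_id (𝟙 (𝟙_ C))).symm ▸ UnitTree.nil (b := b)
  | snoc Γ p => cases hv
  | snoc_inv Γ p => cases hv with | node h h' => cases h'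

/-- Coherence: a structural morphism is determined by its source and its target if no variable
occurs twice. -/
theorem Can.unique {s t : Tree G} {f g : s.obj b ⟶ t.obj b} (hs : s.leaves.Nodup)
    (hf : Can b s t f) (hg : Can b s t g) : f = g := by
  -- Without leaves, both morphisms agree after an isomorphism to the unit. Otherwise extract a
  -- variable `q` from `t`. As `q` occurs once in `s`, both morphisms factor through the same
  -- extraction from `s`, and the induction hypothesis identifies the remainders.
  induction hn : t.leaves.length generalizing s t with
  | zero =>
    obtain ⟨v, hv⟩ := UnitTree.exists_of_leaves (b := b) (List.length_eq_zero_iff.1 hn)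
    have := hv.isIso
    exact (cancel_mono v).1 ((hf.unitTree hv).unique (hg.unitTree hv))
  | succ n ih =>
    obtain ⟨q, hq⟩ := List.exists_mem_of_length_pos (l := t.leaves) (by omega)
    obtain ⟨t', e', he'⟩ := Ext.exists_of_mem (b := b) hq
    obtain ⟨s₁, e₁, f', h₁, hf', hfe⟩ := hf.extract he'
    obtain ⟨s₂, e₂, g', h₂, hg', hge⟩ := hg.extract he'
    obtain ⟨rfl, he⟩ := h₁.unique hs h₂
    cases he
    have hn' := he'.leaves_perm.length_eq
    rw [ih (List.nodup_cons.1 ((h₁.leaves_perm.nodup_iff).1 hs)).2 hf' hg' (by simp at hn'; omega),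
      ← hge] at hfe
    have := he'.isIso
    exact (cancel_mono e').1 hfe

end Coherence

end VLambda

namespace VLambda

set_option linter.unusedSectionVars false

/-! ### Free variables and substitution -/

namespace Tm

variable {S : Signature.{u₁, u₂}}

/-- The variable `x` occurs free in the term. -/
def Free (x : ℕ) : Tm S → Prop
  | fvar y => y = x
  | bvar _ => False
  | op _ vs => ∃ i, Free x (vs i)
  | star => False
  | letStar v t => Free x v ∨ Free x t
  | pair v t => Free x v ∨ Free x t
  | letPair v t => Free x v ∨ Free x t
  | lam _ v => Free x v
  | app v t => Free x v ∨ Free x t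

/-- The bound variable of index `k` (relative to the root) does not dangle in the term. -/
def Absent : ℕ → Tm S → Prop
  | _, fvar _ => True
  | k, bvar i => i ≠ k
  | k, op _ vs => ∀ i, Absent k (vs i)
  | _, star => True
  | k, letStar v t => Absent k v ∧ Absent k t
  | k, pair v t => Absent k v ∧ Absent k t
  | k, letPair v t => Absent k v ∧ Absent (k + 2) t
  | k, lam _ v => Absent (k + 1) v
  | k, app v t => Absent k v ∧ Absent k t

/-- Replace the bound variable of index `k` by the free variable `x`. -/
def instFvar : ℕ → ℕ → Tm S → Tm S
  | _, _, fvar y => fvar y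
  | k, x, bvar i => if i = k then fvar x else bvar i
  | k, x, op f vs => op f (fun i => instFvar k x (vs i))
  | _, _, star => star
  | k, x, letStar v t => letStar (instFvar k x v) (instFvar k x t)
  | k, x, pair v t => pair (instFvar k x v) (instFvar k x t)
  | k, x, letPair v t => letPair (instFvar k x v) (instFvar (k + 2) x t)
  | k, x, lam A v => lam A (instFvar (k + 1) x v)
  | k, x, app v t => app (instFvar k x v) (instFvar k x t)

theorem close_eq_self {v : Tm S} {x : ℕ} (h : ¬ Free x v) (k : ℕ) : close k x v = v := by
  induction v generalizing k <;> simp_all [Free, close]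

theorem free_close {v : Tm S} {x y k : ℕ} : Free x (close k y v) ↔ Free x v ∧ x ≠ y := by
  induction v generalizing k with
  | fvar z => by_cases h : z = y <;> simp [close, h, Free] <;> grind
  | op f vs ih => simp [close, Free, ih]
  | _ => simp_all [close, Free] <;> tauto

theorem absent_close {v : Tm S} {x j k : ℕ} (h : j ≠ k) (hv : Absent k v) :
    Absent k (close j x v) := by
  induction v generalizing j k with
  | fvar z => by_cases hz : z = x <;> simp [close, hz, Absent, h]
  | _ => simp_all [close, Absent]

theorem absent_subst {v : Tm S} {σ : ℕ → Tm S} {k : ℕ} (hσ : ∀ x k, Absent k (σ x))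
    (hv : Absent k v) : Absent k (v.subst σ) := by
  induction v generalizing k <;> simp_all [subst, Absent]

theorem subst_congr {v : Tm S} {σ τ : ℕ → Tm S} (h : ∀ x, Free x v → σ x = τ x) :
    v.subst σ = v.subst τ := by
  induction v with
  | op f vs ih =>
    simp only [subst, op.injEq, heq_eq_eq, true_and]
    exact funext fun i => ih i fun x hx => h x ⟨i, hx⟩
  | _ => simp_all [subst, Free]

@[simp] theorem subst_fvar (v : Tm S) : v.subst fvar = v := by
  induction v <;> simp_all [subst]

theorem subst_eq_self {v : Tm S} {σ : ℕ → Tm S} (h : ∀ x, Free x v → σ x = fvar x) :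
    v.subst σ = v := by
  rw [subst_congr h, subst_fvar]

theorem subst_of_closed {v : Tm S} (h : ∀ x, ¬ Free x v) (σ : ℕ → Tm S) : v.subst σ = v :=
  subst_eq_self fun x hx => absurd hx (h x)

theorem subst_subst (v : Tm S) (σ τ : ℕ → Tm S) :
    (v.subst σ).subst τ = v.subst (fun x => (σ x).subst τ) := by
  induction v <;> simp_all [subst]

/-- Substitution passes under a binder once the bound variable has been renamed to some `y` that is
not free in the terms substituted for the other variables. -/
theorem subst_close {v : Tm S} {σ : ℕ → Tm S} {x y k : ℕ}
    (h : ∀ z, Free z v → z ≠ x → ¬ Free y (σ z)) :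
    (close k x v).subst σ = close k y (v.subst (Function.update σ x (fvar y))) := by
  induction v generalizing k with
  | fvar z =>
    by_cases hz : z = x
    · simp [close, subst, hz]
    · simp [close, subst, hz, close_eq_self (h z rfl hz)]
  | op f vs ih =>
    simp only [subst, close, op.injEq, heq_eq_eq, true_and]
    exact funext fun i => ih i fun z hz => h z ⟨i, hz⟩
  | _ => simp_all [subst, close, Free]

theorem instFvar_close {v : Tm S} {x y k : ℕ} (h : Absent k v) :
    instFvar k y (close k x v) = v.subst₁ x (fvar y) := by
  unfold subst₁
  induction v generalizing k with
  | fvar z => by_cases hz : z = x <;> simp [close, instFvar, subst, hz]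
  | _ => simp_all [subst, close, instFvar, Absent]

/-- Terms with the same abstraction agree up to renaming the abstracted variable. -/
theorem eq_subst_of_close_eq {v v' : Tm S} {x x' k : ℕ} (h : Absent k v) (h' : Absent k v')
    (e : close k x v = close k x' v') : v = v'.subst₁ x' (fvar x) := by
  rw [← instFvar_close h', ← e, instFvar_close h, subst₁, subst_eq_self]
  intro z _
  by_cases hz : z = x <;> simp [hz]

/-- The two bound variables are renamed one after the other, first `y'` and then `x'`. The
hypotheses `hxy` and `hx` ensure that `x` is still fresh when the first renaming passes under the
binder of `x'`. -/
theorem eq_subst_of_close_close_eq {v v' : Tm S} {x y x' y' : ℕ} (hv : ∀ k, Absent k v)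
    (hv' : ∀ k, Absent k v') (hxy : x ≠ y) (hx : ∀ z, Free z v' → z ≠ x' → z ≠ y' → z ≠ x)
    (e : close 0 y (close 1 x v) = close 0 y' (close 1 x' v')) :
    v = v'.subst (Function.update (Function.update fvar y' (fvar y)) x' (fvar x)) := by
  have h := eq_subst_of_close_eq (absent_close one_ne_zero (hv 0)) (absent_close one_ne_zero (hv' 0)) e
  rw [subst₁, subst_close (y := x)] at h
  · refine (eq_subst_of_close_eq (hv 1) ?_ h).trans ?_
    · refine absent_subst (fun z k => ?_) (hv' 1)
      by_cases hz : z = x' <;> by_cases hz' : z = y' <;> simp [hz, hz', Function.update, Absent]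
      split_ifs <;> simp [Absent]
    · rw [subst₁, subst_eq_self]
      intro z _
      by_cases hz : z = x <;> simp [hz]
  · intro z hz hzx
    by_cases hzy : z = y'
    · simp [hzy, Free, hxy.symm]
    · simp [hzy, Free, hx z hz hzx hzy]

end Tm

end VLambda

namespace VLambda

set_option linter.unusedSectionVars false

/-! ### Substitution of trees for the leaves of a tree. -/

section Binding

variable {G : Type u₁} {C : Type*} [Category.{w} C] [MonoidalCategory C] [SymmetricCategory C]
  [MonoidalClosed C] {b : G → C}

open VLambda.Tree

/-- `Bind b E t s h`: the tree `s` arises from `t` by replacing every leaf `p` by some tree `s'`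
that comes with a morphism `h'` to the type of `p` satisfying `E p s' h'`; the morphism `h` is the
tensor product of these morphisms. -/
inductive Bind (b : G → C) (E : ∀ (p : ℕ × Ty G) (s : Tree G), (s.obj b ⟶ tyObj b p.2) → Prop) :
    ∀ t s : Tree G, (s.obj b ⟶ t.obj b) → Prop
  | nil : Bind b E nil nil (𝟙 _)
  | leaf {p : ℕ × Ty G} {s : Tree G} {h : s.obj b ⟶ tyObj b p.2} :
      E p s h → Bind b E (leaf p) s h
  | node {t s t' s' : Tree G} {h : s.obj b ⟶ t.obj b} {h' : s'.obj b ⟶ t'.obj b} :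
      Bind b E t s h → Bind b E t' s' h' → Bind b E (node t t') (node s s') (h ⊗ₘ h')
  | ctx_nil : Bind b E (ctx []) nil (𝟙 (𝟙_ C))
  | ctx_cons {Γ : Ctx G} {p : ℕ × Ty G} {s s' : Tree G} {h : s.obj b ⟶ (ctx Γ).obj b}
      {h' : s'.obj b ⟶ tyObj b p.2} : Bind b E (ctx Γ) s h → E p s' h' →
      Bind b E (ctx (p :: Γ)) (node s s') ((h ⊗ₘ h') ≫ (ctxSnoc b Γ p).hom)

variable {E : ∀ (p : ℕ × Ty G) (s : Tree G), (s.obj b ⟶ tyObj b p.2) → Prop}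

theorem Bind.mono {E' : ∀ (p : ℕ × Ty G) (s : Tree G), (s.obj b ⟶ tyObj b p.2) → Prop}
    {t s : Tree G} {h : s.obj b ⟶ t.obj b} (H : Bind b E t s h)
    (hE : ∀ p ∈ t.leaves, ∀ s h, E p s h → E' p s h) : Bind b E' t s h := by
  induction H with
  | nil => exact .nil
  | leaf h => exact .leaf (hE _ (by simp [leaves]) _ _ h)
  | node _ _ ih ih' =>
    exact .node (ih fun p hp => hE p (by simp [leaves, hp]))
      (ih' fun p hp => hE p (by simp [leaves, hp]))
  | ctx_nil => exact .ctx_nil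
  | ctx_cons _ h ih =>
    exact .ctx_cons (ih fun p hp => hE p (List.mem_cons_of_mem _ hp))
      (hE _ (by simp [leaves]) _ _ h)

theorem Bind.exists_of_mem {t s : Tree G} {h : s.obj b ⟶ t.obj b} (H : Bind b E t s h)
    {p : ℕ × Ty G} (hp : p ∈ t.leaves) : ∃ s' h', E p s' h' ∧ s'.names ⊆ s.names := by
  induction H with
  | nil => simp [leaves] at hp
  | leaf h => obtain rfl : p = _ := by simpa [leaves] using hp
              exact ⟨_, _, h, List.Subset.refl _⟩
  | node _ _ ih ih' =>
    rcases List.mem_append.1 hp with hp | hp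
    · obtain ⟨_, _, h, hs⟩ := ih' hp
      exact ⟨_, _, h, fun x hx => by simp [hs hx]⟩
    · obtain ⟨_, _, h, hs⟩ := ih hp
      exact ⟨_, _, h, fun x hx => by simp [hs hx]⟩
  | ctx_nil => simp [leaves] at hp
  | ctx_cons _ h ih =>
    rcases List.mem_cons.1 hp with rfl | hp
    · exact ⟨_, _, h, fun x hx => by simp [hx]⟩
    · obtain ⟨_, _, h, hs⟩ := ih hp
      exact ⟨_, _, h, fun x hx => by simp [hs hx]⟩

section

variable {X X' Y Y' Z Z' : C}

theorem tensor_assoc_inv (f : X ⟶ X') (g : Y ⟶ Y') (h : Z ⟶ Z') :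
    (α_ X Y Z).inv ≫ ((f ⊗ₘ g) ⊗ₘ h) = (f ⊗ₘ (g ⊗ₘ h)) ≫ (α_ X' Y' Z').inv := by
  simp

theorem tensor_whiskerRight {f : X ⟶ X'} {k : X ⟶ Y} {h : X' ⟶ Y'} {k' : Y ⟶ Y'}
    (e : f ≫ h = k ≫ k') (g : Z ⟶ Z') : f ▷ Z ≫ (h ⊗ₘ g) = (k ⊗ₘ g) ≫ k' ▷ Z' := by
  rw [← tensorHom_id, ← tensorHom_id, tensorHom_comp_tensorHom, tensorHom_comp_tensorHom, e]
  simp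

theorem tensor_whiskerLeft {f : X ⟶ X'} {k : X ⟶ Y} {h : X' ⟶ Y'} {k' : Y ⟶ Y'}
    (e : f ≫ h = k ≫ k') (g : Z ⟶ Z') : Z ◁ f ≫ (g ⊗ₘ h) = (g ⊗ₘ k) ≫ Z' ◁ k' := by
  rw [← id_tensorHom, ← id_tensorHom, tensorHom_comp_tensorHom, tensorHom_comp_tensorHom, e]
  simp

theorem tensor_unitor_inv (f : X ⟶ X') : (λ_ X).inv ≫ (𝟙 (𝟙_ C) ⊗ₘ f) = f ≫ (λ_ X').inv := by
  simp

theorem tensor_iso_inv (i : X ⊗ Y ≅ Z) (f : X' ⟶ X) (g : Y' ⟶ Y) :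
    𝟙 _ ≫ (f ⊗ₘ g) = ((f ⊗ₘ g) ≫ i.hom) ≫ i.inv := by
  simp

theorem tensor_unitor (f : X ⟶ X') : (λ_ X).hom ≫ f = (𝟙 (𝟙_ C) ⊗ₘ f) ≫ (λ_ X').hom := by
  simp

end

/-- Structural morphisms are natural in the leaves: instead of rearranging `t` after the
substitution, one may rearrange the substituted trees as blocks before it. -/
theorem Can.bind {t t' : Tree G} {f : t.obj b ⟶ t'.obj b} (hf : Can b t t' f) {s : Tree G}
    {h : s.obj b ⟶ t.obj b} (H : Bind b E t s h) :
    ∃ s' h' f', Bind b E t' s' h' ∧ Can b s s' f' ∧ f' ≫ h' = h ≫ f := by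
  induction hf generalizing s with
  | id t => exact ⟨_, _, _, H, .id _, by simp⟩
  | comp _ _ ih ih' =>
    obtain ⟨_, _, _, H', hc, e⟩ := ih H
    obtain ⟨_, _, _, H'', hc', e'⟩ := ih' H'
    exact ⟨_, _, _, H'', hc.comp hc', by rw [Category.assoc, e', reassoc_of% e]⟩
  | whiskerRight r _ ih =>
    cases H with
    | @node _ _ _ s' h h' H₁ H₂ =>
    obtain ⟨s'', h'', f', H', hc, e⟩ := ih H₁
    refine ⟨_, _, _, H'.node H₂, hc.whiskerRight _, tensor_whiskerRight e _⟩
  | whiskerLeft r _ ih =>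
    cases H with
    | node H₁ H₂ =>
    obtain ⟨s'', h'', f', H', hc, e⟩ := ih H₂
    refine ⟨_, _, _, H₁.node H', hc.whiskerLeft _, tensor_whiskerLeft e _⟩
  | assoc t₁ t₂ t₃ =>
    cases H with
    | node H₁ H₃ =>
    cases H₁ with
    | node H₁ H₂ =>
    exact ⟨_, _, _, H₁.node (H₂.node H₃), .assoc _ _ _, (associator_naturality _ _ _).symm⟩
  | assoc_inv t₁ t₂ t₃ =>
    cases H with
    | node H₁ H₂ =>
    cases H₂ with
    | node H₂ H₃ =>
    exact ⟨_, _, _, (H₁.node H₂).node H₃, .assoc_inv _ _ _, tensor_assoc_inv _ _ _⟩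
  | unitor t =>
    cases H with
    | node H₁ H₂ =>
    cases H₁
    exact ⟨_, _, _, H₂, .unitor _, tensor_unitor _⟩
  | unitor_inv t =>
    exact ⟨_, _, _, Bind.nil.node H, .unitor_inv _, tensor_unitor_inv _⟩
  | braid t₁ t₂ =>
    cases H with
    | node H₁ H₂ =>
    exact ⟨_, _, _, H₂.node H₁, .braid _ _, (BraidedCategory.braiding_naturality _ _).symm⟩
  | ctx_nil => cases H; exact ⟨_, _, _, .nil, .id _, rfl⟩
  | ctx_nil_inv => cases H; exact ⟨_, _, _, .ctx_nil, .id _, rfl⟩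
  | snoc Γ p =>
    cases H with
    | node H₁ H₂ => cases H₂ with
      | leaf H₂ => exact ⟨_, _, _, H₁.ctx_cons H₂, .id _, Category.id_comp _⟩
  | snoc_inv Γ p =>
    cases H with
    | ctx_cons H₁ H₂ => exact ⟨_, _, _, H₁.node (.leaf H₂), .id _, tensor_iso_inv _ _ _⟩

end Binding

/-! ### Interpretation relative to trees -/

section Interpretation

open VLambda.Tree

/-- What is interpreted: a term or a tuple of terms. -/
inductive Subject (S : Signature.{u₁, u₂}) : Type (max u₁ u₂)
  | tm : Tm S → Subject S
  | tup : (n : ℕ) → (Fin n → Tm S) → Subject S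

/-- A type or a tuple of types. -/
inductive Target (G : Type u₁) : Type u₁
  | ty : Ty G → Target G
  | tup : (n : ℕ) → (Fin n → Ty G) → Target G

variable {S : Signature.{u₁, u₂}} {C : Type*} [Category.{w} C] [MonoidalCategory C]
  [SymmetricCategory C] [MonoidalClosed C]

/-- The codomain of the interpretation. -/
noncomputable def Target.obj (b : S.Ground → C) : Target S.Ground → C
  | ty A => tyObj b A
  | tup n A => nTensor n (fun i => tyObj b (A i))

namespace Subject

/-- Simultaneous substitution. -/
def subst (σ : ℕ → Tm S) : Subject S → Subject S
  | tm v => tm (v.subst σ)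
  | tup n v => tup n (fun i => (v i).subst σ)

/-- The variable `x` occurs free. -/
def Free (x : ℕ) : Subject S → Prop
  | tm v => v.Free x
  | tup _ v => ∃ i, (v i).Free x

/-- The bound variable of index `k` does not dangle. -/
def Absent (k : ℕ) : Subject S → Prop
  | tm v => v.Absent k
  | tup _ v => ∀ i, (v i).Absent k

end Subject

/-- The interpretation of terms and tuples of terms in bracketed contexts. -/
inductive Interp.Sem (M : Interp C S) :
    ∀ (t : Tree S.Ground) (_ : Subject S) (o : Target S.Ground), (t.obj M.obj ⟶ o.obj M.obj) → Prop
  | var {t : Tree S.Ground} {x : ℕ} {A : Ty S.Ground} {c : t.obj M.obj ⟶ (leaf (x, A)).obj M.obj} :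
      t.names.Nodup → Can M.obj t (leaf (x, A)) c → M.Sem t (.tm (.fvar x)) (.ty A) c
  | op {t : Tree S.Ground} {f : S.Op} {v : Fin (S.arity f) → Tm S}
      {k : t.obj M.obj ⟶ (Target.tup (S.arity f) (S.dom f)).obj M.obj} :
      M.Sem t (.tup (S.arity f) v) (.tup (S.arity f) (S.dom f)) k → M.Sem t (.tm (.op f v)) (.ty (S.cod f)) (k ≫ M.op f)
  | star {t : Tree S.Ground} {c : t.obj M.obj ⟶ nil.obj M.obj} :
      t.names.Nodup → Can M.obj t nil c → M.Sem t (.tm .star) (.ty .unit) c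
  | pair {t t₁ t₂ : Tree S.Ground} {v u : Tm S} {A B : Ty S.Ground}
      {c : t.obj M.obj ⟶ (node t₁ t₂).obj M.obj} {f : t₁.obj M.obj ⟶ tyObj M.obj A}
      {g : t₂.obj M.obj ⟶ tyObj M.obj B} : t.names.Nodup → Can M.obj t (node t₁ t₂) c →
      M.Sem t₁ (.tm v) (.ty A) f → M.Sem t₂ (.tm u) (.ty B) g →
      M.Sem t (.tm (.pair v u)) (.ty (.tensor A B)) (c ≫ (f ⊗ₘ g))
  | letPair {t t₁ t₂ : Tree S.Ground} {v u u₀ : Tm S} {A B D : Ty S.Ground} {x y : ℕ}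
      {c : t.obj M.obj ⟶ (node t₂ t₁).obj M.obj} {f : t₁.obj M.obj ⟶ tyObj M.obj (.tensor A B)}
      {g : (node t₂ (node (leaf (x, A)) (leaf (y, B)))).obj M.obj ⟶ tyObj M.obj D} :
      t.names.Nodup → Can M.obj t (node t₂ t₁) c → M.Sem t₁ (.tm v) (.ty (.tensor A B)) f →
      M.Sem (node t₂ (node (leaf (x, A)) (leaf (y, B)))) (.tm u) (.ty D) g →
      u₀ = Tm.close 0 y (Tm.close 1 x u) →
      M.Sem t (.tm (.letPair v u₀)) (.ty D) (c ≫ t₂.obj M.obj ◁ f ≫ g)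
  | letStar {t t₁ t₂ : Tree S.Ground} {v u : Tm S} {A : Ty S.Ground}
      {c : t.obj M.obj ⟶ (node t₂ t₁).obj M.obj} {f : t₁.obj M.obj ⟶ tyObj M.obj .unit}
      {g : t₂.obj M.obj ⟶ tyObj M.obj A} :
      t.names.Nodup → Can M.obj t (node t₂ t₁) c → M.Sem t₁ (.tm v) (.ty .unit) f →
      M.Sem t₂ (.tm u) (.ty A) g →
      M.Sem t (.tm (.letStar v u)) (.ty A) (c ≫ t₂.obj M.obj ◁ f ≫ (ρ_ (t₂.obj M.obj)).hom ≫ g)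
  | lam {t t' : Tree S.Ground} {v v₀ : Tm S} {A B : Ty S.Ground} {x : ℕ}
      {c : t.obj M.obj ⟶ t'.obj M.obj} {f : (node t' (leaf (x, A))).obj M.obj ⟶ tyObj M.obj B} :
      t.names.Nodup → Can M.obj t t' c → M.Sem (node t' (leaf (x, A))) (.tm v) (.ty B) f →
      v₀ = Tm.close 0 x v →
      M.Sem t (.tm (.lam A v₀)) (.ty (.lolli A B))
        (c ≫ transpose (t'.obj M.obj) (tyObj M.obj A) (tyObj M.obj B) f)
  | app {t t₁ t₂ : Tree S.Ground} {v u : Tm S} {A B : Ty S.Ground}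
      {c : t.obj M.obj ⟶ (node t₁ t₂).obj M.obj} {f : t₁.obj M.obj ⟶ tyObj M.obj (.lolli A B)}
      {g : t₂.obj M.obj ⟶ tyObj M.obj A} : t.names.Nodup → Can M.obj t (node t₁ t₂) c →
      M.Sem t₁ (.tm v) (.ty (.lolli A B)) f → M.Sem t₂ (.tm u) (.ty A) g →
      M.Sem t (.tm (.app v u)) (.ty B) (c ≫ (f ⊗ₘ g) ≫ appHom (tyObj M.obj A) (tyObj M.obj B))
  | tup_zero {t : Tree S.Ground} {v : Fin 0 → Tm S} {A : Fin 0 → Ty S.Ground}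
      {c : t.obj M.obj ⟶ nil.obj M.obj} :
      t.names.Nodup → Can M.obj t nil c → M.Sem t (.tup 0 v) (.tup 0 A) c
  | tup_succ {t t₁ t₂ : Tree S.Ground} {n : ℕ} {v : Fin (n + 1) → Tm S}
      {A : Fin (n + 1) → Ty S.Ground} {c : t.obj M.obj ⟶ (node t₁ t₂).obj M.obj}
      {f : t₁.obj M.obj ⟶ nTensor n (fun i => tyObj M.obj (A i.castSucc))}
      {g : t₂.obj M.obj ⟶ tyObj M.obj (A (Fin.last n))} :
      t.names.Nodup → Can M.obj t (node t₁ t₂) c →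
      M.Sem t₁ (.tup n (fun i => v i.castSucc)) (.tup n (fun i => A i.castSucc)) f →
      M.Sem t₂ (.tm (v (Fin.last n))) (.ty (A (Fin.last n))) g →
      M.Sem t (.tup (n + 1) v) (.tup (n + 1) A)
        (c ≫ (f ⊗ₘ g) ≫ (nTensorSnoc n (fun i => tyObj M.obj (A i))).hom)

namespace Interp.Sem

variable {M : Interp C S}

theorem nodup {t : Tree S.Ground} {j : Subject S} {o : Target S.Ground} {f : t.obj M.obj ⟶ o.obj M.obj}
    (h : M.Sem t j o f) : t.names.Nodup := by
  induction h <;> assumption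

theorem of_eq {t : Tree S.Ground} {j : Subject S} {o : Target S.Ground} {f g : t.obj M.obj ⟶ o.obj M.obj}
    (h : M.Sem t j o f) (e : f = g) : M.Sem t j o g := e ▸ h

/-- Every rule starts with an arbitrary structural morphism, which absorbs `c`; the rule for
operation symbols passes `c` on to the tuple of arguments. -/
theorem can {t t' : Tree S.Ground} {j : Subject S} {o : Target S.Ground} {f : t.obj M.obj ⟶ o.obj M.obj}
    (h : M.Sem t j o f) {c : t'.obj M.obj ⟶ t.obj M.obj} (hc : Can M.obj t' t c) :
    M.Sem t' j o (c ≫ f) := by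
  have hn := hc.names_perm.nodup_iff.2 h.nodup
  induction h with
  | var _ hc' => exact .var hn (hc.comp hc')
  | op _ ih => exact (ih hc).op.of_eq (Category.assoc _ _ _)
  | star _ hc' => exact .star hn (hc.comp hc')
  | pair _ hc' h h' => exact (Sem.pair hn (hc.comp hc') h h').of_eq (Category.assoc _ _ _)
  | letPair _ hc' h h' e =>
    exact (Sem.letPair hn (hc.comp hc') h h' e).of_eq (Category.assoc _ _ _)
  | letStar _ hc' h h' => exact (Sem.letStar hn (hc.comp hc') h h').of_eq (Category.assoc _ _ _)
  | lam _ hc' h e => exact (Sem.lam hn (hc.comp hc') h e).of_eq (Category.assoc _ _ _)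
  | app _ hc' h h' => exact (Sem.app hn (hc.comp hc') h h').of_eq (Category.assoc _ _ _)
  | tup_zero _ hc' => exact .tup_zero hn (hc.comp hc')
  | tup_succ _ hc' h h' => exact (Sem.tup_succ hn (hc.comp hc') h h').of_eq (Category.assoc _ _ _)

/-- This is linearity: no rule drops a variable. It will force two interpretations of a term to
split the context in the same way. -/
theorem free_iff {t : Tree S.Ground} {j : Subject S} {o : Target S.Ground} {f : t.obj M.obj ⟶ o.obj M.obj}
    (h : M.Sem t j o f) (x : ℕ) : j.Free x ↔ x ∈ t.names := by
  induction h with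
  | var _ hc => simp [hc.names_perm.mem_iff, Subject.Free, Tm.Free, eq_comm]
  | op _ ih => exact ih
  | star _ hc => simp [hc.names_perm.mem_iff, Subject.Free, Tm.Free]
  | pair _ hc _ _ ih ih' =>
    simp_all [hc.names_perm.mem_iff, Subject.Free, Tm.Free, or_comm]
  | letPair _ hc _ h' e ih ih' =>
    have := h'.nodup
    simp_all [hc.names_perm.mem_iff, Subject.Free, Tm.Free, Tm.free_close]
    grind
  | letStar _ hc _ _ ih ih' =>
    simp_all [hc.names_perm.mem_iff, Subject.Free, Tm.Free]
  | lam _ hc h e ih =>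
    have := h.nodup
    simp_all [hc.names_perm.mem_iff, Subject.Free, Tm.Free, Tm.free_close]
    grind
  | app _ hc _ _ ih ih' =>
    simp_all [hc.names_perm.mem_iff, Subject.Free, Tm.Free, or_comm]
  | tup_zero _ hc => simp [hc.names_perm.mem_iff, Subject.Free]
  | tup_succ _ hc _ _ ih ih' =>
    simp_all [hc.names_perm.mem_iff, Subject.Free, Fin.exists_fin_succ', or_comm]

/-- Interpreted terms are locally closed, because binders enter only by closing a named variable. -/
theorem absent {t : Tree S.Ground} {j : Subject S} {o : Target S.Ground} {f : t.obj M.obj ⟶ o.obj M.obj}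
    (h : M.Sem t j o f) (k : ℕ) : j.Absent k := by
  induction h generalizing k with
  | letPair _ hc _ _ e ih ih' =>
    subst e
    exact ⟨ih k, Tm.absent_close (by omega) (Tm.absent_close (by omega) (ih' _))⟩
  | lam _ hc _ e ih => subst e; exact Tm.absent_close (by omega) (ih _)
  | tup_succ _ hc _ _ ih ih' =>
    exact Fin.lastCases (ih' k) (ih k)
  | op _ ih => exact ih k
  | tup_zero => exact fun i => i.elim0
  | _ => simp_all [Subject.Absent, Tm.Absent]

end Interp.Sem

end Interpretation

end VLambda

namespace VLambda

set_option linter.unusedSectionVars false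

/-! ### Naturality of transposition. -/

section Transpose

variable {C : Type*} [Category.{w} C] [MonoidalCategory C] [SymmetricCategory C] [MonoidalClosed C]

theorem transpose_naturality_left {Y Y' X Z : C} (k : Y' ⟶ Y) (f : Y ⊗ X ⟶ Z) :
    transpose Y' X Z (k ▷ X ≫ f) = k ≫ transpose Y X Z f := by
  simp only [transpose, Equiv.trans_apply, Iso.homCongr_apply, Iso.refl_hom, Category.comp_id]
  rw [← Adjunction.homEquiv_naturality_left]
  simp

theorem transpose_symm_naturality_left {Y Y' X Z : C} (k : Y' ⟶ Y) (f : Y ⟶ (ihom X).obj Z) :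
    (transpose Y' X Z).symm (k ≫ f) = k ▷ X ≫ (transpose Y X Z).symm f := by
  rw [Equiv.symm_apply_eq, transpose_naturality_left, Equiv.apply_symm_apply]

theorem whiskerRight_appHom {Y X Z : C} (f : Y ⟶ (ihom X).obj Z) :
    f ▷ X ≫ appHom X Z = (transpose Y X Z).symm f := by
  rw [appHom, ← transpose_symm_naturality_left, Category.comp_id]

end Transpose

section Interpretation

open VLambda.Tree

variable {S : Signature.{u₁, u₂}} {C : Type*} [Category.{w} C] [MonoidalCategory C]
  [SymmetricCategory C] [MonoidalClosed C] {M : Interp C S}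

section

variable {X X' Y Y' Z Z' W A B D : C}

/-- Here and in the four identities that follow, `e` is the square produced by `Can.bind`: `c'`
rearranges the substituted tree as `c` rearranges the original one. They are the compositional cases
of `Interp.Sem.subst`. -/
theorem tensor_bind {k : X ⟶ X'} {c : X' ⟶ Y ⊗ Z} {c' : X ⟶ Y' ⊗ Z'} {h : Y' ⟶ Y} {h' : Z' ⟶ Z}
    (e : c' ≫ (h ⊗ₘ h') = k ≫ c) (f : Y ⟶ A) (g : Z ⟶ B) (x : A ⊗ B ⟶ D) :
    c' ≫ ((h ≫ f) ⊗ₘ (h' ≫ g)) ≫ x = k ≫ c ≫ (f ⊗ₘ g) ≫ x := by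
  rw [← tensorHom_comp_tensorHom, Category.assoc, reassoc_of% e]

theorem pair_bind {k : X ⟶ X'} {c : X' ⟶ Y ⊗ Z} {c' : X ⟶ Y' ⊗ Z'} {h : Y' ⟶ Y} {h' : Z' ⟶ Z}
    (e : c' ≫ (h ⊗ₘ h') = k ≫ c) (f : Y ⟶ A) (g : Z ⟶ B) :
    c' ≫ ((h ≫ f) ⊗ₘ (h' ≫ g)) = k ≫ c ≫ (f ⊗ₘ g) := by
  rw [← tensorHom_comp_tensorHom, reassoc_of% e]

theorem letPair_bind {k : X ⟶ X'} {c : X' ⟶ Y ⊗ Z} {c' : X ⟶ Y' ⊗ Z'} {h : Y' ⟶ Y} {h' : Z' ⟶ Z}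
    (e : c' ≫ (h ⊗ₘ h') = k ≫ c) (f : Z ⟶ A ⊗ B) (g : Y ⊗ (A ⊗ B) ⟶ D) :
    c' ≫ Y' ◁ (h' ≫ f) ≫ (h ⊗ₘ (𝟙 A ⊗ₘ 𝟙 B)) ≫ g = k ≫ c ≫ Y ◁ f ≫ g := by
  rw [← reassoc_of% e, MonoidalCategory.tensorHom_def h h', id_tensorHom_id, tensorHom_id,
    Category.assoc, whisker_exchange_assoc]
  simp

theorem letStar_bind {k : X ⟶ X'} {c : X' ⟶ Y ⊗ Z} {c' : X ⟶ Y' ⊗ Z'} {h : Y' ⟶ Y} {h' : Z' ⟶ Z}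
    (e : c' ≫ (h ⊗ₘ h') = k ≫ c) (f : Z ⟶ 𝟙_ C) (g : Y ⟶ D) :
    c' ≫ Y' ◁ (h' ≫ f) ≫ (ρ_ Y').hom ≫ h ≫ g = k ≫ c ≫ Y ◁ f ≫ (ρ_ Y).hom ≫ g := by
  rw [← reassoc_of% e, MonoidalCategory.tensorHom_def h h', ← rightUnitor_naturality_assoc,
    Category.assoc, whisker_exchange_assoc]
  simp

theorem lam_bind {k : X ⟶ X'} {c : X' ⟶ Y} {c' : X ⟶ Y'} {h : Y' ⟶ Y}
    (e : c' ≫ h = k ≫ c) (f : Y ⊗ A ⟶ B) :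
    c' ≫ transpose Y' A B ((h ⊗ₘ 𝟙 A) ≫ f) = k ≫ c ≫ transpose Y A B f := by
  rw [tensorHom_id, transpose_naturality_left, reassoc_of% e]

end

theorem exists_fresh (l : List ℕ) : ∃ x, x ∉ l := by
  obtain ⟨x, hx⟩ := Infinite.exists_notMem_finset l.toFinset
  exact ⟨x, by simpa using hx⟩

namespace Interp

/-- The interpretation of a simultaneous substitution. -/
abbrev SemSubst (M : Interp C S) (σ : ℕ → Tm S) (t s : Tree S.Ground)
    (h : s.obj M.obj ⟶ t.obj M.obj) : Prop :=
  Bind M.obj (fun p s h => M.Sem s (.tm (σ p.1)) (.ty p.2) h) t s h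

theorem SemSubst.congr {σ τ : ℕ → Tm S} {t s : Tree S.Ground} {h : s.obj M.obj ⟶ t.obj M.obj}
    (H : M.SemSubst σ t s h) (e : ∀ x ∈ t.names, σ x = τ x) : M.SemSubst τ t s h :=
  Bind.mono H fun p hp s h H => by rw [← e _ (mem_names_of_mem_leaves hp)]; exact H

theorem SemSubst.free {σ : ℕ → Tm S} {t s : Tree S.Ground} {h : s.obj M.obj ⟶ t.obj M.obj}
    (H : M.SemSubst σ t s h) {x y : ℕ} (hx : x ∈ t.names) (hy : (σ x).Free y) : y ∈ s.names := by
  obtain ⟨p, hp, rfl⟩ := List.mem_map.1 hx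
  obtain ⟨_, _, h, hs⟩ := Bind.exists_of_mem H hp
  exact hs ((h.free_iff y).1 hy)

theorem semSubst_leaf {σ : ℕ → Tm S} {x y : ℕ} {A : Ty S.Ground} (h : σ x = .fvar y) :
    M.SemSubst σ (leaf (x, A)) (leaf (y, A)) (𝟙 _) :=
  .leaf (by rw [h]; exact .var (by simp) (.id _))

namespace Sem

/-- By induction on the interpretation. `Can.bind` transports the splitting of `t` to one of `s`,
and the substitution is divided accordingly. Under a binder, `σ` is extended by a fresh variable for
the bound one. -/
theorem subst {t : Tree S.Ground} {j : Subject S} {o : Target S.Ground} {f : t.obj M.obj ⟶ o.obj M.obj}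
    (h : M.Sem t j o f) {σ : ℕ → Tm S} {s : Tree S.Ground} {k : s.obj M.obj ⟶ t.obj M.obj}
    (H : M.SemSubst σ t s k) (hs : s.names.Nodup) : M.Sem s (j.subst σ) o (k ≫ f) := by
  induction h generalizing σ s with
  | var _ hc =>
    obtain ⟨s', h', c', H', hc', e⟩ := hc.bind H
    cases H' with
    | leaf H' => exact (H'.can hc').of_eq e
  | op _ ih => exact (ih H hs).op.of_eq (Category.assoc _ _ _)
  | star _ hc =>
    obtain ⟨s', h', c', H', hc', e⟩ := hc.bind H
    cases H'
    exact (Sem.star hs hc').of_eq ((Category.comp_id _).symm.trans e)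
  | pair _ hc _ _ ih ih' =>
    obtain ⟨s', h', c', H', hc', e⟩ := hc.bind H
    cases H' with
    | node H₁ H₂ =>
    have hn := List.nodup_append'.1 (names_node _ _ ▸ hc'.names_perm.nodup_iff.1 hs)
    exact (Sem.pair hs hc' (ih H₁ hn.2.1) (ih' H₂ hn.1)).of_eq
      (pair_bind e _ _)
  | @letPair t t₁ t₂ v u u₀ A B D x y c f g ht hc h₁ h₂ hu ih ih' =>
    obtain ⟨s', h', c', H', hc', e⟩ := hc.bind H
    cases H' with
    | @node _ s₂ _ s₁ _ _ H₂ H₁ =>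
    have hn := List.nodup_append'.1 (names_node _ _ ▸ hc'.names_perm.nodup_iff.1 hs)
    -- The new bound names only have to avoid the variables of `s₂`, since these include all free
    -- variables of the terms substituted into the body.
    obtain ⟨x', hx'⟩ := exists_fresh s₂.names
    obtain ⟨y', hy'⟩ := exists_fresh (x' :: s₂.names)
    rw [List.mem_cons, not_or] at hy'
    have hxy : y ≠ x ∧ x ∉ t₂.names ∧ y ∉ t₂.names := by
      have := h₂.nodup
      simp at this
      grind
    have hu' : (u₀.subst σ) = Tm.close 0 y' (Tm.close 1 x' (u.subst
        (Function.update (Function.update σ y (.fvar y')) x (.fvar x')))) := by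
      have key : ∀ z, u.Free z → z ≠ x → z ≠ y → z ∈ t₂.names := fun z hz h h' => by
        have := (h₂.free_iff z).1 hz
        simp at this
        grind
      rw [hu, Tm.subst_close (y := y'), Tm.subst_close (y := x')]
      · intro z hz hzx
        by_cases hzy : z = y
        · simp [hzy, Tm.Free, hy'.1]
        · rw [Function.update_of_ne hzy]
          exact fun h => hx' (SemSubst.free H₂ (key z hz hzx hzy) h)
      · intro z hz hzy h
        rw [Tm.free_close] at hz
        exact hy'.2 (SemSubst.free H₂ (key z hz.1 hz.2 hzy) h)
    refine (Sem.letPair hs hc' (ih H₁ hn.1) (ih' (Bind.node (SemSubst.congr H₂ fun z hz => ?_)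
      (Bind.node (semSubst_leaf (y := x') ?_) (semSubst_leaf (y := y') ?_))) ?_) hu').of_eq
        (letPair_bind e _ _)
    · rw [Function.update_of_ne, Function.update_of_ne] <;> rintro rfl <;> simp_all
    · simp
    · simp [hxy.1]
    · simp [hn.2.1, hx', hy']
  | letStar _ hc _ _ ih ih' =>
    obtain ⟨s', h', c', H', hc', e⟩ := hc.bind H
    cases H' with
    | node H₁ H₂ =>
    have hn := List.nodup_append'.1 (names_node _ _ ▸ hc'.names_perm.nodup_iff.1 hs)
    exact (Sem.letStar hs hc' (ih H₂ hn.1) (ih' H₁ hn.2.1)).of_eq (letStar_bind e _ _)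
  | @lam t t' v v₀ A B x c f ht hc h hv ih =>
    obtain ⟨s', h', c', H', hc', e⟩ := hc.bind H
    obtain ⟨x', hx'⟩ := exists_fresh s'.names
    have hx : x ∉ t'.names := by
      have := h.nodup
      simp at this
      grind
    have hv' : v₀.subst σ = Tm.close 0 x' (v.subst (Function.update σ x (.fvar x'))) := by
      rw [hv, Tm.subst_close]
      intro z hz hzx h'
      have := (h.free_iff z).1 hz
      simp [hzx] at this
      exact hx' (SemSubst.free H' this h')
    refine (Sem.lam hs hc' (ih (Bind.node (SemSubst.congr H' fun z hz => ?_)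
      (semSubst_leaf (y := x') ?_)) ?_) hv').of_eq (lam_bind e _)
    · rw [Function.update_of_ne]; rintro rfl; simp_all
    · simp
    · simp [hx', hc'.names_perm.nodup_iff.1 hs]
  | app _ hc _ _ ih ih' =>
    obtain ⟨s', h', c', H', hc', e⟩ := hc.bind H
    cases H' with
    | node H₁ H₂ =>
    have hn := List.nodup_append'.1 (names_node _ _ ▸ hc'.names_perm.nodup_iff.1 hs)
    exact (Sem.app hs hc' (ih H₁ hn.2.1) (ih' H₂ hn.1)).of_eq (tensor_bind e _ _ _)
  | tup_zero _ hc =>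
    obtain ⟨s', h', c', H', hc', e⟩ := hc.bind H
    cases H'
    exact (Sem.tup_zero hs hc').of_eq ((Category.comp_id _).symm.trans e)
  | @tup_succ _ _ _ _ v _ _ _ _ _ hc _ _ ih ih' =>
    obtain ⟨s', h', c', H', hc', e⟩ := hc.bind H
    cases H' with
    | node H₁ H₂ =>
    have hn := List.nodup_append'.1 (names_node _ _ ▸ hc'.names_perm.nodup_iff.1 hs)
    exact (Sem.tup_succ (v := fun i => (v i).subst σ) hs hc' (ih H₁ hn.2.1) (ih' H₂ hn.1)).of_eq (tensor_bind e _ _ _)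

end Sem

/-- `Bind` opens contexts into trees of leaves, so even the trivial substitution changes the
bracketing. Hence a new tree `s` and a structural morphism appear instead of `t` and the identity.
-/
theorem exists_semSubst_id {σ : ℕ → Tm S} (t : Tree S.Ground) (h : ∀ x ∈ t.names, σ x = .fvar x) :
    ∃ s k, M.SemSubst σ t s k ∧ Can M.obj s t k := by
  induction t with
  | nil => exact ⟨_, _, .nil, .id _⟩
  | leaf p => exact ⟨_, _, semSubst_leaf (h _ (by simp)), .id _⟩
  | node t t' ih ih' =>
    obtain ⟨_, _, H, hc⟩ := ih fun x hx => h x (by simp [hx])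
    obtain ⟨_, _, H', hc'⟩ := ih' fun x hx => h x (by simp [hx])
    exact ⟨_, _, .node H H', hc.tensor hc'⟩
  | ctx Γ =>
    induction Γ with
    | nil => exact ⟨_, _, .ctx_nil, .ctx_nil_inv⟩
    | cons p Γ ih =>
      obtain ⟨_, _, H, hc⟩ := ih fun x hx => h x (by simp_all)
      refine ⟨_, _, .ctx_cons H (s' := leaf p) (h' := 𝟙 _) ?_, (hc.tensor (.id _)).comp (.snoc Γ p)⟩
      rw [h p.1 (by simp)]
      exact .var (by simp) (.id _)

theorem whiskerLeft_of_inv {X X' Y Y' Z : C} {h : X ⟶ X'} {h' : X' ⟶ X} (e : h' ≫ h = 𝟙 _)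
    (k : Y ⟶ Y') (g : X' ⊗ Y' ⟶ Z) : h' ▷ Y ≫ (h ⊗ₘ k) ≫ g = X' ◁ k ≫ g := by
  rw [MonoidalCategory.tensorHom_def, Category.assoc, ← comp_whiskerRight_assoc, e]
  simp

/-- Substitution for the variables of a part of the tree. -/
theorem Sem.subst_right {t r s : Tree S.Ground} {j : Subject S} {o : Target S.Ground}
    {g : (node t r).obj M.obj ⟶ o.obj M.obj} (h : M.Sem (node t r) j o g) {σ : ℕ → Tm S}
    (hσ : ∀ x ∈ t.names, σ x = .fvar x) {k : s.obj M.obj ⟶ r.obj M.obj} (H : M.SemSubst σ r s k)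
    (hn : (node t s).names.Nodup) : M.Sem (node t s) (j.subst σ) o (t.obj M.obj ◁ k ≫ g) := by
  obtain ⟨t', h', H', hc⟩ := exists_semSubst_id (M := M) t hσ
  obtain ⟨c, hc', -, e⟩ := hc.exists_inv
  have hc'' := hc'.whiskerRight s
  exact ((h.subst (.node H' H) (hc''.names_perm.nodup_iff.1 hn)).can hc'').of_eq
    (whiskerLeft_of_inv e _ _)

end Interp

/-- Names are not repeated in `t`, so those of each half determine its typed leaves. The halves are
then related by structural morphisms, and coherence makes the triangle commute. -/
theorem exists_can_of_names {t t₁ t₂ t₁' t₂' : Tree S.Ground}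
    {c : t.obj M.obj ⟶ (node t₁ t₂).obj M.obj} {c' : t.obj M.obj ⟶ (node t₁' t₂').obj M.obj}
    (ht : t.names.Nodup) (hc : Can M.obj t (node t₁ t₂) c) (hc' : Can M.obj t (node t₁' t₂') c')
    (h₁ : ∀ x, x ∈ t₁.names ↔ x ∈ t₁'.names) (h₂ : ∀ x, x ∈ t₂.names ↔ x ∈ t₂'.names) :
    ∃ c₁ c₂, Can M.obj t₁ t₁' c₁ ∧ Can M.obj t₂ t₂' c₂ ∧ c ≫ (c₁ ⊗ₘ c₂) = c' := by
  -- A name occurs only once in `t`, so it carries the same type in both splittings.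
  have key : ∀ {s s' r r' : Tree S.Ground}, t.leaves.Perm (r.leaves ++ s.leaves) →
      t.leaves.Perm (r'.leaves ++ s'.leaves) →
      (∀ x, x ∈ s.names → x ∈ s'.names) → s.leaves ⊆ s'.leaves := by
    intro s s' r r' hp hp' hs p hp₁
    obtain ⟨p', hp₁', he⟩ := List.mem_map.1 (hs p.1 (mem_names_of_mem_leaves hp₁))
    have := List.inj_on_of_nodup_map ht (hp'.symm.subset (List.mem_append_right _ hp₁'))
      (hp.symm.subset (List.mem_append_right _ hp₁)) he
    exact this ▸ hp₁'
  have hp := hc.leaves_perm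
  have hp' := hc'.leaves_perm
  have hn := List.nodup_append'.1 (hp.nodup_iff.1 (leaves_nodup ht))
  have hn' := List.nodup_append'.1 (hp'.nodup_iff.1 (leaves_nodup ht))
  have p₁ : t₁.leaves.Perm t₁'.leaves := (List.perm_ext_iff_of_nodup hn.2.1 hn'.2.1).2 fun p =>
    ⟨fun h => key hp hp' (fun x => (h₁ x).1) h, fun h => key hp' hp (fun x => (h₁ x).2) h⟩
  have p₂ : t₂.leaves.Perm t₂'.leaves := (List.perm_ext_iff_of_nodup hn.1 hn'.1).2 fun p =>
    ⟨fun h => key (hp.trans List.perm_append_comm) (hp'.trans List.perm_append_comm)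
      (fun x => (h₂ x).1) h,
    fun h => key (hp'.trans List.perm_append_comm) (hp.trans List.perm_append_comm)
      (fun x => (h₂ x).2) h⟩
  obtain ⟨c₁, hc₁⟩ := exists_can (b := M.obj) p₁
  obtain ⟨c₂, hc₂⟩ := exists_can (b := M.obj) p₂
  exact ⟨c₁, c₂, hc₁, hc₂, Can.unique (leaves_nodup ht) (hc.comp (hc₁.tensor hc₂)) hc'⟩

/-- Targets that may be compared: tuples of types have to agree. -/
def Target.Compat {G : Type u₁} : Target G → Target G → Prop
  | .ty _, .ty _ => True
  | o, o' => o = o'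

section

variable {X Y Y' Y'' Z Z' Z'' W A B D : C}

theorem pair_unique {c : X ⟶ Y ⊗ Z} {c' : X ⟶ Y' ⊗ Z'} {h : Y ⟶ Y'} {h' : Z ⟶ Z'}
    (e : c ≫ (h ⊗ₘ h') = c') (f : Y' ⟶ A) (g : Z' ⟶ B) :
    c ≫ ((h ≫ f) ⊗ₘ (h' ≫ g)) = c' ≫ (f ⊗ₘ g) := by
  rw [← e, Category.assoc, tensorHom_comp_tensorHom]

theorem tensor_unique {c : X ⟶ Y ⊗ Z} {c' : X ⟶ Y' ⊗ Z'} {h : Y ⟶ Y'} {h' : Z ⟶ Z'}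
    (e : c ≫ (h ⊗ₘ h') = c') (f : Y' ⟶ A) (g : Z' ⟶ B) (k : A ⊗ B ⟶ D) :
    c ≫ ((h ≫ f) ⊗ₘ (h' ≫ g)) ≫ k = c' ≫ (f ⊗ₘ g) ≫ k := by
  rw [← Category.assoc, pair_unique e, Category.assoc]

theorem letPair_unique {c : X ⟶ Y ⊗ Z} {c' : X ⟶ Y' ⊗ Z'} {h : Y ⟶ Y'} {h' : Z ⟶ Z'}
    (e : c ≫ (h ⊗ₘ h') = c') (f : Z' ⟶ A ⊗ B) (g : Y' ⊗ (A ⊗ B) ⟶ D) :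
    c ≫ Y ◁ (h' ≫ f) ≫ h ▷ (A ⊗ B) ≫ Y' ◁ (𝟙 A ⊗ₘ 𝟙 B) ≫ g = c' ≫ Y' ◁ f ≫ g := by
  rw [← e, MonoidalCategory.tensorHom_def h h', id_tensorHom_id, MonoidalCategory.whiskerLeft_id, Category.id_comp,
    Category.assoc, whisker_exchange_assoc]
  simp

theorem letStar_unique {c : X ⟶ Y ⊗ Z} {c' : X ⟶ Y' ⊗ Z'} {h : Y ⟶ Y'} {h' : Z ⟶ Z'}
    (e : c ≫ (h ⊗ₘ h') = c') (f : Z' ⟶ 𝟙_ C) (g : Y' ⟶ D) :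
    c ≫ Y ◁ (h' ≫ f) ≫ (ρ_ Y).hom ≫ h ≫ g = c' ≫ Y' ◁ f ≫ (ρ_ Y').hom ≫ g := by
  rw [← e, MonoidalCategory.tensorHom_def h h', ← rightUnitor_naturality_assoc,
    Category.assoc, whisker_exchange_assoc]
  simp

theorem lam_unique {c : X ⟶ Y} {c' : X ⟶ Y'} {h : Y ⟶ Y'} (e : c ≫ h = c') (f : Y' ⊗ A ⟶ B) :
    c ≫ transpose Y A B (h ▷ A ≫ Y' ◁ 𝟙 A ≫ f) = c' ≫ transpose Y' A B f := by
  rw [MonoidalCategory.whiskerLeft_id, Category.id_comp, transpose_naturality_left, reassoc_of% e]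

end

/-- The interpretation of a term in a bracketed context is unique. -/
theorem Interp.Sem.unique {t : Tree S.Ground} {j : Subject S} {o o' : Target S.Ground}
    {f : t.obj M.obj ⟶ o.obj M.obj} {f' : t.obj M.obj ⟶ o'.obj M.obj} (h : M.Sem t j o f)
    (h' : M.Sem t j o' f') (ho : o.Compat o') : o = o' ∧ f ≍ f' := by
  -- The types are not assumed equal, because the type of a term does not determine those of its
  -- subterms; for instance, it says nothing about the argument type of an application. Uniqueness
  -- of types is thus part of the induction.
  induction h generalizing o' with
  | var ht hc =>
    cases h' with
    | @var _ _ A' c' _ hc' =>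
    have := hc.leaves_perm.symm.trans hc'.leaves_perm
    simp [leaves] at this
    subst this
    exact ⟨rfl, heq_of_eq (hc.unique (leaves_nodup ht) hc')⟩
  | op _ ih =>
    cases h' with
    | op h' => obtain ⟨-, e⟩ := ih h' rfl; cases e; exact ⟨rfl, .rfl⟩
  | star ht hc =>
    cases h' with
    | star _ hc' => exact ⟨rfl, heq_of_eq (hc.unique (leaves_nodup ht) hc')⟩
  | pair ht hc h₁ h₂ ih₁ ih₂ =>
    cases h' with
    | pair _ hc' h₁' h₂' =>
    obtain ⟨c₁, c₂, hc₁, hc₂, e⟩ := exists_can_of_names ht hc hc'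
      (fun x => (h₁.free_iff x).symm.trans (h₁'.free_iff x))
      (fun x => (h₂.free_iff x).symm.trans (h₂'.free_iff x))
    obtain ⟨e₁, e₁'⟩ := ih₁ (h₁'.can hc₁) trivial
    obtain ⟨e₂, e₂'⟩ := ih₂ (h₂'.can hc₂) trivial
    cases e₁; cases e₂; cases e₁'; cases e₂'
    exact ⟨rfl, heq_of_eq (pair_unique e _ _)⟩
  | @letPair t t₁ t₂ v u u₀ A B D x y c f g ht hc h₁ h₂ hu ih₁ ih₂ =>
    cases h' with
    | @letPair _ t₁' t₂' _ u' _ A' B' D' x' y' c' f' g' _ hc' h₁' h₂' hu' =>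
    have hfree : ∀ {t : Tree S.Ground} {u u₀ : Tm S} {x y : ℕ} {A B D : Ty S.Ground}
        {g : (node t (node (leaf (x, A)) (leaf (y, B)))).obj M.obj ⟶ tyObj M.obj D},
        M.Sem (node t (node (leaf (x, A)) (leaf (y, B)))) (.tm u) (.ty D) g →
        u₀ = Tm.close 0 y (Tm.close 1 x u) → ∀ z, u₀.Free z ↔ z ∈ t.names := by
      intro t u u₀ x y A B D g h hu z
      have := h.nodup
      have h := h.free_iff z
      simp only [Subject.Free, names_node, names_leaf, List.mem_append, List.mem_singleton] at h
      rw [hu, Tm.free_close, Tm.free_close, h]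
      simp at this
      grind
    obtain ⟨c₂, c₁, hc₂, hc₁, e⟩ := exists_can_of_names ht hc hc'
      (fun z => (hfree h₂ hu z).symm.trans (hfree h₂' hu' z))
      (fun z => (h₁.free_iff z).symm.trans (h₁'.free_iff z))
    obtain ⟨e₁, e₁'⟩ := ih₁ (h₁'.can hc₁) trivial
    cases e₁; cases e₁'
    have hn := h₂.nodup
    have hn' := h₂'.nodup
    have hm := fun z => hc₂.names_perm.mem_iff (a := z)
    have hxy : x ≠ y := by simp at hn; grind
    have hxy' : y' ≠ x' := by simp at hn'; grind
    -- The body in the second interpretation may use other bound names. Renaming `x'` and `y'` to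
    -- `x` and `y` turns it into `u`, so that the induction hypothesis applies.
    have hs := h₂'.subst_right
      (σ := Function.update (Function.update Tm.fvar y' (.fvar y)) x' (.fvar x))
      (s := node (leaf (x, A)) (leaf (y, B)))
      (by
        intro z hz
        rw [Function.update_of_ne, Function.update_of_ne] <;> rintro rfl <;> simp_all)
      (.node (semSubst_leaf (by simp)) (semSubst_leaf (by simp [hxy'])))
      ((hc₂.whiskerRight _).names_perm.nodup_iff.1 hn)
    have hu'' : u = u'.subst (Function.update (Function.update Tm.fvar y' (.fvar y)) x' (.fvar x)) :=
      Tm.eq_subst_of_close_close_eq h₂.absent h₂'.absent hxy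
        (fun z hz hzx hzy hzx' => by
          have := (h₂'.free_iff z).1 hz
          simp [hzx, hzy, ← hm] at this
          subst hzx'
          simp [this] at hn) (hu.symm.trans hu')
    rw [Subject.subst, ← hu''] at hs
    obtain ⟨e₂, e₂'⟩ := ih₂ (hs.can (hc₂.whiskerRight _)) trivial
    cases e₂; cases e₂'
    exact ⟨rfl, heq_of_eq (letPair_unique e _ _)⟩
  | letStar ht hc h₁ h₂ ih₁ ih₂ =>
    cases h' with
    | letStar _ hc' h₁' h₂' =>
    obtain ⟨c₂, c₁, hc₂, hc₁, e⟩ := exists_can_of_names ht hc hc'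
      (fun x => (h₂.free_iff x).symm.trans (h₂'.free_iff x))
      (fun x => (h₁.free_iff x).symm.trans (h₁'.free_iff x))
    obtain ⟨e₁, e₁'⟩ := ih₁ (h₁'.can hc₁) trivial
    obtain ⟨e₂, e₂'⟩ := ih₂ (h₂'.can hc₂) trivial
    cases e₂; cases e₁'; cases e₂'
    exact ⟨rfl, heq_of_eq (letStar_unique e _ _)⟩
  | @lam t t₁ v v₀ A B x c f ht hc h hv ih =>
    cases h' with
    | @lam _ t₁' v' _ _ B' x' c' f' _ hc' h' hv' =>
    have hp := hc.leaves_perm.symm.trans hc'.leaves_perm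
    obtain ⟨d, hd⟩ := exists_can (b := M.obj) hp
    have e := (hc.comp hd).unique (leaves_nodup ht) hc'
    have hn := h.nodup
    have hn' := h'.nodup
    -- As for pattern matching, the two bodies are compared after renaming the bound variable.
    have hs := h'.subst_right (σ := Function.update Tm.fvar x' (.fvar x)) (s := leaf (x, A))
      (by
        intro z hz
        rw [Function.update_of_ne]
        rintro rfl
        simp_all)
      (semSubst_leaf (by simp)) ((hd.whiskerRight _).names_perm.nodup_iff.1 hn)
    rw [Subject.subst, ← Tm.subst₁,
      ← Tm.eq_subst_of_close_eq (h.absent 0) (h'.absent 0) (hv.symm.trans hv')] at hs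
    obtain ⟨e₂, e₂'⟩ := ih (hs.can (hd.whiskerRight _)) trivial
    cases e₂; cases e₂'
    exact ⟨rfl, heq_of_eq (lam_unique e _)⟩
  | app ht hc h₁ h₂ ih₁ ih₂ =>
    cases h' with
    | app _ hc' h₁' h₂' =>
    obtain ⟨c₁, c₂, hc₁, hc₂, e⟩ := exists_can_of_names ht hc hc'
      (fun x => (h₁.free_iff x).symm.trans (h₁'.free_iff x))
      (fun x => (h₂.free_iff x).symm.trans (h₂'.free_iff x))
    obtain ⟨e₁, e₁'⟩ := ih₁ (h₁'.can hc₁) trivial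
    obtain ⟨e₂, e₂'⟩ := ih₂ (h₂'.can hc₂) trivial
    cases e₁; cases e₁'; cases e₂'
    exact ⟨rfl, heq_of_eq (tensor_unique e _ _ _)⟩
  | tup_zero ht hc =>
    cases h' with
    | tup_zero _ hc' => exact ⟨ho, by cases ho; exact heq_of_eq (hc.unique (leaves_nodup ht) hc')⟩
  | @tup_succ t t₁ t₂ n v A c f g ht hc h₁ h₂ ih₁ ih₂ =>
    cases ho
    cases h' with
    | tup_succ _ hc' h₁' h₂' =>
    obtain ⟨c₁, c₂, hc₁, hc₂, e⟩ := exists_can_of_names ht hc hc'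
      (fun x => (h₁.free_iff x).symm.trans (h₁'.free_iff x))
      (fun x => (h₂.free_iff x).symm.trans (h₂'.free_iff x))
    obtain ⟨-, e₁'⟩ := ih₁ (h₁'.can hc₁) rfl
    obtain ⟨-, e₂'⟩ := ih₂ (h₂'.can hc₂) trivial
    cases e₁'; cases e₂'
    exact ⟨rfl, heq_of_eq (tensor_unique e _ _ _)⟩

end Interpretation

end VLambda

namespace VLambda

set_option linter.unusedSectionVars false

/-! ### Derivations and the relational interpretation. -/

section Interpretation

open VLambda.Tree

section Structural

variable {G : Type u₁} {C : Type*} [Category.{w} C] [MonoidalCategory C] [SymmetricCategory C]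
  [MonoidalClosed C] {b : G → C}

theorem Can.of_eq {s t : Tree G} {f g : s.obj b ⟶ t.obj b} (h : Can b s t f) (e : f = g) :
    Can b s t g := e ▸ h

theorem Can.split {Γ Δ E : Ctx G} (s : Shuffle Γ Δ E) :
    Can b (ctx E) (node (ctx Γ) (ctx Δ)) (split b s) := by
  induction s with
  | nil =>
    refine ((Can.unitor_inv (ctx [])).comp (Can.ctx_nil_inv.whiskerRight _)).of_eq ?_
    exact (congrArg _ (id_whiskerRight _ _)).trans (Category.comp_id _)
  | left p s ih =>
    exact (Can.snoc_inv _ p).comp ((ih.whiskerRight (leaf p)).comp ((Can.assoc _ _ _).comp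
      (((Can.braid _ _).whiskerLeft _).comp ((Can.assoc_inv _ _ _).comp
        ((Can.snoc _ p).whiskerRight _)))))
  | right p s ih =>
    exact (Can.snoc_inv _ p).comp ((ih.whiskerRight (leaf p)).comp ((Can.assoc _ _ _).comp
      ((Can.snoc _ p).whiskerLeft _)))

theorem nTensorSnoc_naturality {n : ℕ} {X Y : Fin (n + 1) → C} (f : ∀ i, X i ⟶ Y i) :
    (nTensorSnoc n X).hom ≫ nTensorHom (n + 1) f =
      (nTensorHom n (fun i => f i.castSucc) ⊗ₘ f (Fin.last n)) ≫ (nTensorSnoc n Y).hom := by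
  cases n with
  | zero => exact tensor_unitor (f 0)
  | succ n => exact (Category.id_comp _).trans (Category.comp_id _).symm

end Structural

variable {S : Signature.{u₁, u₂}} {C : Type*} [Category.{w} C] [MonoidalCategory C]
  [SymmetricCategory C] [MonoidalClosed C] {M : Interp C S}

theorem IsCtx.perm {G : Type u₁} {E E' : Ctx G} (h : IsCtx E) (p : E'.Perm E) : IsCtx E' :=
  (p.map Prod.fst).nodup_iff.2 h

theorem IsCtx.names {G : Type u₁} {E : Ctx G} (h : IsCtx E) : (ctx E).names.Nodup := h

theorem IsCtx.append_left {G : Type u₁} {Γ Δ : Ctx G} (h : IsCtx (Γ ++ Δ)) : IsCtx Γ := by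
  rw [IsCtx, List.map_append] at h
  exact (List.nodup_append'.1 h).1

theorem IsCtx.append_right {G : Type u₁} {Γ Δ : Ctx G} (h : IsCtx (Γ ++ Δ)) : IsCtx Δ := by
  rw [IsCtx, List.map_append] at h
  exact (List.nodup_append'.1 h).2.1

theorem Shuffle.perm {α : Type u₁} {Γ Δ E : List α} (s : Shuffle Γ Δ E) : E.Perm (Γ ++ Δ) := by
  induction s with
  | nil => exact .refl _
  | left p _ ih => exact ih.cons p
  | right p _ ih => exact (ih.cons p).trans List.perm_middle.symm

section

variable {X X' Y Y' Z Z' W : C}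

theorem tup_sem {c : X ⟶ Y ⊗ Z} {n : Y ⟶ Y'} {k : Y' ⊗ Z ⟶ W} {k' : W ⟶ X'} {f : Y' ⟶ Z'} {W' : C}
    {g : Z ⟶ W'} {i : Z' ⊗ W' ⟶ X'} (e : k ≫ k' = (f ⊗ₘ g) ≫ i) :
    c ≫ ((n ≫ f) ⊗ₘ g) ≫ i = (c ≫ n ▷ Z ≫ k) ≫ k' := by
  rw [Category.assoc, Category.assoc, e, ← tensorHom_id, tensorHom_comp_tensorHom_assoc,
    Category.id_comp]

theorem pm_sem {A B D U V : C} (c : X ⟶ Y ⊗ Z) (f : Y ⟶ A ⊗ B) (k₁ : (Z ⊗ A) ⊗ B ⟶ U)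
    (k₂ : U ⟶ V) (g : V ⟶ D) :
    (c ≫ (β_ Y Z).hom) ≫ Z ◁ f ≫ ((α_ Z A B).inv ≫ k₁ ≫ k₂) ≫ g =
      c ≫ f ▷ Z ≫ (β_ (A ⊗ B) Z).hom ≫ (α_ Z A B).inv ≫ k₁ ≫ k₂ ≫ g := by
  rw [BraidedCategory.braiding_naturality_left_assoc]
  simp only [Category.assoc]

theorem letStar_sem {D : C} (c : X ⟶ Y ⊗ Z) (f : Y ⟶ 𝟙_ C) (k : Z ⟶ D) :
    (c ≫ (β_ Y Z).hom) ≫ Z ◁ f ≫ (ρ_ Z).hom ≫ k = c ≫ f ▷ Z ≫ (λ_ Z).hom ≫ k := by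
  rw [← braiding_rightUnitor, Category.assoc, Category.assoc,
    BraidedCategory.braiding_naturality_left_assoc]

end

theorem Interp.Sem.tup_of_shuffles {n : ℕ} {Γ : Fin n → Ctx S.Ground} {E : Ctx S.Ground}
    (s : Shuffles n Γ E) (hE : IsCtx E) {v : Fin n → Tm S} {A : Fin n → Ty S.Ground}
    {f : ∀ i, (ctx (Γ i)).obj M.obj ⟶ tyObj M.obj (A i)}
    (h : ∀ i, M.Sem (ctx (Γ i)) (.tm (v i)) (.ty (A i)) (f i)) :
    M.Sem (ctx E) (.tup n v) (.tup n A) (nSplit M.obj s ≫ nTensorHom n f) := by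
  induction s with
  | nil Γ => exact (Sem.tup_zero hE.names .ctx_nil).of_eq (Category.comp_id _).symm
  | snoc Γ s s' ih =>
    have hE' := hE.perm s'.perm.symm
    exact (Sem.tup_succ hE.names (.split s') (ih hE'.append_left fun i => h i.castSucc)
      (h (Fin.last _))).of_eq (tup_sem (nTensorSnoc_naturality _))

/-- All housekeeping morphisms are structural. Together with `Interp.Sem.unique` this shows that the
interpretation does not depend on the derivation. -/
theorem Interp.sem_spec (M : Interp C S) {Γ : Ctx S.Ground} {v : Tm S} {A : Ty S.Ground}
    (d : Der Γ v A) : M.Sem (ctx Γ) (.tm v) (.ty A) (M.sem d) := by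
  induction d with
  | var x A =>
    exact .var (by simp) (((Can.snoc_inv [] (x, A)).comp ((Can.ctx_nil.whiskerRight _).comp
      (.unitor _))).of_eq (by
        exact (congrArg _ ((congrArg (· ≫ _) (id_whiskerRight _ _)).trans
          (Category.id_comp _))).trans (Iso.inv_hom_id _)))
  | op f Γ v d s hE ih =>
    exact (Sem.tup_of_shuffles s hE ih).op.of_eq (Category.assoc _ _ _)
  | star => exact .star (by simp) .ctx_nil
  | pair d e s hE ih ih' => exact .pair hE.names (.split s) ih ih'
  | @pm Γ Δ E v t A B D x y d e s hE ih ih' =>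
    have hc := (Can.assoc_inv (b := M.obj) (ctx Δ) (leaf (x, A)) (leaf (y, B))).comp
      (((Can.snoc Δ (x, A)).whiskerRight _).comp (.snoc _ (y, B)))
    refine (Sem.letPair hE.names ((Can.split s).comp (.braid _ _)) ih (ih'.can hc) rfl).of_eq ?_
    exact pm_sem _ _ _ _ _
  | letStar d e s hE ih ih' =>
    exact (Sem.letStar hE.names ((Can.split s).comp (.braid _ _)) ih ih').of_eq (letStar_sem _ _ _)
  | @abs Γ v A B x d ih =>
    have hn := ih.nodup
    exact (Sem.lam (IsCtx.names (List.nodup_cons.1 hn).2) (.id _) (ih.can (.snoc Γ (x, A))) rfl).of_eq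
      (Category.id_comp _)
  | app d e s hE ih ih' => exact .app hE.names (.split s) ih ih'

/-- Walk along `E` and assign each entry to a list that still contains it. Given exchange for the
premises, rules stated with shuffles then hold for arbitrary permutations. -/
theorem Shuffle.exists_of_perm {α : Type u₁} {Γ Δ E : List α} (h : E.Perm (Γ ++ Δ)) :
    ∃ Γ' Δ', Γ'.Perm Γ ∧ Δ'.Perm Δ ∧ Nonempty (Shuffle Γ' Δ' E) := by
  classical
  induction E generalizing Γ Δ with
  | nil =>
    obtain ⟨rfl, rfl⟩ := List.append_eq_nil_iff.1 h.nil_eq.symm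
    exact ⟨[], [], .refl _, .refl _, ⟨.nil⟩⟩
  | cons p E ih =>
    rcases List.mem_append.1 (h.subset (List.mem_cons_self ..)) with hp | hp
    · have hp := List.perm_cons_erase hp
      obtain ⟨Γ', Δ', h₁, h₂, ⟨s⟩⟩ := ih (h.trans (hp.append_right Δ)).cons_inv
      exact ⟨_, _, (h₁.cons p).trans hp.symm, h₂, ⟨.left p s⟩⟩
    · have hp := List.perm_cons_erase hp
      obtain ⟨Γ', Δ', h₁, h₂, ⟨s⟩⟩ :=
        ih ((h.trans (hp.append_left Γ)).trans List.perm_middle).cons_inv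
      exact ⟨_, _, h₁, (h₂.cons p).trans hp.symm, ⟨.right p s⟩⟩

/-- Typing of terms and of tuples of terms. -/
inductive Subject.Typed (E : Ctx S.Ground) : Subject S → Target S.Ground → Prop
  | tm {v : Tm S} {A : Ty S.Ground} : VLambda.Typed E v A → Typed E (.tm v) (.ty A)
  | tup {n : ℕ} {Γ : Fin n → Ctx S.Ground} {v : Fin n → Tm S} {A : Fin n → Ty S.Ground} :
      (∀ i, VLambda.Typed (Γ i) (v i) (A i)) → Nonempty (Shuffles n Γ E) →
      Typed E (.tup n v) (.tup n A)

/-- An interpretation contains enough data to rebuild a derivation, in any ordering of the leaves.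
Applied in the trivial model, this gives exchange for typing. -/
theorem Interp.Sem.typed {t : Tree S.Ground} {j : Subject S} {o : Target S.Ground}
    {f : t.obj M.obj ⟶ o.obj M.obj} (h : M.Sem t j o f) {E : Ctx S.Ground}
    (hE : E.Perm t.leaves) : j.Typed E o := by
  have hE' : IsCtx E := IsCtx.perm (E := t.leaves) h.nodup hE
  induction h generalizing E with
  | @var t x A c _ hc =>
    obtain rfl : E = [(x, A)] := List.perm_singleton.1 (hE.trans hc.leaves_perm)
    exact .tm ⟨.var x A⟩
  | op _ ih =>
    cases ih hE hE' with
    | tup h hs =>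
    obtain ⟨s⟩ := hs
    exact .tm ⟨.op _ _ _ (fun i => (h i).some) s hE'⟩
  | star _ hc =>
    obtain rfl : E = [] := (hE.trans hc.leaves_perm).eq_nil
    exact .tm ⟨.star⟩
  | pair _ hc h₁ h₂ ih₁ ih₂ =>
    obtain ⟨Γ, Δ, h, h', ⟨s⟩⟩ := Shuffle.exists_of_perm
      (hE.trans (hc.leaves_perm.trans List.perm_append_comm))
    have hn := hE'.perm s.perm.symm
    obtain ⟨⟨d⟩⟩ := ih₁ h hn.append_left
    obtain ⟨⟨e⟩⟩ := ih₂ h' hn.append_right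
    exact .tm ⟨.pair d e s hE'⟩
  | letPair _ hc h₁ h₂ hu ih₁ ih₂ =>
    subst hu
    obtain ⟨Γ, Δ, h, h', ⟨s⟩⟩ := Shuffle.exists_of_perm (hE.trans hc.leaves_perm)
    have hn := hE'.perm s.perm.symm
    obtain ⟨⟨d⟩⟩ := ih₁ h hn.append_left
    obtain ⟨⟨e⟩⟩ := ih₂ ((h'.cons _).cons _) (IsCtx.perm h₂.nodup ((h'.cons _).cons _))
    exact .tm ⟨.pm d e s hE'⟩
  | letStar _ hc h₁ h₂ ih₁ ih₂ =>
    obtain ⟨Γ, Δ, h, h', ⟨s⟩⟩ := Shuffle.exists_of_perm (hE.trans hc.leaves_perm)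
    have hn := hE'.perm s.perm.symm
    obtain ⟨⟨d⟩⟩ := ih₁ h hn.append_left
    obtain ⟨⟨e⟩⟩ := ih₂ h' hn.append_right
    exact .tm ⟨.letStar d e s hE'⟩
  | lam _ hc h hv ih =>
    subst hv
    have h' := hE.trans hc.leaves_perm
    obtain ⟨⟨d⟩⟩ := ih (h'.cons _) (IsCtx.perm h.nodup (h'.cons _))
    exact .tm ⟨.abs d⟩
  | app _ hc h₁ h₂ ih₁ ih₂ =>
    obtain ⟨Γ, Δ, h, h', ⟨s⟩⟩ := Shuffle.exists_of_perm
      (hE.trans (hc.leaves_perm.trans List.perm_append_comm))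
    have hn := hE'.perm s.perm.symm
    obtain ⟨⟨d⟩⟩ := ih₁ h hn.append_left
    obtain ⟨⟨e⟩⟩ := ih₂ h' hn.append_right
    exact .tm ⟨.app d e s hE'⟩
  | @tup_zero t v A _ _ hc =>
    obtain rfl : E = [] := (hE.trans hc.leaves_perm).eq_nil
    exact .tup (Γ := fun i => i.elim0) (fun i => i.elim0) ⟨.nil _⟩
  | tup_succ _ hc h₁ h₂ ih₁ ih₂ =>
    obtain ⟨Γ, Δ, h, h', ⟨s⟩⟩ := Shuffle.exists_of_perm
      (hE.trans (hc.leaves_perm.trans List.perm_append_comm))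
    have hn := hE'.perm s.perm.symm
    obtain ⟨d⟩ := ih₂ h' hn.append_right
    cases ih₁ h hn.append_left with
    | @tup _ Γ' _ _ hd hs =>
    obtain ⟨s'⟩ := hs
    refine .tup (Γ := Fin.snoc (α := fun _ => Ctx S.Ground) Γ' Δ) ?_
      ⟨.snoc (E' := Γ) _ (by simpa using s') (by simpa using s)⟩
    refine Fin.lastCases ?_ ?_
    · simpa using d
    · intro i
      simpa using hd i

theorem Interp.Sem.typed_tm {t : Tree S.Ground} {v : Tm S} {A : Ty S.Ground}
    {f : t.obj M.obj ⟶ tyObj M.obj A} (h : M.Sem t (.tm v) (.ty A) f) {E : Ctx S.Ground}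
    (hE : E.Perm t.leaves) : Typed E v A := by
  cases h.typed hE with
  | tm h => exact h

end Interpretation

/-! ### A trivial model and admissibility of substitution -/

/-- The category with one object and one morphism. -/
inductive Triv : Type
  | pt

namespace Triv

/-- With only one morphism between any two objects, `Interp.Sem` carries only typing information.
Facts about typing can thus be obtained from the results on interpretations. -/
instance : Category.{0} Triv where
  Hom _ _ := PUnit
  id _ := ⟨⟩
  comp _ _ := ⟨⟩

def iso (X Y : Triv) : X ≅ Y := ⟨⟨⟩, ⟨⟩, rfl, rfl⟩

instance : MonoidalCategory Triv where
  tensorObj _ _ := pt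
  whiskerLeft _ _ _ _ := ⟨⟩
  whiskerRight _ _ := ⟨⟩
  tensorUnit := pt
  associator _ _ _ := iso _ _
  leftUnitor _ := iso _ _
  rightUnitor _ := iso _ _

instance : SymmetricCategory Triv where
  braiding _ _ := iso _ _

instance : MonoidalClosed Triv where
  closed X :=
    { rightAdj := { obj := fun _ => pt, map := fun _ => ⟨⟩ }
      adj := Adjunction.mkOfHomEquiv { homEquiv := fun _ _ => Equiv.refl PUnit } }

end Triv

/-- The trivial interpretation. -/
noncomputable def trivInterp (S : Signature.{u₁, u₂}) : Interp Triv S where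
  obj _ := .pt
  op _ := ⟨⟩

end VLambda

namespace VLambda

set_option linter.unusedSectionVars false

/-! ### Soundness -/

section Soundness

open VLambda.Tree

variable {S : Signature.{u₁, u₂}} {C : Type*} [Category.{w} C] [MonoidalCategory C]
  [SymmetricCategory C] [MonoidalClosed C] {M : Interp C S}

section

variable {X Y Z W A B D : C}

/-- This identity and the next seven are what the eight base equations become in a symmetric
monoidal closed category. -/
theorem pm_beta_eq (f : X ⟶ A) (g : Y ⟶ B) (h : Z ⊗ (A ⊗ B) ⟶ D) :
    𝟙 _ ≫ Z ◁ (𝟙 _ ≫ (f ⊗ₘ g)) ≫ h = Z ◁ (f ⊗ₘ g) ≫ h := by simp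

theorem pm_eta_eq (f : X ⟶ A ⊗ B) (h : Z ⊗ (A ⊗ B) ⟶ D) :
    𝟙 _ ≫ Z ◁ f ≫ Z ◁ (𝟙 _ ≫ (𝟙 A ⊗ₘ 𝟙 B)) ≫ h = Z ◁ f ≫ h := by simp

theorem star_beta_eq (f : X ⟶ A) :
    𝟙 _ ≫ X ◁ 𝟙 (𝟙_ C) ≫ (ρ_ X).hom ≫ f = (ρ_ X).hom ≫ f := by simp

theorem star_eta_eq (f : X ⟶ 𝟙_ C) (g : Y ⊗ 𝟙_ C ⟶ A) :
    𝟙 _ ≫ Y ◁ f ≫ (ρ_ Y).hom ≫ (ρ_ Y).inv ≫ Y ◁ 𝟙 _ ≫ g = Y ◁ f ≫ g := by simp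

theorem abs_beta_eq (f : X ⟶ A) (g : Y ⊗ A ⟶ B) :
    𝟙 _ ≫ ((𝟙 _ ≫ transpose Y A B g) ⊗ₘ f) ≫ appHom A B = Y ◁ f ≫ g := by
  rw [Category.id_comp, Category.id_comp, MonoidalCategory.tensorHom_def', Category.assoc,
    whiskerRight_appHom, Equiv.symm_apply_apply]

theorem abs_eta_eq (f : X ⟶ (ihom A).obj B) :
    𝟙 _ ≫ transpose X A B (𝟙 _ ≫ (f ⊗ₘ 𝟙 A) ≫ appHom A B) = f := by
  rw [Category.id_comp, Category.id_comp, tensorHom_id, whiskerRight_appHom,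
    Equiv.apply_symm_apply]

theorem letStar_comm_eq (f : X ⟶ 𝟙_ C) (g : Y ⟶ A) (h : Z ⊗ A ⟶ D) :
    (α_ Z Y X).inv ≫ (Z ⊗ Y) ◁ f ≫ (ρ_ (Z ⊗ Y)).hom ≫ Z ◁ g ≫ h =
      Z ◁ (𝟙 _ ≫ Y ◁ f ≫ (ρ_ Y).hom ≫ g) ≫ h := by simp

theorem pm_comm_eq (f : X ⟶ A ⊗ B) (g : Y ⊗ (A ⊗ B) ⟶ W) (h : Z ⊗ W ⟶ D) :
    (α_ Z Y X).inv ≫ (Z ⊗ Y) ◁ f ≫ (α_ Z Y (A ⊗ B)).hom ≫ Z ◁ g ≫ h =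
      Z ◁ (𝟙 _ ≫ Y ◁ f ≫ g) ≫ h := by simp

end

theorem Typed.exists_sem {Γ : Ctx S.Ground} {v : Tm S} {A : Ty S.Ground} (h : Typed Γ v A)
    (M : Interp C S) : ∃ f, M.Sem (ctx Γ) (.tm v) (.ty A) f := by
  obtain ⟨d⟩ := h
  exact ⟨_, M.sem_spec d⟩

theorem Typed.isCtx {Γ : Ctx S.Ground} {v : Tm S} {A : Ty S.Ground} (h : Typed Γ v A) :
    IsCtx Γ := by
  obtain ⟨_, h⟩ := h.exists_sem (trivInterp S)
  exact h.nodup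

namespace Interp

/-- The subjects `v` and `t` have the same interpretation. -/
def Same (M : Interp C S) (r : Tree S.Ground) (v t : Tm S) (A : Ty S.Ground) : Prop :=
  ∃ f, M.Sem r (.tm v) (.ty A) f ∧ M.Sem r (.tm t) (.ty A) f

theorem Same.can {r s : Tree S.Ground} {v t : Tm S} {A : Ty S.Ground} (h : M.Same s v t A)
    (hp : r.leaves.Perm s.leaves) : M.Same r v t A := by
  obtain ⟨f, h, h'⟩ := h
  obtain ⟨c, hc⟩ := exists_can (b := M.obj) hp
  exact ⟨_, h.can hc, h'.can hc⟩

theorem _root_.VLambda.Typed.exists_sem_of_perm {Γ : Ctx S.Ground} {v : Tm S} {A : Ty S.Ground}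
    (h : Typed Γ v A) (M : Interp C S) {r : Tree S.Ground} (hp : r.leaves.Perm Γ) :
    ∃ f, M.Sem r (.tm v) (.ty A) f := by
  obtain ⟨_, h⟩ := h.exists_sem M
  obtain ⟨c, hc⟩ := exists_can (b := M.obj) (s := r) (t := ctx Γ) hp
  exact ⟨_, h.can hc⟩

/-- Substitution for the rightmost variable. -/
theorem Sem.subst₁ {r s : Tree S.Ground} {u v : Tm S} {A D : Ty S.Ground} {z : ℕ}
    {g : (node r (leaf (z, A))).obj M.obj ⟶ tyObj M.obj D} {f : s.obj M.obj ⟶ tyObj M.obj A}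
    (h : M.Sem (node r (leaf (z, A))) (.tm u) (.ty D) g) (h' : M.Sem s (.tm v) (.ty A) f)
    (hn : (node r s).names.Nodup) :
    M.Sem (node r s) (.tm (u.subst₁ z v)) (.ty D) (r.obj M.obj ◁ f ≫ g) := by
  have hz := h.nodup
  refine h.subst_right (fun x hx => ?_) (.leaf ?_) hn
  · rw [Function.update_of_ne]
    rintro rfl
    simp_all
  · simpa using h'

theorem nodup_of_perm {E : Ctx S.Ground} (hE : IsCtx E) {r : Tree S.Ground}
    (hp : E.Perm r.leaves) : r.names.Nodup := hE.perm hp.symm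

/-- The context is bracketed so that the outer rule needs only an identity or one associator. The
substituted side is supplied by the substitution lemma, and the order of the variables in `E` is
restored at the end. -/
theorem same_of_baseEq {E : Ctx S.Ground} {v t : Tm S} {A : Ty S.Ground}
    (h : BaseEq E v t A) : M.Same (ctx E) v t A := by
  cases h with
  | @pm_beta Γ Δ Θ _ v t u A B D x y hv ht hu hp hE =>
    have hp' : E.Perm (node (ctx Θ) (node (ctx Γ) (ctx Δ))).leaves :=
      hp.trans (List.perm_append_comm.append_right _)
    have hn := nodup_of_perm hE hp'
    have hn' := hu.isCtx
    obtain ⟨f, hf⟩ := hv.exists_sem M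
    obtain ⟨g, hg⟩ := ht.exists_sem M
    obtain ⟨h, hh⟩ := hu.exists_sem_of_perm M (r := node (ctx Θ) (node (leaf (x, A)) (leaf (y, B))))
      (.refl _)
    have hm := (List.nodup_append'.1 (names_node _ _ ▸ hn)).1
    have h₁ := (Sem.letPair hn (.id _) (.pair hm (.id _) hf hg) hh rfl).of_eq (pm_beta_eq _ _ _)
    refine Same.can ⟨_, h₁, ?_⟩ hp'
    simp [IsCtx] at hn'
    refine hh.subst_right (fun z hz => ?_) (.node (.leaf ?_) (.leaf ?_)) hn
    · simp at hz
      rw [Function.update_of_ne, Function.update_of_ne] <;> rintro rfl <;> grind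
    · simpa [Function.update_of_ne (Ne.symm hn'.1.1)] using hf
    · simpa using hg
  | @pm_eta Γ Δ _ v u A B D x y z hv hu hn' hp hE =>
    have hp' : E.Perm (node (ctx Δ) (ctx Γ)).leaves := hp
    have hn := nodup_of_perm hE hp'
    obtain ⟨f, hf⟩ := hv.exists_sem M
    obtain ⟨h, hh⟩ := hu.exists_sem_of_perm M (r := node (ctx Δ) (leaf (z, .tensor A B))) (.refl _)
    have hm := nodup_of_perm (r := node (ctx Δ) (node (leaf (x, A)) (leaf (y, B)))) hn' (.refl _)
    have hx : M.Sem (node (leaf (x, A)) (leaf (y, B))) (.tm (.pair (.fvar x) (.fvar y)))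
        (.ty (.tensor A B)) _ :=
      .pair (by simp at hm; simp; grind) (.id _) (.var (by simp) (.id _)) (.var (by simp) (.id _))
    exact Same.can ⟨_, (Sem.letPair hn (.id _) hf (hh.subst₁ hx hm) rfl).of_eq (pm_eta_eq _ _),
      hh.subst₁ hf hn⟩ hp'
  | star_beta hv =>
    obtain ⟨f, hf⟩ := hv.exists_sem M
    have hn : (node (ctx E) nil).names.Nodup := by simpa using hv.isCtx.names
    exact Same.can ⟨_, (Sem.letStar hn (.id _) (.star (by simp) (.id _)) hf).of_eq (star_beta_eq _),
      hf.can (.unitor_right _)⟩ (.refl _)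
  | @star_eta Γ Δ _ v t A z hv ht hp hE =>
    have hp' : E.Perm (node (ctx Δ) (ctx Γ)).leaves := hp
    have hn := nodup_of_perm hE hp'
    obtain ⟨f, hf⟩ := hv.exists_sem M
    obtain ⟨h, hh⟩ := ht.exists_sem_of_perm M (r := node (ctx Δ) (leaf (z, .unit))) (.refl _)
    have hs := (hh.subst₁ (s := nil) (.star (by simp) (.id _))
      (by simpa using (List.nodup_cons.1 ht.isCtx).2)).can (.unitor_right_inv _)
    exact Same.can ⟨_, (Sem.letStar hn (.id _) hf hs).of_eq (star_eta_eq _ _),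
      hh.subst₁ hf hn⟩ hp'
  | @abs_beta Γ Δ _ v t A B x hv ht hp hE =>
    have hp' : E.Perm (node (ctx Γ) (ctx Δ)).leaves := hp.trans List.perm_append_comm
    have hn := nodup_of_perm hE hp'
    obtain ⟨f, hf⟩ := ht.exists_sem M
    obtain ⟨h, hh⟩ := hv.exists_sem_of_perm M (r := node (ctx Γ) (leaf (x, A))) (.refl _)
    exact Same.can ⟨_, (Sem.app hn (.id _)
      (.lam (IsCtx.names (List.nodup_cons.1 hv.isCtx).2) (.id _) hh rfl) hf).of_eq
        (abs_beta_eq _ _), hh.subst₁ hf hn⟩ hp'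
  | @abs_eta _ v A B x hv hn' =>
    obtain ⟨f, hf⟩ := hv.exists_sem M
    have hn := nodup_of_perm (r := node (ctx E) (leaf (x, A))) hn' (.refl _)
    exact ⟨_, (Sem.lam hv.isCtx.names (.id _) (.app hn (.id _) hf (.var (by simp) (.id _))) rfl).of_eq
      (abs_eta_eq _), hf⟩
  | @letStar_comm Γ Δ Θ _ u v t A D z hu hv ht hp hE =>
    have hp' : E.Perm (node (ctx Γ) (node (ctx Θ) (ctx Δ))).leaves := by
      refine hp.trans ?_
      rw [List.append_assoc]
      exact List.perm_append_comm
    have hn := nodup_of_perm hE hp'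
    have hm := List.nodup_append'.1 (names_node _ _ ▸ hn)
    obtain ⟨f, hf⟩ := hv.exists_sem M
    obtain ⟨g, hg⟩ := ht.exists_sem M
    obtain ⟨h, hh⟩ := hu.exists_sem_of_perm M (r := node (ctx Γ) (leaf (z, A))) (.refl _)
    exact Same.can ⟨_, hh.subst₁ (.letStar hm.1 (.id _) hf hg) hn,
      (Sem.letStar hn (.assoc_inv _ _ _) hf (hh.subst₁ hg (by
        simp at hn ⊢; grind))).of_eq (letStar_comm_eq _ _ _)⟩ hp'
  | @pm_comm Γ Δ Θ _ u v t A B A' D x y z hu hv ht hn' hp hE =>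
    have hp' : E.Perm (node (ctx Γ) (node (ctx Θ) (ctx Δ))).leaves := by
      refine hp.trans ?_
      rw [List.append_assoc]
      exact List.perm_append_comm
    have hn := nodup_of_perm hE hp'
    have hm := List.nodup_append'.1 (names_node _ _ ▸ hn)
    have hk := ht.isCtx
    obtain ⟨f, hf⟩ := hv.exists_sem M
    obtain ⟨g, hg⟩ := ht.exists_sem_of_perm M (r := node (ctx Θ) (node (leaf (x, A)) (leaf (y, B))))
      (.refl _)
    obtain ⟨h, hh⟩ := hu.exists_sem_of_perm M (r := node (ctx Γ) (leaf (z, A'))) (.refl _)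
    exact Same.can ⟨_, hh.subst₁ (.letPair hm.1 (.id _) hf hg rfl) hn,
      (Sem.letPair hn (.assoc_inv _ _ _) hf ((hh.subst₁ hg (by
        simp [IsCtx] at hn hn' hk ⊢; grind)).can (.assoc _ _ _)) rfl).of_eq (pm_comm_eq _ _ _)⟩ hp'

end Interp

variable {V : Type u₃} [CompleteLattice V] [CommMonoid V] [IsQuantale V] [VCatSepAutonomous C V]

/-- The distance of parallel morphisms. -/
def homDist (V : Type u₃) [CompleteLattice V] [CommMonoid V] [IsQuantale V]
    [VCatSepAutonomous C V] {X Y : C} (f g : X ⟶ Y) : V :=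
  (VCatSepAutonomous.homVCat X Y : VCat V _).hom f g

section

variable {X Y Z X' Y' : C}

theorem one_le_homDist (f : X ⟶ Y) : 1 ≤ homDist V f f :=
  (VCatSepAutonomous.homVCat X Y : VCat V _).one_le f

theorem homDist_comp (f f' : X ⟶ Y) (g g' : Y ⟶ Z) :
    homDist V f f' * homDist V g g' ≤ homDist V (f ≫ g) (f' ≫ g') :=
  VCatSepAutonomous.comp_vfunctor X Y Z (f, g) (f', g')

theorem homDist_tensor (f f' : X ⟶ Y) (g g' : X' ⟶ Y') :
    homDist V f f' * homDist V g g' ≤ homDist V (f ⊗ₘ g) (f' ⊗ₘ g') :=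
  VCatSepAutonomous.tensor_vfunctor X Y X' Y' (f, g) (f', g')

theorem homDist_transpose (f f' : Y ⊗ X ⟶ Z) :
    homDist V f f' ≤ homDist V (transpose Y X Z f) (transpose Y X Z f') :=
  (VCatSepAutonomous.adj_viso Y X Z).1 f f'

theorem homDist_comp_left (c : X ⟶ Y) (g g' : Y ⟶ Z) :
    homDist V g g' ≤ homDist V (c ≫ g) (c ≫ g') := by
  calc homDist V g g' = 1 * homDist V g g' := (one_mul _).symm
    _ ≤ homDist V c c * homDist V g g' := mul_le_mul_left (one_le_homDist c) _
    _ ≤ _ := homDist_comp _ _ _ _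

theorem homDist_comp_right (f f' : X ⟶ Y) (c : Y ⟶ Z) :
    homDist V f f' ≤ homDist V (f ≫ c) (f' ≫ c) := by
  calc homDist V f f' = homDist V f f' * 1 := (mul_one _).symm
    _ ≤ homDist V f f' * homDist V c c := mul_le_mul_right (one_le_homDist c) _
    _ ≤ _ := homDist_comp _ _ _ _

theorem homDist_whiskerLeft (f f' : X ⟶ Y) : homDist V f f' ≤ homDist V (Z ◁ f) (Z ◁ f') := by
  calc homDist V f f' = 1 * homDist V f f' := (one_mul _).symm
    _ ≤ homDist V (𝟙 Z) (𝟙 Z) * homDist V f f' := mul_le_mul_left (one_le_homDist _) _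
    _ ≤ homDist V (𝟙 Z ⊗ₘ f) (𝟙 Z ⊗ₘ f') := homDist_tensor _ _ _ _
    _ = _ := by rw [id_tensorHom, id_tensorHom]

end

namespace Interp

/-- The interpretations of `v` and `t` are related by `q`. -/
def Holds (M : Interp C S) (r : Tree S.Ground) (v t : Subject S) (o : Target S.Ground) (q : V) :
    Prop :=
  ∃ f g, M.Sem r v o f ∧ M.Sem r t o g ∧ q ≤ homDist V f g

theorem Holds.can {r s : Tree S.Ground} {v t : Subject S} {o : Target S.Ground} {q : V}
    (h : M.Holds s v t o q) (hp : r.leaves.Perm s.leaves) : M.Holds r v t o q := by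
  obtain ⟨f, g, h, h', hq⟩ := h
  obtain ⟨c, hc⟩ := exists_can (b := M.obj) hp
  exact ⟨_, _, h.can hc, h'.can hc, hq.trans (homDist_comp_left _ _ _)⟩

theorem Same.holds {r : Tree S.Ground} {v t : Tm S} {A : Ty S.Ground} (h : M.Same r v t A)
    (hint : (1 : V) = ⊤) : M.Holds r (.tm v) (.tm t) (.ty A) (⊤ : V) := by
  obtain ⟨f, h, h'⟩ := h
  exact ⟨f, f, h, h', hint ▸ one_le_homDist f⟩

theorem Sem.eq {t : Tree S.Ground} {v : Tm S} {A : Ty S.Ground} {f f' : t.obj M.obj ⟶ tyObj M.obj A}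
    (h : M.Sem t (.tm v) (.ty A) f) (h' : M.Sem t (.tm v) (.ty A) f') : f = f' :=
  eq_of_heq (h.unique h' trivial).2

/-- Interpretations are unique, so a bound for one pair of them is a bound for every pair. -/
theorem Holds.le {r : Tree S.Ground} {v t : Tm S} {A : Ty S.Ground} {q : V}
    (h : M.Holds r (.tm v) (.tm t) (.ty A) q) {f g : r.obj M.obj ⟶ tyObj M.obj A}
    (hf : M.Sem r (.tm v) (.ty A) f) (hg : M.Sem r (.tm t) (.ty A) g) : q ≤ homDist V f g := by
  obtain ⟨f', g', hf', hg', hq⟩ := h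
  rwa [hf.eq hf', hg.eq hg']

theorem Holds.tup {n : ℕ} {Γ : Fin n → Ctx S.Ground} {E : Ctx S.Ground}
    (s : Shuffles n Γ E) (hE : IsCtx E) {v t : Fin n → Tm S} {A : Fin n → Ty S.Ground}
    {q : Fin n → V}
    (h : ∀ i, M.Holds (ctx (Γ i)) (.tm (v i)) (.tm (t i)) (.ty (A i)) (q i)) :
    M.Holds (ctx E) (.tup n v) (.tup n t) (.tup n A) (∏ i, q i) := by
  induction s with
  | nil Γ =>
    exact ⟨_, _, .tup_zero hE.names .ctx_nil, .tup_zero hE.names .ctx_nil, by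
      rw [Fin.prod_univ_zero]
      exact one_le_homDist (𝟙 (𝟙_ C))⟩
  | snoc Γ s s' ih =>
    have hE' := hE.perm s'.perm.symm
    obtain ⟨f, g, hf, hg, hq⟩ := ih hE'.append_left fun i => h i.castSucc
    obtain ⟨f', g', hf', hg', hq'⟩ := h (Fin.last _)
    refine ⟨_, _, .tup_succ hE.names (.split s') hf hf', .tup_succ hE.names (.split s') hg hg', ?_⟩
    rw [Fin.prod_univ_castSucc]
    exact (mul_le_mul' hq hq').trans ((homDist_tensor _ _ _ _).trans
      ((homDist_comp_right _ _ _).trans (homDist_comp_left _ _ _)))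

end Interp

/-- Since `q` is the least upper bound of the basis elements way below it, the rule (arch) is sound.
-/
theorem IsBasis.le_of_forall {B : Set V} (hB : IsBasis B) {q x : V}
    (h : ∀ r ∈ B, WayBelow r q → r ≤ x) : q ≤ x :=
  (hB q).2.2.2 fun r hr => h r hr.1 hr.2

/-- Theorems hold in models. -/
theorem Interp.IsModel.holds {B : Set V} (hint : (1 : V) = ⊤) (hB : IsBasis B) {T : VTheory S B}
    (hM : M.IsModel T) {Γ : Ctx S.Ground} {v t : Tm S} {A : Ty S.Ground} {q : V}
    (h : Thm T.Ax Γ v t A q) : M.Holds (ctx Γ) (.tm v) (.tm t) (.ty A) q := by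
  induction h with
  | ax e he =>
    obtain ⟨d⟩ := e.lhs_typed
    obtain ⟨d'⟩ := e.rhs_typed
    exact ⟨_, _, M.sem_spec d, M.sem_spec d', hM e he d d'⟩
  -- Equal morphisms are related by the unit, which is `⊤` by integrality.
  | base h => exact (same_of_baseEq h).holds hint
  | base_symm h =>
    obtain ⟨f, h, h'⟩ := same_of_baseEq (M := M) h
    exact Same.holds ⟨f, h', h⟩ hint
  | refl h =>
    obtain ⟨f, hf⟩ := h.exists_sem M
    exact Same.holds ⟨f, hf, hf⟩ hint
  | trans _ _ ih ih' =>
    obtain ⟨f, g, hf, hg, hq⟩ := ih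
    obtain ⟨g', h, hg', hh, hr⟩ := ih'
    obtain rfl := hg.eq hg'
    exact ⟨f, h, hf, hh, (mul_le_mul' hq hr).trans (VCat.mul_le _ _ _ _)⟩
  | weak _ hr _ ih =>
    obtain ⟨f, g, hf, hg, hq⟩ := ih
    exact ⟨f, g, hf, hg, hr.trans hq⟩
  | arch hv ht _ _ ih =>
    obtain ⟨f, hf⟩ := hv.exists_sem M
    obtain ⟨g, hg⟩ := ht.exists_sem M
    exact ⟨f, g, hf, hg, hB.le_of_forall fun r hr hr' => (ih r hr hr').le hf hg⟩
  | join hv ht _ ih =>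
    obtain ⟨f, hf⟩ := hv.exists_sem M
    obtain ⟨g, hg⟩ := ht.exists_sem M
    exact ⟨f, g, hf, hg, iSup_le fun i => (ih i).le hf hg⟩
  | pair _ _ s hE ih ih' =>
    obtain ⟨f, g, hf, hg, hq⟩ := ih
    obtain ⟨f', g', hf', hg', hq'⟩ := ih'
    exact ⟨_, _, .pair hE.names (.split s) hf hf', .pair hE.names (.split s) hg hg',
      (mul_le_mul' hq hq').trans ((homDist_tensor _ _ _ _).trans (homDist_comp_left _ _ _))⟩
  | op f _ s hE ih =>
    obtain ⟨f, g, hf, hg, hq⟩ := Holds.tup s hE ih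
    exact ⟨_, _, hf.op, hg.op, hq.trans (homDist_comp_right _ _ _)⟩
  | letStar _ _ s hE ih ih' =>
    obtain ⟨f, g, hf, hg, hq⟩ := ih
    obtain ⟨f', g', hf', hg', hq'⟩ := ih'
    refine ⟨_, _, .letStar hE.names ((Can.split s).comp (.braid _ _)) hf hf',
      .letStar hE.names ((Can.split s).comp (.braid _ _)) hg hg', ?_⟩
    exact (mul_le_mul' (hq.trans (homDist_whiskerLeft _ _)) (hq'.trans
      (homDist_comp_left _ _ _))).trans ((homDist_comp _ _ _ _).trans (homDist_comp_left _ _ _))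
  | @abs Γ v t A A' x q h ih =>
    obtain ⟨f, g, hf, hg, hq⟩ := ih.can (r := node (ctx Γ) (leaf (x, A))) (.refl _)
    have hn : IsCtx Γ := (List.nodup_cons.1 (show (ctx ((x, A) :: Γ)).names.Nodup from hf.nodup)).2
    exact ⟨_, _, .lam hn.names (.id _) hf rfl, .lam hn.names (.id _) hg rfl,
      hq.trans ((homDist_transpose _ _).trans (homDist_comp_left _ _ _))⟩
  | @pm Γ Δ E v v' t t' A A' D x y q r _ _ s hE ih ih' =>
    obtain ⟨f, g, hf, hg, hq⟩ := ih
    obtain ⟨f', g', hf', hg', hq'⟩ :=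
      ih'.can (r := node (ctx Δ) (node (leaf (x, A)) (leaf (y, A')))) (.refl _)
    refine ⟨_, _, .letPair hE.names ((Can.split s).comp (.braid _ _)) hf hf' rfl,
      .letPair hE.names ((Can.split s).comp (.braid _ _)) hg hg' rfl, ?_⟩
    exact (mul_le_mul' (hq.trans (homDist_whiskerLeft _ _)) hq').trans
      ((homDist_comp _ _ _ _).trans (homDist_comp_left _ _ _))
  | app _ _ s hE ih ih' =>
    obtain ⟨f, g, hf, hg, hq⟩ := ih
    obtain ⟨f', g', hf', hg', hq'⟩ := ih'
    exact ⟨_, _, .app hE.names (.split s) hf hf', .app hE.names (.split s) hg hg',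
      (mul_le_mul' hq hq').trans ((homDist_tensor _ _ _ _).trans
        ((homDist_comp_right _ _ _).trans (homDist_comp_left _ _ _)))⟩
  | perm _ hp ih => exact ih.can hp
  | @subst Γ Δ E v v' t t' A A' x q r _ _ hp hE ih ih' =>
    obtain ⟨f, g, hf, hg, hq⟩ := ih.can (r := node (ctx Γ) (leaf (x, A))) (.refl _)
    obtain ⟨f', g', hf', hg', hq'⟩ := ih'
    have hp' : E.Perm (node (ctx Γ) (ctx Δ)).leaves := hp.trans List.perm_append_comm
    have hn := nodup_of_perm hE hp'
    refine Holds.can ⟨_, _, hf.subst₁ hf' hn, hg.subst₁ hg' hn, ?_⟩ hp'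
    -- The substituted term is interpreted first in the composite, so its label comes first.
    rw [mul_comm]
    exact (mul_le_mul' (hq'.trans (homDist_whiskerLeft _ _)) hq).trans (homDist_comp _ _ _ _)

end Soundness

/-! ### Admissible rules of the calculus -/

section Admissible

open VLambda.Tree

variable {S : Signature.{u₁, u₂}} {V : Type u₃} [CompleteLattice V] [CommMonoid V] [IsQuantale V]
  {B : Set V} {Ax : Set (VEq S B)} {Γ Δ E : Ctx S.Ground} {v t : Tm S} {A A' D : Ty S.Ground}

/-- Interpret in the trivial model and read off a derivation for the permuted context. -/
theorem Typed.perm (h : Typed Γ v A) (hp : E.Perm Γ) : Typed E v A := by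
  obtain ⟨_, h⟩ := h.exists_sem (trivInterp S)
  exact h.typed_tm hp

theorem Typed.free_iff (h : Typed Γ v A) (x : ℕ) : v.Free x ↔ x ∈ Γ.map Prod.fst := by
  obtain ⟨_, h⟩ := h.exists_sem (trivInterp S)
  exact h.free_iff x

end Admissible

end VLambda

namespace VLambda

set_option linter.unusedSectionVars false

/-! ### Rules up to permutation of contexts, and provable equality. -/

section Calculus

variable {S : Signature.{u₁, u₂}} {V : Type u₃} [CompleteLattice V] [CommMonoid V] [IsQuantale V]
  {B : Set V} {Ax : Set (VEq S B)} {Γ Δ E : Ctx S.Ground} {v v' t t' u : Tm S}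
  {A A' D : Ty S.Ground} {q r : V}

theorem Typed.pair (h : Typed Γ v A) (h' : Typed Δ t A') (hp : E.Perm (Γ ++ Δ)) (hE : IsCtx E) :
    Typed E (.pair v t) (.tensor A A') := by
  obtain ⟨_, _, h₁, h₂, ⟨s⟩⟩ := Shuffle.exists_of_perm hp
  obtain ⟨d⟩ := h.perm h₁
  obtain ⟨d'⟩ := h'.perm h₂
  exact ⟨.pair d d' s hE⟩

theorem Typed.app (h : Typed Γ v (.lolli A A')) (h' : Typed Δ t A) (hp : E.Perm (Γ ++ Δ))
    (hE : IsCtx E) : Typed E (.app v t) A' := by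
  obtain ⟨_, _, h₁, h₂, ⟨s⟩⟩ := Shuffle.exists_of_perm hp
  obtain ⟨d⟩ := h.perm h₁
  obtain ⟨d'⟩ := h'.perm h₂
  exact ⟨.app d d' s hE⟩

theorem Typed.letStar (h : Typed Γ v .unit) (h' : Typed Δ t A) (hp : E.Perm (Γ ++ Δ))
    (hE : IsCtx E) : Typed E (.letStar v t) A := by
  obtain ⟨_, _, h₁, h₂, ⟨s⟩⟩ := Shuffle.exists_of_perm hp
  obtain ⟨d⟩ := h.perm h₁
  obtain ⟨d'⟩ := h'.perm h₂
  exact ⟨.letStar d d' s hE⟩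

theorem Typed.pm {x y : ℕ} (h : Typed Γ v (.tensor A A'))
    (h' : Typed ((y, A') :: (x, A) :: Δ) t D) (hp : E.Perm (Γ ++ Δ)) (hE : IsCtx E) :
    Typed E (.pm v x y t) D := by
  obtain ⟨_, _, h₁, h₂, ⟨s⟩⟩ := Shuffle.exists_of_perm hp
  obtain ⟨d⟩ := h.perm h₁
  obtain ⟨d'⟩ := h'.perm ((h₂.cons _).cons _)
  exact ⟨.pm d d' s hE⟩

theorem Typed.abs {x : ℕ} (h : Typed ((x, A) :: Γ) v A') : Typed Γ (.abs x A v) (.lolli A A') := by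
  obtain ⟨d⟩ := h
  exact ⟨.abs d⟩

theorem Typed.fvar (x : ℕ) (A : Ty S.Ground) : Typed [(x, A)] (.fvar x) A := ⟨.var x A⟩

theorem Typed.star : Typed (S := S) [] .star .unit := ⟨.star⟩

theorem Thm.pair_of_perm (h : Thm Ax Γ v t A q) (h' : Thm Ax Δ v' t' A' r)
    (hp : E.Perm (Γ ++ Δ)) (hE : IsCtx E) :
    Thm Ax E (.pair v v') (.pair t t') (.tensor A A') (q * r) := by
  obtain ⟨_, _, h₁, h₂, ⟨s⟩⟩ := Shuffle.exists_of_perm hp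
  exact (h.perm h₁).pair (h'.perm h₂) s hE

theorem Thm.app_of_perm (h : Thm Ax Γ v t (.lolli A A') q) (h' : Thm Ax Δ v' t' A r)
    (hp : E.Perm (Γ ++ Δ)) (hE : IsCtx E) : Thm Ax E (.app v v') (.app t t') A' (q * r) := by
  obtain ⟨_, _, h₁, h₂, ⟨s⟩⟩ := Shuffle.exists_of_perm hp
  exact (h.perm h₁).app (h'.perm h₂) s hE

theorem Thm.letStar_of_perm (h : Thm Ax Γ v t .unit q) (h' : Thm Ax Δ v' t' A r)
    (hp : E.Perm (Γ ++ Δ)) (hE : IsCtx E) : Thm Ax E (.letStar v v') (.letStar t t') A (q * r) := by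
  obtain ⟨_, _, h₁, h₂, ⟨s⟩⟩ := Shuffle.exists_of_perm hp
  exact (h.perm h₁).letStar (h'.perm h₂) s hE

theorem Thm.pm_of_perm {x y : ℕ} (h : Thm Ax Γ v t (.tensor A A') q)
    (h' : Thm Ax ((y, A') :: (x, A) :: Δ) v' t' D r) (hp : E.Perm (Γ ++ Δ)) (hE : IsCtx E) :
    Thm Ax E (.pm v x y v') (.pm t x y t') D (q * r) := by
  obtain ⟨_, _, h₁, h₂, ⟨s⟩⟩ := Shuffle.exists_of_perm hp
  exact (h.perm h₁).pm (h'.perm ((h₂.cons _).cons _)) s hE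

variable [hint : Fact ((1 : V) = ⊤)]

theorem mul_top_eq (q : V) : q * ⊤ = q := by rw [← hint.out, mul_one]

theorem top_mul_eq (q : V) : ⊤ * q = q := by rw [← hint.out, one_mul]

/-- Provable equality. -/
def TEq (Ax : Set (VEq S B)) (Γ : Ctx S.Ground) (v t : Tm S) (A : Ty S.Ground) : Prop :=
  Thm Ax Γ v t A ⊤ ∧ Thm Ax Γ t v A ⊤

namespace TEq

theorem refl (h : Typed Γ v A) : TEq Ax Γ v v A := ⟨.refl h, .refl h⟩

theorem symm (h : TEq Ax Γ v t A) : TEq Ax Γ t v A := ⟨h.2, h.1⟩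

theorem trans (h : TEq Ax Γ v t A) (h' : TEq Ax Γ t u A) : TEq Ax Γ v u A :=
  ⟨mul_top_eq (⊤ : V) ▸ h.1.trans h'.1, mul_top_eq (⊤ : V) ▸ h'.2.trans h.2⟩

theorem base (h : BaseEq Γ v t A) : TEq Ax Γ v t A := ⟨.base h, .base_symm h⟩

theorem perm (h : TEq Ax Γ v t A) (hp : Δ.Perm Γ) : TEq Ax Δ v t A :=
  ⟨h.1.perm hp, h.2.perm hp⟩

theorem pair (h : TEq Ax Γ v t A) (h' : TEq Ax Δ v' t' A')
    (hp : E.Perm (Γ ++ Δ)) (hE : IsCtx E) :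
    TEq Ax E (.pair v v') (.pair t t') (.tensor A A') :=
  ⟨mul_top_eq (⊤ : V) ▸ h.1.pair_of_perm h'.1 hp hE, mul_top_eq (⊤ : V) ▸ h.2.pair_of_perm h'.2 hp hE⟩

theorem app (h : TEq Ax Γ v t (.lolli A A')) (h' : TEq Ax Δ v' t' A)
    (hp : E.Perm (Γ ++ Δ)) (hE : IsCtx E) : TEq Ax E (.app v v') (.app t t') A' :=
  ⟨mul_top_eq (⊤ : V) ▸ h.1.app_of_perm h'.1 hp hE, mul_top_eq (⊤ : V) ▸ h.2.app_of_perm h'.2 hp hE⟩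

theorem letStar (h : TEq Ax Γ v t .unit) (h' : TEq Ax Δ v' t' A)
    (hp : E.Perm (Γ ++ Δ)) (hE : IsCtx E) : TEq Ax E (.letStar v v') (.letStar t t') A :=
  ⟨mul_top_eq (⊤ : V) ▸ h.1.letStar_of_perm h'.1 hp hE,
    mul_top_eq (⊤ : V) ▸ h.2.letStar_of_perm h'.2 hp hE⟩

theorem pm {x y : ℕ} (h : TEq Ax Γ v t (.tensor A A'))
    (h' : TEq Ax ((y, A') :: (x, A) :: Δ) v' t' D) (hp : E.Perm (Γ ++ Δ)) (hE : IsCtx E) :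
    TEq Ax E (.pm v x y v') (.pm t x y t') D :=
  ⟨mul_top_eq (⊤ : V) ▸ h.1.pm_of_perm h'.1 hp hE, mul_top_eq (⊤ : V) ▸ h.2.pm_of_perm h'.2 hp hE⟩

theorem abs {x : ℕ} (h : TEq Ax ((x, A) :: Γ) v t A') :
    TEq Ax Γ (.abs x A v) (.abs x A t) (.lolli A A') := ⟨h.1.abs, h.2.abs⟩

end TEq

/-! #### Simultaneous substitution -/

theorem Thm.subst_refl {x : ℕ} (h : Thm Ax ((x, A) :: Γ) v t A' q) (hu : Typed Δ u A)
    (hp : E.Perm (Γ ++ Δ)) (hE : IsCtx E) :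
    Thm Ax E (v.subst₁ x u) (t.subst₁ x u) A' q :=
  mul_top_eq q ▸ h.subst (.refl hu) hp hE

/-- The substitution `σ`, restricted to the variables of `Γ`. -/
def restrictSubst (Γ : Ctx S.Ground) (σ : ℕ → Tm S) (x : ℕ) : Tm S :=
  if x ∈ Γ.map Prod.fst then σ x else .fvar x

/-- The variables are replaced one at a time by the rule for single substitution. By disjointness,
later substitutions leave the terms inserted earlier unchanged. -/
theorem Thm.subst_of_disjoint {σ : ℕ → Tm S} {θ : ℕ × Ty S.Ground → Ctx S.Ground}
    (hσ : ∀ p ∈ Γ, Typed (θ p) (σ p.1) p.2) (h : Thm Ax (Γ ++ Δ) v t A q)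
    (hn : IsCtx (Γ.flatMap θ ++ Γ ++ Δ)) :
    Thm Ax (Γ.flatMap θ ++ Δ) (v.subst (restrictSubst Γ σ)) (t.subst (restrictSubst Γ σ)) A q := by
  induction Γ generalizing Δ v t with
  | nil =>
    have : restrictSubst (S := S) [] σ = .fvar := by ext; simp [restrictSubst]
    simpa [this] using h
  | cons p Γ ih =>
    have hp := hσ p (by simp)
    have hs : ∀ v : Tm S, (v.subst₁ p.1 (σ p.1)).subst (restrictSubst Γ σ) =
        v.subst (restrictSubst (p :: Γ) σ) := by
      intro v
      rw [Tm.subst₁, Tm.subst_subst]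
      refine Tm.subst_congr fun x _ => ?_
      by_cases hx : x = p.1
      · subst hx
        rw [Function.update_self, Tm.subst_eq_self]
        · simp [restrictSubst]
        · intro y hy
          have := (hp.free_iff y).1 hy
          rw [restrictSubst, if_neg]
          intro h'
          simp only [IsCtx, List.map_append, List.flatMap_cons, List.map_cons, List.append_assoc,
            List.nodup_append] at hn
          exact hn.2.2 y this y (by simp only [List.mem_append, List.mem_cons]; tauto) rfl
      · rw [Function.update_of_ne hx]
        simp only [Tm.subst, restrictSubst, List.map_cons, List.mem_cons, hx, false_or]
    have hn' : IsCtx (Γ.flatMap θ ++ Γ ++ (θ p ++ Δ)) := by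
      simp only [IsCtx, List.map_append, List.flatMap_cons, List.map_cons, List.append_assoc,
        List.nodup_append, List.nodup_cons, List.mem_append, List.mem_cons] at hn ⊢
      grind
    have := ih (fun p hp => hσ p (List.mem_cons_of_mem _ hp)) (h.subst_refl hp
      (E := Γ ++ (θ p ++ Δ)) (by
        show (Γ ++ (θ p ++ Δ)).Perm ((Γ ++ Δ) ++ θ p)
        rw [List.append_assoc]
        exact List.perm_append_comm.append_left _) (by
          rw [List.append_assoc] at hn'
          exact hn'.append_right)) hn'
    rw [hs, hs] at this
    refine this.perm ?_
    rw [List.flatMap_cons, ← List.append_assoc]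
    exact List.perm_append_comm.append_right _

/-- The variables of `Γ` may clash with those of the substituted terms. They are first renamed to
fresh ones, after which both the renaming and the actual substitution are disjoint. -/
theorem Thm.subst_all {σ : ℕ → Tm S} {θ : ℕ × Ty S.Ground → Ctx S.Ground}
    (hv : Typed Γ v A) (ht : Typed Γ t A)
    (hσ : ∀ p ∈ Γ, Typed (θ p) (σ p.1) p.2) (h : Thm Ax Γ v t A q) (hp : E.Perm (Γ.flatMap θ))
    (hE : IsCtx E) : Thm Ax E (v.subst σ) (t.subst σ) A q := by
  -- The shift `x ↦ N + x` avoids all names in `Γ` and `E`. One more than the sum of these names is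
  -- large enough.
  obtain ⟨N, hN⟩ : ∃ N, ∀ x ∈ Γ.map Prod.fst ++ E.map Prod.fst, x < N :=
    ⟨_, fun x hx => Nat.lt_succ_of_le (List.single_le_sum (fun _ _ => Nat.zero_le _) x hx)⟩
  have hΓ := hv.isCtx
  let Γ' : Ctx S.Ground := Γ.map fun p => (N + p.1, p.2)
  have e₁ : (Γ.flatMap fun p => [(N + p.1, p.2)]) = Γ' := List.map_eq_flatMap.symm
  have e₂ : (Γ'.flatMap fun p => θ (p.1 - N, p.2)) = Γ.flatMap θ := by
    simp [Γ', List.flatMap_map]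
  have n₁ : IsCtx (Γ' ++ Γ) := by
    simp only [IsCtx, List.map_append, Γ', List.map_map, List.nodup_append]
    refine ⟨?_, hΓ, ?_⟩
    · have := List.Nodup.map (f := fun x => N + x) (fun x y h => by simpa using h) hΓ
      simpa [Function.comp_def] using this
    · intro a ha b hb
      have := hN b (List.mem_append_left _ hb)
      obtain ⟨p, -, rfl⟩ := List.mem_map.1 ha
      simp
      omega
  have n₂ : IsCtx (Γ.flatMap θ ++ Γ') := by
    have hE' := hE.perm hp.symm
    simp only [IsCtx, List.map_append, List.nodup_append]
    refine ⟨hE', n₁.append_left, ?_⟩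
    intro a ha b hb
    have := hN a (List.mem_append_right _ ((hp.map Prod.fst).symm.subset ha))
    simp only [Γ', List.map_map] at hb
    obtain ⟨p, -, rfl⟩ := List.mem_map.1 hb
    simp
    omega
  have h₁ := Thm.subst_of_disjoint (Δ := []) (σ := fun x => .fvar (N + x))
    (θ := fun p => [(N + p.1, p.2)]) (fun p _ => .fvar _ _) (by simpa using h)
    (by rw [e₁]; simpa using n₁)
  rw [e₁] at h₁
  have h₂ := Thm.subst_of_disjoint (Δ := []) (σ := fun x => σ (x - N))
    (θ := fun p => θ (p.1 - N, p.2)) (by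
      intro p' hp'
      obtain ⟨p, hp, rfl⟩ := List.mem_map.1 hp'
      simpa using hσ p hp) h₁ (by rw [e₂]; simpa using n₂)
  rw [e₂, List.append_nil] at h₂
  have key : ∀ {v : Tm S}, Typed Γ v A → (v.subst (restrictSubst Γ fun x => .fvar (N + x))).subst
      (restrictSubst Γ' fun x => σ (x - N)) = v.subst σ := by
    intro v hv
    rw [Tm.subst_subst]
    refine Tm.subst_congr fun x hx => ?_
    have hx := (hv.free_iff x).1 hx
    have : N + x ∈ Γ'.map Prod.fst := by
      obtain ⟨p, hpΓ, rfl⟩ := List.mem_map.1 hx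
      simp only [Γ', List.map_map]
      exact List.mem_map.2 ⟨p, hpΓ, rfl⟩
    simp [restrictSubst, hx, Tm.subst, this]
  rw [key hv, key ht] at h₂
  exact h₂.perm hp

theorem TEq.subst_all {σ : ℕ → Tm S} {θ : ℕ × Ty S.Ground → Ctx S.Ground}
    (hv : Typed Γ v A) (ht : Typed Γ t A)
    (hσ : ∀ p ∈ Γ, Typed (θ p) (σ p.1) p.2) (h : TEq Ax Γ v t A) (hp : E.Perm (Γ.flatMap θ))
    (hE : IsCtx E) : TEq Ax E (v.subst σ) (t.subst σ) A :=
  ⟨h.1.subst_all hv ht hσ hp hE, h.2.subst_all ht hv hσ hp hE⟩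

end Calculus

end VLambda

namespace VLambda

set_option linter.unusedSectionVars false

/-! ### Single substitution and the term formers. -/

namespace Tm

variable {S : Signature.{u₁, u₂}} {v t u : Tm S} {x y z : ℕ} {A : Ty S.Ground}

theorem subst₁_of_not_free (h : ¬ Free x v) : v.subst₁ x t = v :=
  subst_eq_self fun y hy => Function.update_of_ne (by rintro rfl; exact h hy) _ _

@[simp] theorem subst₁_self : v.subst₁ x (fvar x) = v := by
  rw [subst₁, Function.update_eq_self, subst_fvar]

@[simp] theorem subst₁_fvar : (fvar x : Tm S).subst₁ x t = t := by
  simp [subst₁, subst]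

theorem subst₁_fvar_of_ne (h : y ≠ x) : (fvar y : Tm S).subst₁ x t = fvar y := by
  simp [subst₁, subst, h]

theorem subst₁_app : (app v u).subst₁ x t = app (v.subst₁ x t) (u.subst₁ x t) := rfl

theorem subst₁_pair : (pair v u).subst₁ x t = pair (v.subst₁ x t) (u.subst₁ x t) := rfl

theorem subst₁_letStar : (letStar v u).subst₁ x t = letStar (v.subst₁ x t) (u.subst₁ x t) := rfl

theorem subst_update_self (h : y ≠ x) :
    v.subst (Function.update (Function.update fvar x t) y (fvar y)) = v.subst₁ x t := by
  refine subst_congr fun z _ => ?_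
  by_cases hz : z = y
  · subst hz; simp [h]
  · simp [hz]

theorem subst₁_abs (h : y ≠ x) (hy : ¬ Free y t) :
    (abs y A v).subst₁ x t = abs y A (v.subst₁ x t) := by
  have : (close 0 y v).subst (Function.update fvar x t) = close 0 y (v.subst₁ x t) := by
    rw [subst_close (y := y), subst_update_self h]
    intro w _ hw
    by_cases hwx : w = x
    · simpa [hwx] using hy
    · simpa [hwx, Free] using hw
  simp [abs, subst₁, subst, this]

theorem subst₁_pm (hx : x ≠ z) (hy : y ≠ z) (hxt : ¬ Free x t) (hyt : ¬ Free y t) :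
    (pm v x y u).subst₁ z t = pm (v.subst₁ z t) x y (u.subst₁ z t) := by
  have hf : ∀ {y' w : ℕ}, ¬ Free y' t → w ≠ y' → ¬ Free y' (Function.update fvar z t w) := by
    intro y' w hy' hw
    by_cases hwx : w = z
    · simpa [hwx] using hy'
    · simpa [hwx, Free] using hw
  have : (close 0 y (close 1 x u)).subst (Function.update fvar z t) =
      close 0 y (close 1 x (u.subst₁ z t)) := by
    rw [subst_close (y := y) fun w _ hw => hf hyt hw, subst_update_self hy]
    unfold subst₁
    rw [subst_close (y := x) fun w _ hw => hf hxt hw, subst_update_self hx]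
    rfl
  simp [pm, subst₁, subst, this]

end Tm

/-! ### Linear patterns and functional completeness. -/

section Calculus

variable {S : Signature.{u₁, u₂}} {V : Type u₃} [CompleteLattice V] [CommMonoid V] [IsQuantale V]
  {B : Set V} {Ax : Set (VEq S B)} {Γ Δ E : Ctx S.Ground} {v v' t t' u : Tm S}
  {A A' D : Ty S.Ground} {q r : V}

theorem IsCtx.cons {x : ℕ} (h : IsCtx Γ) (hx : x ∉ Γ.map Prod.fst) : IsCtx ((x, A) :: Γ) :=
  List.nodup_cons.2 ⟨hx, h⟩

theorem Typed.not_free {x : ℕ} (h : Typed Γ v A) (hx : x ∉ Γ.map Prod.fst) : ¬ v.Free x :=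
  fun h' => hx ((h.free_iff x).1 h')

/-- Linear patterns: the terms built from variables by `∗` and `⊗`. -/
inductive Pattern : Ctx S.Ground → Tm S → Ty S.Ground → Prop
  | var (x : ℕ) (A : Ty S.Ground) : Pattern [(x, A)] (.fvar x) A
  | star : Pattern [] .star .unit
  | pair {Γ Δ E : Ctx S.Ground} {v t : Tm S} {A A' : Ty S.Ground} :
      Pattern Γ v A → Pattern Δ t A' → E.Perm (Γ ++ Δ) → IsCtx E →
      Pattern E (.pair v t) (.tensor A A')

theorem Pattern.typed (h : Pattern Γ v A) : Typed Γ v A := by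
  induction h with
  | var x A => exact .fvar x A
  | star => exact .star
  | pair _ _ hp hE ih ih' => exact ih.pair ih' hp hE

variable [hint : Fact ((1 : V) = ⊤)]

theorem TEq.thm (h : TEq Ax Γ v v' A) (h' : TEq Ax Γ t t' A) (hq : Thm Ax Γ v t A q) :
    Thm Ax Γ v' t' A q := by
  have := (h.2.trans hq).trans h'.1
  rwa [top_mul_eq, mul_top_eq] at this

theorem TEq.beta {x : ℕ} (h : Typed ((x, A) :: Γ) v A') (h' : Typed Δ t A) (hp : E.Perm (Γ ++ Δ))
    (hE : IsCtx E) : TEq Ax E (.app (.abs x A v) t) (v.subst₁ x t) A' :=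
  .base (.abs_beta h h' hp hE)

/-- Currying followed by uncurrying against a pattern match: `λ z. pm z to x ⊗ y. m x y`. -/
def uncurry (x y z : ℕ) (A A' : Ty S.Ground) (m : Tm S) : Tm S :=
  .abs z (.tensor A A') (.pm (.fvar z) x y (.app (.app m (.fvar x)) (.fvar y)))

section Uncurry

variable {x y z : ℕ} (hΓ : IsCtx Γ) (hx : x ∉ Γ.map Prod.fst) (hy : y ∉ Γ.map Prod.fst)
  (hz : z ∉ Γ.map Prod.fst) (hxy : x ≠ y) (hxz : x ≠ z) (hyz : y ≠ z)

include hΓ hx hy hxy in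
theorem isCtx_cons_cons : IsCtx ((y, A') :: (x, A) :: Γ) :=
  (hΓ.cons hx).cons (by simpa using ⟨hxy.symm, by simpa using hy⟩)

include hΓ hx hy hxy in
theorem typed_app_app (h : Typed Γ v (.lolli A (.lolli A' D))) :
    Typed ((y, A') :: (x, A) :: Γ) (.app (.app v (.fvar x)) (.fvar y)) D :=
  (h.app (.fvar x A) List.perm_append_comm (hΓ.cons hx)).app (.fvar y A')
    (List.perm_append_comm (l₁ := [(y, A')])) (isCtx_cons_cons hΓ hx hy hxy)

include hΓ hx hy hxy hz in
theorem typed_uncurry (h : Typed Γ v (.lolli A (.lolli A' D))) :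
    Typed Γ (uncurry x y z A A' v) (.lolli (.tensor A A') D) :=
  .abs ((Typed.fvar z _).pm (typed_app_app hΓ hx hy hxy h) (.refl _) (hΓ.cons hz))

include hΓ hx hy hxy hz in
theorem Thm.uncurry (h : Thm Ax Γ v t (.lolli A (.lolli A' D)) q) :
    Thm Ax Γ (uncurry x y z A A' v) (uncurry x y z A A' t) (.lolli (.tensor A A') D) q := by
  have h₁ := h.app_of_perm (.refl (.fvar x A)) List.perm_append_comm (hΓ.cons hx)
  have h₂ := h₁.app_of_perm (.refl (.fvar y A')) (List.perm_append_comm (l₁ := [(y, A')]))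
    (isCtx_cons_cons (A := A) (A' := A') hΓ hx hy hxy)
  have h₃ := ((Thm.refl (Typed.fvar z (.tensor A A'))).pm_of_perm h₂ (.refl _) (hΓ.cons hz)).abs
  rwa [mul_top_eq, mul_top_eq, top_mul_eq] at h₃

include hΓ hx hy hxy hz in
theorem TEq.uncurry (h : TEq Ax Γ v t (.lolli A (.lolli A' D))) :
    TEq Ax Γ (uncurry x y z A A' v) (uncurry x y z A A' t) (.lolli (.tensor A A') D) :=
  ⟨h.1.uncurry hΓ hx hy hz hxy, h.2.uncurry hΓ hx hy hz hxy⟩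

include hΓ hx hy hxy hz hxz hyz in
-- The β-rule for `λ z` is followed by the β-rule for the match. Freshness keeps the auxiliary names
-- out of `v` and prevents capture of variables of `t` and `t'`.
theorem TEq.uncurry_app {Δ' : Ctx S.Ground} (h : Typed Γ v (.lolli A (.lolli A' D)))
    (ht : Typed Δ t A) (ht' : Typed Δ' t' A') (hp : E.Perm (Γ ++ (Δ ++ Δ'))) (hE : IsCtx E)
    (hxE : x ∉ (Δ ++ Δ').map Prod.fst) (hyE : y ∉ (Δ ++ Δ').map Prod.fst) :
    TEq Ax E (.app (VLambda.uncurry x y z A A' v) (.pair t t')) (.app (.app v t) t') D := by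
  have hΔ : IsCtx (Δ ++ Δ') := (hE.perm hp.symm).append_right
  have htt := ht.pair ht' (.refl _) hΔ
  have hvx : ¬ v.Free x := h.not_free hx
  have hvy : ¬ v.Free y := h.not_free hy
  have h₁ := TEq.beta (Ax := Ax) ((Typed.fvar z (.tensor A A')).pm
    (typed_app_app hΓ hx hy hxy h) (.refl _) (hΓ.cons hz)) htt hp hE
  rw [Tm.subst₁_pm hxz hyz (htt.not_free hxE) (htt.not_free hyE), Tm.subst₁_fvar, Tm.subst₁_app,
    Tm.subst₁_app, Tm.subst₁_fvar_of_ne hxz, Tm.subst₁_fvar_of_ne hyz,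
    Tm.subst₁_of_not_free (h.not_free hz)] at h₁
  have h₂ := TEq.base (Ax := Ax) (.pm_beta ht ht' (typed_app_app hΓ hx hy hxy h)
    (hp.trans List.perm_append_comm) hE)
  have : (Tm.app (.app v (.fvar x)) (.fvar y)).subst₂ x t y t' = .app (.app v t) t' := by
    have : v.subst (Function.update (Function.update .fvar x t) y t') = v :=
      Tm.subst_eq_self fun w hw => by
        have h₁ : w ≠ x := by rintro rfl; exact hvx hw
        have h₂ : w ≠ y := by rintro rfl; exact hvy hw
        simp [h₁, h₂]
    simp [Tm.subst₂, Tm.subst, this, hxy]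
  rw [this] at h₂
  exact h₁.trans h₂

include hΓ hx hy hxy hz hxz hyz in
/-- A function on a tensor product is determined by its curried form. -/
theorem TEq.uncurry_abs_abs (h : Typed Γ u (.lolli (.tensor A A') D)) :
    TEq Ax Γ (VLambda.uncurry x y z A A'
      (.abs x A (.abs y A' (.app u (.pair (.fvar x) (.fvar y)))))) u (.lolli (.tensor A A') D) := by
  have hc := isCtx_cons_cons (A := A) (A' := A') hΓ hx hy hxy
  have hpair : Typed [(y, A'), (x, A)] (.pair (.fvar x) (.fvar y)) (.tensor A A') :=
    (Typed.fvar x A).pair (.fvar y A') (.swap _ _ _) (IsCtx.append_left (Δ := Γ) hc)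
  have hb : Typed ((y, A') :: (x, A) :: Γ) (.app u (.pair (.fvar x) (.fvar y))) D :=
    h.app hpair (List.perm_append_comm (l₁ := [(y, A'), (x, A)])) hc
  have h₁ := TEq.beta (Ax := Ax) hb.abs (.fvar x A) (List.perm_append_comm (l₁ := [(x, A)]))
    (hΓ.cons hx)
  rw [Tm.subst₁_self] at h₁
  have h₂ := h₁.app (.refl (.fvar y A')) (List.perm_append_comm (l₁ := [(y, A')])) hc
  have h₃ := TEq.beta (Ax := Ax) hb (.fvar y A') (List.perm_append_comm (l₁ := [(y, A')])) hc
  rw [Tm.subst₁_self] at h₃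
  have h₄ := (TEq.refl (Ax := Ax) (Typed.fvar z (.tensor A A'))).pm (h₂.trans h₃)
    (.refl _) (hΓ.cons hz)
  -- After the β-reductions the body is `pm z to x ⊗ y. u (x ⊗ y)`, which η for matching contracts
  -- to `u z`.
  have h₅ := TEq.base (Ax := Ax) (.pm_eta (x := x) (y := y) (Typed.fvar z (.tensor A A'))
    (h.app (.fvar z _) (List.perm_append_comm (l₁ := [(z, _)])) (hΓ.cons hz)) hc
    (.refl _) (hΓ.cons hz))
  rw [Tm.subst₁_app, Tm.subst₁_of_not_free (h.not_free hz), Tm.subst₁_fvar,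
    Tm.subst₁_self] at h₅
  exact (h₄.trans h₅).abs.trans (.base (.abs_eta h (hΓ.cons hz)))

end Uncurry

theorem perm_of_count {α : Type*} {l l' : List α}
    (h : ∀ [DecidableEq α], ∀ a, l.count a = l'.count a) : l.Perm l' := by
  classical exact List.perm_iff_count.2 h

/-- Abstraction over the variables of a pattern. -/
theorem Pattern.exists_abstraction {P : Tm S} (hP : Pattern Γ P A) (Ax : Set (VEq S B))
    (hΓ : IsCtx (Γ ++ Δ)) (D : Ty S.Ground) : ∃ L : Tm S → Tm S,
      (∀ v, Typed (Γ ++ Δ) v D → Typed Δ (L v) (.lolli A D)) ∧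
      (∀ v t q, Thm Ax (Γ ++ Δ) v t D q → Thm Ax Δ (L v) (L t) (.lolli A D) q) ∧
      (∀ u, Typed Δ u (.lolli A D) → TEq Ax Δ (L (.app u P)) u (.lolli A D)) ∧
      (∀ v, Typed (Γ ++ Δ) v D → TEq Ax (Γ ++ Δ) (.app (L v) P) v D) := by
  induction hP generalizing Δ D with
  | var x A =>
    refine ⟨.abs x A, fun v hv => .abs hv, fun v t q h => .abs h,
      fun u hu => .base (.abs_eta hu hΓ), fun v hv => ?_⟩
    have := TEq.beta (Ax := Ax) hv (.fvar x A) (List.perm_append_comm (l₁ := [(x, A)])) hΓ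
    rwa [Tm.subst₁_self] at this
  | star =>
    -- The pattern `∗` binds nothing, so its abstraction is `λ z. z to ∗. v` with a fresh `z`.
    obtain ⟨z, hz⟩ := exists_fresh (Δ.map Prod.fst)
    have hc : IsCtx ((z, .unit) :: Δ) := IsCtx.cons (Γ := Δ) hΓ hz
    have hv' : ∀ {v : Tm S}, Typed Δ v D →
      Typed ((z, .unit) :: Δ) (.letStar (.fvar z) v) D := fun hv =>
        (Typed.fvar z .unit).letStar hv (.refl _) hc
    refine ⟨fun v => .abs z .unit (.letStar (.fvar z) v), fun v hv => (hv' hv).abs,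
      fun v t q h => ?_, fun u hu => ?_, fun v hv => ?_⟩
    · have := ((Thm.refl (Typed.fvar z .unit)).letStar_of_perm h (.refl _) hc).abs
      rwa [top_mul_eq] at this
    · have := TEq.base (Ax := Ax) (.star_eta (Typed.fvar z .unit)
        (hu.app (.fvar z _) (List.perm_append_comm (l₁ := [(z, _)])) hc) (.refl _) hc)
      rw [Tm.subst₁_app, Tm.subst₁_of_not_free (hu.not_free hz), Tm.subst₁_fvar, Tm.subst₁_app,
        Tm.subst₁_of_not_free (hu.not_free hz), Tm.subst₁_fvar] at this
      exact this.abs.trans (.base (.abs_eta hu hc))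
    · have := TEq.beta (Ax := Ax) (hv' hv) .star (by simp) hΓ
      rw [Tm.subst₁_letStar, Tm.subst₁_fvar, Tm.subst₁_of_not_free (hv.not_free hz)] at this
      exact this.trans (.base (.star_beta hv))
  | @pair Γ₁ Γ₂ E P Q A A' hP hQ hp hE ihP ihQ =>
    have hp' : (Γ₂ ++ (Γ₁ ++ Δ)).Perm (E ++ Δ) := perm_of_count fun a => by
      have := hp.count_eq a
      simp only [List.count_append] at this ⊢
      omega
    have hc₂ : IsCtx (Γ₂ ++ (Γ₁ ++ Δ)) := hΓ.perm hp'
    have hc₁ : IsCtx (Γ₁ ++ Δ) := hc₂.append_right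
    have hc : IsCtx Δ := hΓ.append_right
    -- Abstract over the variables of `Q`, then over those of `P`, and uncurry the result.
    obtain ⟨LQ, q₀, q₁, q₂, q₃⟩ := ihQ hc₂ D
    obtain ⟨LP, p₀, p₁, p₂, p₃⟩ := ihP hc₁ (.lolli A' D)
    obtain ⟨x, hx⟩ := exists_fresh ((E ++ Δ).map Prod.fst)
    obtain ⟨y, hy⟩ := exists_fresh (x :: (E ++ Δ).map Prod.fst)
    obtain ⟨z, hz⟩ := exists_fresh (x :: y :: (E ++ Δ).map Prod.fst)
    have hm : ∀ {w : ℕ}, w ∈ (Γ₂ ++ (Γ₁ ++ Δ)).map Prod.fst ↔ w ∈ (E ++ Δ).map Prod.fst :=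
      (hp'.map Prod.fst).mem_iff
    simp only [List.mem_cons, not_or] at hy hz
    rw [← hm] at hx hy hz
    simp only [List.map_append, List.mem_append, not_or] at hx hy hz
    have hxy : x ≠ y := Ne.symm hy.1
    have hxz : x ≠ z := Ne.symm hz.1
    have hyz : y ≠ z := Ne.symm hz.2.1
    have M₀ : ∀ v, Typed (E ++ Δ) v D → Typed Δ (LP (LQ v)) (.lolli A (.lolli A' D)) :=
      fun v hv => p₀ _ (q₀ _ (hv.perm hp'))
    refine ⟨fun v => uncurry x y z A A' (LP (LQ v)), fun v hv => ?_, fun v t q h => ?_,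
      fun u hu => ?_, fun v hv => ?_⟩
    · exact typed_uncurry hc hx.2.2 hy.2.2.2 hz.2.2.2.2 hxy (M₀ v hv)
    · exact (p₁ _ _ _ (q₁ _ _ _ (h.perm hp'))).uncurry hc hx.2.2 hy.2.2.2 hz.2.2.2.2 hxy
    · refine TEq.trans (TEq.uncurry hc hx.2.2 hy.2.2.2 hz.2.2.2.2 hxy ?_)
        (.uncurry_abs_abs hc hx.2.2 hy.2.2.2 hz.2.2.2.2 hxy hxz hyz hu)
      have hPt := hP.typed
      have hQt := hQ.typed
      have cy : IsCtx ((y, A') :: (Γ₁ ++ Δ)) := hc₁.cons (by simp; grind)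
      have cxy := isCtx_cons_cons (A := A) (A' := A') hc hx.2.2 hy.2.2.2 hxy
      have hPy : Typed ((y, A') :: Γ₁) (.pair P (.fvar y)) (.tensor A A') :=
        hPt.pair (.fvar y A') (List.perm_append_comm (l₁ := [_]))
          (IsCtx.append_left (Γ := (y, A') :: Γ₁) (Δ := Δ) cy)
      have hPy' : Typed ((y, A') :: (Γ₁ ++ Δ)) (.app u (.pair P (.fvar y))) D :=
        hu.app hPy (List.perm_append_comm (l₁ := (y, A') :: Γ₁)) cy
      have hxy' : Typed ((y, A') :: (x, A) :: Δ) (.app u (.pair (.fvar x) (.fvar y))) D :=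
        hu.app ((Typed.fvar x A).pair (.fvar y A') (.swap _ _ _)
          (IsCtx.append_left (Γ := [_, _]) (Δ := Δ) cxy))
          (List.perm_append_comm (l₁ := [_, _])) cxy
      -- Written as `(λ y. u (P ⊗ y)) Q`, the term `u (P ⊗ Q)` has the form to which the inverse law
      -- of `LQ` applies. The result is `(λ x. λ y. u (x ⊗ y)) P`, so the law for `LP` leaves the
      -- curried form of `u`.
      have e₁ := TEq.beta (Ax := Ax) hPy' hQt (E := Γ₂ ++ (Γ₁ ++ Δ)) List.perm_append_comm hc₂
      rw [Tm.subst₁_app, Tm.subst₁_pair, Tm.subst₁_fvar, Tm.subst₁_of_not_free,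
        Tm.subst₁_of_not_free] at e₁
      rotate_left
      · exact hPt.not_free hy.2.2.1
      · exact hu.not_free hy.2.2.2
      have e₂ := TEq.beta (Ax := Ax) hxy'.abs hPt (E := Γ₁ ++ Δ) List.perm_append_comm hc₁
      rw [Tm.subst₁_abs hxy.symm (hPt.not_free hy.2.2.1), Tm.subst₁_app, Tm.subst₁_pair,
        Tm.subst₁_fvar, Tm.subst₁_fvar_of_ne hxy.symm,
        Tm.subst₁_of_not_free (hu.not_free hx.2.2)] at e₂
      have e₃ : TEq Ax (Γ₁ ++ Δ) (LQ (.app u (.pair P Q))) (.abs y A' (.app u (.pair P (.fvar y)))) _ :=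
        TEq.trans ⟨q₁ _ _ _ e₁.2, q₁ _ _ _ e₁.1⟩ (q₂ _ hPy'.abs)
      have e₄ := e₃.trans e₂.symm
      exact TEq.trans ⟨p₁ _ _ _ e₄.1, p₁ _ _ _ e₄.2⟩ (p₂ _ hxy'.abs.abs)
    · have e₁ := TEq.uncurry_app (Ax := Ax) hc hx.2.2 hy.2.2.2 hz.2.2.2.2 hxy hxz hyz (M₀ v hv)
        hP.typed hQ.typed (E := E ++ Δ) (hp'.symm.trans (perm_of_count fun a => by
          simp only [List.count_append]; omega)) hΓ (by simp; grind) (by simp; grind)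
      have e₂ := (p₃ _ (q₀ _ (hv.perm hp'))).app (TEq.refl hQ.typed) (E := E ++ Δ)
        (hp'.symm.trans List.perm_append_comm) hΓ
      exact (e₁.trans e₂).trans ((q₃ _ (hv.perm hp')).perm hp'.symm)

/-- Functional completeness: a term over the variables of a pattern is obtained by applying a closed
function to the pattern. -/
theorem Pattern.exists_closed {P : Tm S} (hP : Pattern Γ P A) (Ax : Set (VEq S B))
    (hv : Typed Γ v D) : ∃ F, Typed [] F (.lolli A D) ∧ TEq Ax Γ (.app F P) v D := by
  have hΓ : IsCtx (Γ ++ []) := by simpa using hv.isCtx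
  have hv' : Typed (Γ ++ []) v D := by simpa using hv
  obtain ⟨L, h₀, -, -, h₃⟩ := hP.exists_abstraction Ax hΓ D
  exact ⟨L v, h₀ v hv', by simpa using h₃ v hv'⟩

/-- Closed functions are as close as their values at a pattern. -/
theorem Pattern.thm_of_app {P : Tm S} (hP : Pattern Γ P A) (hv : Typed [] v (.lolli A D))
    (ht : Typed [] t (.lolli A D)) (h : Thm Ax Γ (.app v P) (.app t P) D q) :
    Thm Ax [] v t (.lolli A D) q := by
  have hΓ : IsCtx (Γ ++ []) := by simpa using hP.typed.isCtx
  obtain ⟨L, -, h₁, h₂, -⟩ := hP.exists_abstraction Ax hΓ D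
  exact (h₂ v hv).thm (h₂ t ht) (h₁ _ _ _ (by simpa using h))

end Calculus

end VLambda

namespace VLambda

set_option linter.unusedSectionVars false

/-! ### From suprema of provable labels to theorems. -/

section Distance

variable {S : Signature.{u₁, u₂}} {V : Type u₃} [CompleteLattice V] [CommMonoid V] [IsQuantale V]
  {B : Set V} {Ax : Set (VEq S B)} {Γ : Ctx S.Ground} {v t : Tm S} {A : Ty S.Ground} {q : V}

/-- Each basis element `r ≪ q` lies below a join of finitely many provable labels, so (join) and
(weak) prove `r`, and (arch) passes to `q`. Completeness rests on this combination of rules. -/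
theorem Thm.of_le_sSup (hv : Typed Γ v A) (ht : Typed Γ t A) (hq : q ∈ B)
    (h : q ≤ sSup {r | Thm Ax Γ v t A r}) : Thm Ax Γ v t A q := by
  refine .arch hv ht hq fun r hr hrq => ?_
  obtain ⟨X, hX, hXs, hrX⟩ := hrq _ h
  obtain ⟨n, f, -, rfl⟩ := hX.fin_param
  exact (Thm.join hv ht fun i => hXs ⟨i, rfl⟩).weak hrX hr

theorem TEq.of_le_sSup [hint : Fact ((1 : V) = ⊤)] (hB : (1 : V) ∈ B) (hv : Typed Γ v A)
    (ht : Typed Γ t A) (h : 1 ≤ sSup {r | Thm Ax Γ v t A r})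
    (h' : 1 ≤ sSup {r | Thm Ax Γ t v A r}) : TEq Ax Γ v t A := by
  rw [hint.out] at h h' hB
  exact ⟨.of_le_sSup hv ht hB h, .of_le_sSup ht hv hB h'⟩

end Distance

section TermModel

variable {S : Signature.{u₁, u₂}} {V : Type u₃} [CompleteLattice V] [CommMonoid V] [IsQuantale V]
  {B : Set V} (T : VTheory S B) [hint : Fact ((1 : V) = ⊤)]
  {A A' D D' : Ty S.Ground} {Γ Δ Θ E : Ctx S.Ground} {v v' t t' u : Tm S}

/-! #### Elements: terms-in-context up to provable equality, with an undefined one -/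

/-- Provable equality of terms-in-context, up to the order of the variables. -/
def elSetoid (A : Ty S.Ground) : Setoid {p : Ctx S.Ground × Tm S // Typed p.1 p.2 A} where
  r p q := p.1.1.Perm q.1.1 ∧ TEq T.Ax p.1.1 p.1.2 q.1.2 A
  iseqv :=
    { refl := fun p => ⟨.refl _, .refl p.2⟩
      symm := fun h => ⟨h.1.symm, h.2.symm.perm h.1.symm⟩
      trans := fun h h' => ⟨h.1.trans h'.1, h.2.trans (h'.2.perm h.1)⟩ }

/-- Terms-in-context of type `A` up to provable equality, and an undefined element. -/
def El (A : Ty S.Ground) : Type (max u₁ u₂) := Option (Quotient (elSetoid T A))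

variable {T}

namespace El

/-- The undefined element. -/
def undef : El T A := none

/-- The element given by a term-in-context. -/
def mk (h : Typed Γ v A) : El T A := some (Quotient.mk (elSetoid T A) ⟨(Γ, v), h⟩)

theorem mk_eq (h : TEq T.Ax Γ v t A) (hp : Γ.Perm Δ) (hv : Typed Γ v A) (ht : Typed Δ t A) :
    (mk hv : El T A) = mk ht :=
  congrArg some (Quotient.sound (s := elSetoid T A) ⟨hp, h⟩)

theorem teq_of_mk_eq {hv : Typed Γ v A} {ht : Typed Δ t A} (h : (mk hv : El T A) = mk ht) :
    Γ.Perm Δ ∧ TEq T.Ax Γ v t A :=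
  Quotient.exact (s := elSetoid T A) (Option.some.inj h)

theorem eq_undef_or (a : El T A) : a = undef ∨ ∃ Γ v, ∃ h : Typed Γ v A, a = mk h := by
  rcases a with _ | a
  · exact .inl rfl
  · induction a using Quotient.inductionOn with | h p => exact .inr ⟨_, _, p.2, rfl⟩

/-- A unary operation on elements. -/
def map (c : Tm S → Tm S) (h : ∀ Γ v, Typed Γ v A → Typed Γ (c v) D)
    (h' : ∀ Γ v t, Typed Γ v A → TEq T.Ax Γ v t A → TEq T.Ax Γ (c v) (c t) D) (a : El T A) :
    El T D :=
  Option.map (Quotient.map' (s₁ := elSetoid T A) (s₂ := elSetoid T D)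
    (fun p => ⟨(p.1.1, c p.1.2), h _ _ p.2⟩) fun p _ e => ⟨e.1, h' _ _ _ p.2 e.2⟩) a

open scoped Classical in
/-- A binary operation on elements, defined for elements with disjoint sets of variables. -/
noncomputable def map₂ (c : Tm S → Tm S → Tm S)
    (h : ∀ Γ Δ v t, Typed Γ v A → Typed Δ t A' → IsCtx (Γ ++ Δ) → Typed (Γ ++ Δ) (c v t) D)
    (h' : ∀ Γ Δ v v' t t', TEq T.Ax Γ v v' A → TEq T.Ax Δ t t' A' → IsCtx (Γ ++ Δ) →
      TEq T.Ax (Γ ++ Δ) (c v t) (c v' t') D) (a : El T A) (b : El T A') : El T D :=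
  Option.bind a fun a => Option.bind b fun b =>
    Quotient.liftOn₂' (s₁ := elSetoid T A) (s₂ := elSetoid T A') (γ := El T D) a b
      (fun p q => if hc : IsCtx (p.1.1 ++ q.1.1) then mk (h _ _ _ _ p.2 q.2 hc) else undef)
      fun p q p' q' e e' => by
        have hp := e.1.append e'.1
        by_cases hc : IsCtx (p.1.1 ++ q.1.1)
        · rw [dif_pos hc, dif_pos (hc.perm hp.symm)]
          exact mk_eq (h' _ _ _ _ _ _ e.2 e'.2 hc) hp _ _
        · rw [dif_neg hc, dif_neg fun hc' => hc (hc'.perm hp)]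

section map₂

variable {c : Tm S → Tm S → Tm S}
  {h : ∀ Γ Δ v t, Typed Γ v A → Typed Δ t A' → IsCtx (Γ ++ Δ) → Typed (Γ ++ Δ) (c v t) D}
  {h' : ∀ Γ Δ v v' t t', TEq T.Ax Γ v v' A → TEq T.Ax Δ t t' A' → IsCtx (Γ ++ Δ) →
    TEq T.Ax (Γ ++ Δ) (c v t) (c v' t') D}

theorem map₂_undef_left (b : El T A') : map₂ c h h' undef b = undef := rfl

theorem map₂_undef_right (a : El T A) : map₂ c h h' a undef = undef := by
  rcases a.eq_undef_or with rfl | ⟨_, _, _, rfl⟩ <;> rfl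

theorem map₂_mk (hv : Typed Γ v A) (ht : Typed Δ t A') (hc : IsCtx (Γ ++ Δ)) :
    map₂ c h h' (mk hv) (mk ht) = mk (h _ _ _ _ hv ht hc) :=
  dif_pos hc

theorem map₂_mk_of_not (hv : Typed Γ v A) (ht : Typed Δ t A') (hc : ¬ IsCtx (Γ ++ Δ)) :
    map₂ c h h' (mk hv) (mk ht) = undef :=
  dif_neg hc

end map₂

/-- The pair of two elements. -/
noncomputable def pair (a : El T A) (b : El T A') : El T (.tensor A A') :=
  map₂ .pair (fun _ _ _ _ h h' hc => h.pair h' (.refl _) hc)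
    (fun _ _ _ _ _ _ h h' hc => h.pair h' (.refl _) hc) a b

/-- The application of an element to another one. -/
noncomputable def app (a : El T (.lolli A D)) (b : El T A) : El T D :=
  map₂ .app (fun _ _ _ _ h h' hc => h.app h' (.refl _) hc)
    (fun _ _ _ _ _ _ h h' hc => h.app h' (.refl _) hc) a b

/-- The element of the unit type. -/
def star : El T (.unit : Ty S.Ground) := mk .star

theorem pair_mk (hv : Typed Γ v A) (ht : Typed Δ t A') (hc : IsCtx (Γ ++ Δ)) :
    pair (mk hv : El T A) (mk ht) = mk (hv.pair ht (.refl _) hc) := map₂_mk hv ht hc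

theorem app_mk (hv : Typed Γ v (.lolli A D)) (ht : Typed Δ t A) (hc : IsCtx (Γ ++ Δ)) :
    app (mk hv : El T _) (mk ht) = mk (hv.app ht (.refl _) hc) := map₂_mk hv ht hc

@[simp] theorem undef_pair (b : El T A') : pair (undef : El T A) b = undef := map₂_undef_left b

@[simp] theorem pair_undef (a : El T A) : pair a (undef : El T A') = undef := map₂_undef_right a

@[simp] theorem undef_app (b : El T A) : app (undef : El T (.lolli A D)) b = undef :=
  map₂_undef_left b

@[simp] theorem app_undef (a : El T (.lolli A D)) : app a undef = undef := map₂_undef_right a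

/-- Equations between operations on elements need a proof only for actual terms with disjoint
variables; in the remaining case both sides have to be shown undefined. -/
theorem pair_cases (a : El T A) (b : El T A') : pair a b = undef ∨
    ∃ Γ v Δ t, ∃ (h : Typed Γ v A) (h' : Typed Δ t A'), a = mk h ∧ b = mk h' ∧ IsCtx (Γ ++ Δ) := by
  rcases a.eq_undef_or with rfl | ⟨Γ, v, h, rfl⟩
  · simp
  rcases b.eq_undef_or with rfl | ⟨Δ, t, h', rfl⟩
  · simp
  by_cases hc : IsCtx (Γ ++ Δ)
  · exact .inr ⟨_, _, _, _, h, h', rfl, rfl, hc⟩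
  · exact .inl (map₂_mk_of_not h h' hc)

/-- Pairing and application both require disjoint variables, hence fail together. -/
theorem app_eq_undef {a : El T (.lolli A D)} {b : El T A} (h : pair a b = undef) :
    app a b = undef := by
  rcases a.eq_undef_or with rfl | ⟨Γ, v, hv, rfl⟩
  · simp
  rcases b.eq_undef_or with rfl | ⟨Δ, t, ht, rfl⟩
  · simp
  refine map₂_mk_of_not _ _ fun hc => ?_
  rw [pair_mk _ _ hc] at h
  cases h

/-- Both bracketings require the three contexts to be jointly disjoint. -/
theorem pair_pair_cases (a : El T A) (b : El T A') (c : El T D) :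
    (pair (pair a b) c = undef ∧ pair a (pair b c) = undef) ∨
    ∃ Γ v Δ t Θ u, ∃ (h : Typed Γ v A) (h' : Typed Δ t A') (h'' : Typed Θ u D),
      a = mk h ∧ b = mk h' ∧ c = mk h'' ∧ IsCtx (Γ ++ (Δ ++ Θ)) := by
  rcases a.eq_undef_or with rfl | ⟨Γ, v, h, rfl⟩
  · simp
  rcases b.eq_undef_or with rfl | ⟨Δ, t, h', rfl⟩
  · simp
  rcases c.eq_undef_or with rfl | ⟨Θ, u, h'', rfl⟩
  · simp
  by_cases hc : IsCtx (Γ ++ (Δ ++ Θ))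
  · exact .inr ⟨_, _, _, _, _, _, h, h', h'', rfl, rfl, rfl, hc⟩
  · refine .inl ⟨?_, ?_⟩
    · by_cases hc' : IsCtx (Γ ++ Δ)
      · rw [pair_mk _ _ hc']
        exact map₂_mk_of_not _ _ (by rwa [List.append_assoc])
      · rw [pair, pair, map₂_mk_of_not _ _ hc', map₂_undef_left]
    · by_cases hc' : IsCtx (Δ ++ Θ)
      · rw [pair_mk _ _ hc']
        exact map₂_mk_of_not _ _ hc
      · rw [pair, pair, map₂_mk_of_not _ _ hc', map₂_undef_right]

end El

/-! #### Morphisms: closed functions up to provable equality -/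

variable (T) in
/-- Provable equality of closed functions. -/
def funSetoid (A D : Ty S.Ground) : Setoid {v : Tm S // Typed [] v (.lolli A D)} where
  r v t := TEq T.Ax [] v.1 t.1 (.lolli A D)
  iseqv :=
    { refl := fun v => .refl v.2
      symm := fun h => h.symm
      trans := fun h h' => h.trans h' }

variable (T) in
/-- Hypotheses on the theory `T` under which its term model is constructed. -/
class IsRegular : Prop where
  one_mem : (1 : V) ∈ B
  varietal : VTheory.IsVarietal.{u₁, u₂, u₃, w} T

variable [hreg : IsRegular.{u₁, u₂, u₃, w} T]

variable (T) in
include hreg in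
-- Application to the variable `0` embeds closed functions into the quotient that is small by
-- varietality. It is injective because a function is determined by its value at a variable.
theorem small_quotient_funSetoid (A D : Ty S.Ground) : Small.{w} (Quotient (funSetoid T A D)) := by
  have := hreg.varietal A D
  have htyped : ∀ {v}, Typed [] v (.lolli A D) → Typed [(0, A)] (.app v (.fvar 0)) D :=
    fun h => h.app (.fvar 0 A) (.refl _) (by simp [IsCtx])
  refine small_of_injective (β := Quotient (T.valVCat A D).setoid)
    (f := Quotient.map' (fun v => ⟨.app v.1 (.fvar 0), htyped v.2⟩) ?_) ?_
  · intro v t h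
    have h : TEq T.Ax [(0, A)] (.app v.1 (.fvar 0)) (.app t.1 (.fvar 0)) D :=
      TEq.app h (.refl (.fvar 0 A)) (.refl _) (by simp [IsCtx])
    exact ⟨le_top.trans (le_sSup h.1), le_top.trans (le_sSup h.2)⟩
  · intro f g
    induction f, g using Quotient.inductionOn₂' with
    | h v t =>
      intro h
      have h := Quotient.exact h
      have h := TEq.of_le_sSup hreg.one_mem (htyped v.2) (htyped t.2) h.1 h.2
      exact Quotient.sound (s := funSetoid T A D)
        ⟨(Pattern.var 0 A).thm_of_app v.2 t.2 h.1, (Pattern.var 0 A).thm_of_app t.2 v.2 h.2⟩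

variable (T) in
/-- Closed functions up to provable equality. -/
def Fun (A D : Ty S.Ground) : Type w :=
  haveI := small_quotient_funSetoid.{u₁, u₂, u₃, w} T A D
  Shrink.{w} (Quotient (funSetoid T A D))

namespace Fun

/-- The class of a closed function. -/
noncomputable def mk (h : Typed [] v (.lolli A D)) : Fun.{u₁, u₂, u₃, w} T A D :=
  haveI := small_quotient_funSetoid.{u₁, u₂, u₃, w} T A D
  equivShrink _ (Quotient.mk (funSetoid T A D) ⟨v, h⟩)

/-- A representative. -/
noncomputable def rep (f : Fun.{u₁, u₂, u₃, w} T A D) : {v : Tm S // Typed [] v (.lolli A D)} :=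
  haveI := small_quotient_funSetoid.{u₁, u₂, u₃, w} T A D
  ((equivShrink _).symm f).out

/-- A representative. -/
noncomputable def tm (f : Fun.{u₁, u₂, u₃, w} T A D) : Tm S := f.rep.1

theorem typed (f : Fun.{u₁, u₂, u₃, w} T A D) : Typed [] f.tm (.lolli A D) := f.rep.2

theorem tm_mk (h : Typed [] v (.lolli A D)) :
    TEq T.Ax [] (mk h : Fun.{u₁, u₂, u₃, w} T A D).tm v (.lolli A D) := by
  have := small_quotient_funSetoid.{u₁, u₂, u₃, w} T A D
  refine Quotient.exact (s := funSetoid T A D) (a := (mk h : Fun.{u₁, u₂, u₃, w} T A D).rep)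
    (b := ⟨v, h⟩) ?_
  unfold mk rep
  rw [Equiv.symm_apply_apply, Quotient.out_eq]

theorem ext_tm {f g : Fun.{u₁, u₂, u₃, w} T A D} (h : TEq T.Ax [] f.tm g.tm (.lolli A D)) :
    f = g := by
  have := small_quotient_funSetoid.{u₁, u₂, u₃, w} T A D
  have := Quotient.sound (s := funSetoid T A D) (a := f.rep) (b := g.rep) h
  unfold rep at this
  rw [Quotient.out_eq, Quotient.out_eq] at this
  exact (equivShrink _).symm.injective this

/-- The action of a function on elements. -/
noncomputable def ap (f : Fun.{u₁, u₂, u₃, w} T A D) : El T A → El T D :=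
  El.map (.app f.tm) (fun _ _ h => f.typed.app h (.refl _) h.isCtx)
    (fun _ _ _ h => fun h' => TEq.app (.refl f.typed) h' (.refl _) h.isCtx)

theorem ap_mk (f : Fun.{u₁, u₂, u₃, w} T A D) (h : Typed Γ v A) :
    f.ap (.mk h) = .mk (f.typed.app h (.refl _) h.isCtx) := rfl

@[simp] theorem ap_undef (f : Fun.{u₁, u₂, u₃, w} T A D) : f.ap .undef = .undef := rfl

/-- Abstraction over the pattern recovers a function from its value there. -/
theorem ext_pattern {P : Tm S} (hP : Pattern Γ P A) {f g : Fun.{u₁, u₂, u₃, w} T A D}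
    (h : f.ap (.mk hP.typed) = g.ap (.mk hP.typed)) : f = g := by
  have h := (El.teq_of_mk_eq h).2
  exact ext_tm ⟨hP.thm_of_app f.typed g.typed h.1, hP.thm_of_app g.typed f.typed h.2⟩

theorem exists_of_pattern {P : Tm S} (hP : Pattern Γ P A) (hv : Typed Γ v D) :
    ∃ f : Fun.{u₁, u₂, u₃, w} T A D, TEq T.Ax Γ (.app f.tm P) v D := by
  obtain ⟨F, hF, h⟩ := hP.exists_closed T.Ax hv
  exact ⟨mk hF, .trans (.app (tm_mk hF) (.refl hP.typed) (.refl _) hP.typed.isCtx) h⟩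

theorem subst_tm (f : Fun.{u₁, u₂, u₃, w} T A D) (σ : ℕ → Tm S) : f.tm.subst σ = f.tm :=
  Tm.subst_of_closed (fun x hx => by simpa using (f.typed.free_iff x).1 hx) σ

/-- The representative of `f` is closed, so an equation at a generic argument carries over to all
substitution instances. Morphisms specified at a pattern are computed in this way. -/
theorem subst_app_tm {f : Fun.{u₁, u₂, u₃, w} T A D} (ht : Typed Γ t A) (hv : Typed Γ v D)
    (h : TEq T.Ax Γ (.app f.tm t) v D) {σ : ℕ → Tm S} {θ : ℕ × Ty S.Ground → Ctx S.Ground}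
    (hσ : ∀ p ∈ Γ, Typed (θ p) (σ p.1) p.2) (hp : E.Perm (Γ.flatMap θ)) (hE : IsCtx E) :
    TEq T.Ax E (.app f.tm (t.subst σ)) (v.subst σ) D := by
  have := h.subst_all (f.typed.app ht (.refl _) hv.isCtx) hv hσ hp hE
  rwa [Tm.subst, subst_tm] at this

/-- Functions out of a type given by an expression in one variable. -/
theorem exists_of_pattern₁ {P : Tm S} (hP : Pattern [(0, A)] P A') (hv : Typed [(0, A)] v D) :
    ∃ f : Fun.{u₁, u₂, u₃, w} T A' D, ∀ {Γ t}, Typed Γ t A →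
      TEq T.Ax Γ (.app f.tm (P.subst fun _ => t)) (v.subst fun _ => t) D := by
  obtain ⟨f, hf⟩ := exists_of_pattern (T := T) hP hv
  exact ⟨f, fun {Γ t} ht => f.subst_app_tm hP.typed hv hf (θ := fun _ => Γ) (by simpa using ht)
    (by simp) ht.isCtx⟩

/-- Functions out of a type given by an expression in two variables. -/
theorem exists_of_pattern₂ {P : Tm S} (hP : Pattern [(0, A), (1, A')] P D)
    (hv : Typed [(0, A), (1, A')] v D') :
    ∃ f : Fun.{u₁, u₂, u₃, w} T D D', ∀ {Γ Δ t u}, Typed Γ t A → Typed Δ u A' →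
      IsCtx (Γ ++ Δ) → TEq T.Ax (Γ ++ Δ) (.app f.tm (P.subst fun | 0 => t | _ => u))
        (v.subst fun | 0 => t | _ => u) D' := by
  obtain ⟨f, hf⟩ := exists_of_pattern (T := T) hP hv
  exact ⟨f, fun {Γ Δ t u} ht hu hc => f.subst_app_tm hP.typed hv hf
    (θ := fun | (0, _) => Γ | _ => Δ) (by simpa using ⟨ht, hu⟩) (by simp) hc⟩

/-- Functions out of a type given by an expression in three variables. -/
theorem exists_of_pattern₃ {A'' : Ty S.Ground} {P : Tm S}
    (hP : Pattern [(0, A), (1, A'), (2, A'')] P D)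
    (hv : Typed [(0, A), (1, A'), (2, A'')] v D') :
    ∃ f : Fun.{u₁, u₂, u₃, w} T D D', ∀ {Γ Δ Θ t u s}, Typed Γ t A → Typed Δ u A' →
      Typed Θ s A'' → IsCtx (Γ ++ (Δ ++ Θ)) →
      TEq T.Ax (Γ ++ (Δ ++ Θ)) (.app f.tm (P.subst fun | 0 => t | 1 => u | _ => s))
        (v.subst fun | 0 => t | 1 => u | _ => s) D' := by
  obtain ⟨f, hf⟩ := exists_of_pattern (T := T) hP hv
  exact ⟨f, fun {Γ Δ Θ t u s} ht hu hs hc => f.subst_app_tm hP.typed hv hf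
    (θ := fun | (0, _) => Γ | (1, _) => Δ | _ => Θ) (by simpa using ⟨ht, hu, hs⟩) (by simp) hc⟩

end Fun

end TermModel

end VLambda

namespace VLambda

set_option linter.unusedSectionVars false

/-! ### Extensionality and the combinators of an autonomous category. -/

section Combinators

variable {S : Signature.{u₁, u₂}} {V : Type u₃} [CompleteLattice V] [CommMonoid V] [IsQuantale V]
  {B : Set V} {T : VTheory S B} [hint : Fact ((1 : V) = ⊤)]
  {A A' A'' D D' : Ty S.Ground} {Γ Δ Θ E : Ctx S.Ground} {v v' t t' u : Tm S}

/-- Sets of elements which suffice to tell functions apart. -/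
inductive Generating : ∀ {A : Ty S.Ground}, Set (El T A) → Prop
  | univ (A : Ty S.Ground) : Generating (Set.univ : Set (El T A))
  | star : Generating {(El.star : El T .unit)}
  | pair {A A' : Ty S.Ground} {s : Set (El T A)} {t : Set (El T A')} :
      Generating s → Generating t → Generating (Set.image2 El.pair s t)

/-- Confining the names to an interval `[n, m)` allows the pattern of a second factor to start at
`m`, which makes the two disjoint. -/
theorem Generating.exists_pattern {s : Set (El T A)} (hs : Generating s) (n : ℕ) :
    ∃ Γ P m, ∃ hP : Pattern Γ P A, (∀ x ∈ Γ.map Prod.fst, n ≤ x ∧ x < m) ∧ n ≤ m ∧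
      El.mk hP.typed ∈ s := by
  induction hs generalizing n with
  | univ A => exact ⟨_, _, n + 1, .var n A, by simp, by simp, trivial⟩
  | star => exact ⟨_, _, n, .star, by simp, le_rfl, rfl⟩
  | pair _ _ ih ih' =>
    obtain ⟨Γ, P, m, hP, h, hm, hmem⟩ := ih n
    obtain ⟨Δ, Q, k, hQ, h', hk, hmem'⟩ := ih' m
    have hc : IsCtx (Γ ++ Δ) := by
      rw [IsCtx, List.map_append, List.nodup_append]
      refine ⟨hP.typed.isCtx, hQ.typed.isCtx, fun x hx y hy e => ?_⟩
      exact absurd ((h x hx).2.trans_le (h' y hy).1) (by omega)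
    refine ⟨_, _, k, hP.pair hQ (.refl _) hc, fun x hx => ?_, hm.trans hk,
      _, hmem, _, hmem', El.pair_mk _ _ hc⟩
    rw [List.map_append, List.mem_append] at hx
    rcases hx with hx | hx
    · exact ⟨(h x hx).1, (h x hx).2.trans_le hk⟩
    · exact ⟨hm.trans (h' x hx).1, (h' x hx).2⟩

variable [hreg : IsRegular.{u₁, u₂, u₃, w} T]

namespace El

theorem pair_comm_eq_undef {a : El T A} {b : El T A'} (h : pair a b = undef) :
    pair b a = undef := by
  rcases pair_cases b a with h' | ⟨Γ, v, Δ, t, hv, ht, rfl, rfl, hc⟩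
  · exact h'
  · rw [pair_mk _ _ (hc.perm List.perm_append_comm)] at h
    cases h

theorem pair_ap_eq_undef {a : El T A} {b : El T A'} {f : Fun.{u₁, u₂, u₃, w} T A D}
    {g : Fun.{u₁, u₂, u₃, w} T A' D'} (h : pair a b = undef) :
    pair (f.ap a) (g.ap b) = undef := by
  rcases a.eq_undef_or with rfl | ⟨Γ, v, hv, rfl⟩
  · exact undef_pair _
  rcases b.eq_undef_or with rfl | ⟨Δ, t, ht, rfl⟩
  · exact pair_undef _
  refine map₂_mk_of_not _ _ fun hc => ?_
  rw [pair_mk _ _ hc] at h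
  cases h

end El

namespace Fun

/-- A generating set contains a pattern, and agreement at that single generic element is enough. -/
theorem ext_of_generating {s : Set (El T A)} (hs : Generating s) {f g : Fun.{u₁, u₂, u₃, w} T A D}
    (h : ∀ a ∈ s, f.ap a = g.ap a) : f = g := by
  obtain ⟨_, _, _, hP, -, -, hmem⟩ := hs.exists_pattern 0
  exact ext_pattern hP (h _ hmem)

theorem ext {f g : Fun.{u₁, u₂, u₃, w} T A D} (h : ∀ a, f.ap a = g.ap a) : f = g :=
  ext_of_generating (.univ A) fun a _ => h a

theorem ext_pair {f g : Fun.{u₁, u₂, u₃, w} T (.tensor A A') D}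
    (h : ∀ a b, f.ap (.pair a b) = g.ap (.pair a b)) : f = g :=
  ext_of_generating (.pair (.univ A) (.univ A')) (by rintro _ ⟨a, -, b, -, rfl⟩; exact h a b)

theorem ext_pair_left {f g : Fun.{u₁, u₂, u₃, w} T (.tensor (.tensor A A') A'') D}
    (h : ∀ a b c, f.ap (.pair (.pair a b) c) = g.ap (.pair (.pair a b) c)) : f = g :=
  ext_of_generating (.pair (.pair (.univ A) (.univ A')) (.univ A'')) (by rintro _ ⟨_, ⟨a, -, b, -, rfl⟩, c, -, rfl⟩; exact h a b c)

theorem ext_pair_right {f g : Fun.{u₁, u₂, u₃, w} T (.tensor A (.tensor A' A'')) D}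
    (h : ∀ a b c, f.ap (.pair a (.pair b c)) = g.ap (.pair a (.pair b c))) : f = g :=
  ext_of_generating (.pair (.univ A) (.pair (.univ A') (.univ A''))) (by rintro _ ⟨a, -, _, ⟨b, -, c, -, rfl⟩, rfl⟩; exact h a b c)

theorem ext_four {f g : Fun.{u₁, u₂, u₃, w} T (.tensor (.tensor (.tensor A A') A'') D) D'}
    (h : ∀ a b c d, f.ap (.pair (.pair (.pair a b) c) d) = g.ap (.pair (.pair (.pair a b) c) d)) :
    f = g :=
  ext_of_generating (.pair (.pair (.pair (.univ A) (.univ A')) (.univ A'')) (.univ D))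
    (by rintro _ ⟨_, ⟨_, ⟨a, -, b, -, rfl⟩, c, -, rfl⟩, d, -, rfl⟩; exact h a b c d)

theorem ext_star_pair {f g : Fun.{u₁, u₂, u₃, w} T (.tensor .unit A) D}
    (h : ∀ a, f.ap (.pair .star a) = g.ap (.pair .star a)) : f = g :=
  ext_of_generating (.pair .star (.univ A)) (by simpa using h)

theorem ext_pair_star {f g : Fun.{u₁, u₂, u₃, w} T (.tensor A .unit) D}
    (h : ∀ a, f.ap (.pair a .star) = g.ap (.pair a .star)) : f = g :=
  ext_of_generating (.pair (.univ A) .star) (by simpa using h)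

theorem ext_triangle {f g : Fun.{u₁, u₂, u₃, w} T (.tensor (.tensor A .unit) A') D}
    (h : ∀ a b, f.ap (.pair (.pair a .star) b) = g.ap (.pair (.pair a .star) b)) : f = g :=
  ext_of_generating (.pair (.pair (.univ A) .star) (.univ A')) (by rintro _ ⟨_, ⟨a, -, _, rfl, rfl⟩, b, -, rfl⟩; exact h a b)

/-- Compare at two distinct variables, abstract over the second and contract by η. -/
theorem ext_app {f g : Fun.{u₁, u₂, u₃, w} T A (.lolli A' D)}
    (h : ∀ a b, El.app (f.ap a) b = El.app (g.ap a) b) : f = g := by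
  have hc : IsCtx ([(0, A)] ++ [(1, A')]) := by simp [IsCtx]
  have hc' : IsCtx ((1, A') :: [(0, A)]) := by simp [IsCtx]
  have hf := f.typed.app (.fvar 0 A) (.refl _) (Typed.fvar 0 A).isCtx
  have hg := g.typed.app (.fvar 0 A) (.refl _) (Typed.fvar 0 A).isCtx
  have h₀ := h (.mk (.fvar 0 A)) (.mk (.fvar 1 A'))
  rw [ap_mk, ap_mk, El.app_mk _ _ hc, El.app_mk _ _ hc] at h₀
  have h₁ := ((El.teq_of_mk_eq h₀).2.perm (.swap _ _ _)).abs
  refine ext_pattern (.var 0 A) (El.mk_eq (.trans ?_ (h₁.trans ?_)) (.refl _) _ _)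
  · exact TEq.symm (.base (.abs_eta hf hc'))
  · exact .base (.abs_eta hg hc')

theorem exists_id (A : Ty S.Ground) : ∃ f : Fun.{u₁, u₂, u₃, w} T A A, ∀ a, f.ap a = a := by
  obtain ⟨f, hf⟩ := exists_of_pattern₁ (T := T) (.var 0 A) (.fvar 0 A)
  refine ⟨f, fun a => ?_⟩
  rcases a.eq_undef_or with rfl | ⟨Γ, v, h, rfl⟩
  · rfl
  · exact El.mk_eq (hf h) (.refl _) _ _

theorem exists_comp (f : Fun.{u₁, u₂, u₃, w} T A A') (g : Fun.{u₁, u₂, u₃, w} T A' D) :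
    ∃ k : Fun.{u₁, u₂, u₃, w} T A D, ∀ a, k.ap a = g.ap (f.ap a) := by
  have hc := (Typed.fvar 0 A).isCtx
  obtain ⟨k, hk⟩ := exists_of_pattern₁ (T := T) (.var 0 A)
    (g.typed.app (f.typed.app (.fvar 0 A) (.refl _) hc) (.refl _) hc)
  refine ⟨k, fun a => ?_⟩
  rcases a.eq_undef_or with rfl | ⟨Γ, v, h, rfl⟩
  · rfl
  · have := hk h
    simp only [Tm.subst, subst_tm] at this
    exact El.mk_eq this (.refl _) _ _

theorem isCtx_two : IsCtx [(0, A), (1, A')] := by simp [IsCtx]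

theorem pattern_two : Pattern [(0, A), (1, A')] (.pair (.fvar 0) (.fvar 1)) (.tensor A A') :=
  .pair (.var 0 A) (.var 1 A') (.refl _) isCtx_two

theorem exists_tensor (f : Fun.{u₁, u₂, u₃, w} T A D) (g : Fun.{u₁, u₂, u₃, w} T A' D') :
    ∃ k : Fun.{u₁, u₂, u₃, w} T (.tensor A A') (.tensor D D'),
      ∀ a b, k.ap (.pair a b) = .pair (f.ap a) (g.ap b) := by
  obtain ⟨k, hk⟩ := exists_of_pattern₂ (T := T) (pattern_two (A := A) (A' := A'))
    ((f.typed.app (.fvar 0 A) (.refl _) (Typed.fvar 0 A).isCtx).pair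
      (g.typed.app (.fvar 1 A') (.refl _) (Typed.fvar 1 A').isCtx) (.refl _) isCtx_two)
  refine ⟨k, fun a b => ?_⟩
  rcases El.pair_cases a b with h | ⟨Γ, v, Δ, t, h, h', rfl, rfl, hc⟩
  · rw [h, ap_undef]
    exact (El.pair_ap_eq_undef h).symm
  · have := hk h h' hc
    simp only [Tm.subst, subst_tm] at this
    rw [El.pair_mk _ _ hc, ap_mk, ap_mk, ap_mk, El.pair_mk _ _ hc]
    exact El.mk_eq this (.refl _) _ _

theorem exists_braid (A A' : Ty S.Ground) :
    ∃ k : Fun.{u₁, u₂, u₃, w} T (.tensor A A') (.tensor A' A),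
      ∀ a b, k.ap (.pair a b) = .pair b a := by
  obtain ⟨k, hk⟩ := exists_of_pattern₂ (T := T) (pattern_two (A := A) (A' := A'))
    ((Typed.fvar 1 A').pair (.fvar 0 A) (.swap _ _ _) isCtx_two)
  refine ⟨k, fun a b => ?_⟩
  rcases El.pair_cases a b with h | ⟨Γ, v, Δ, t, h, h', rfl, rfl, hc⟩
  · rw [h, ap_undef]
    exact (El.pair_comm_eq_undef h).symm
  · have := hk h h' hc
    simp only [Tm.subst] at this
    have hp : (Δ ++ Γ).Perm (Γ ++ Δ) := List.perm_append_comm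
    rw [El.pair_mk _ _ hc, ap_mk, El.pair_mk _ _ (hc.perm hp)]
    exact El.mk_eq this hp.symm _ _

theorem exists_ev (A D : Ty S.Ground) :
    ∃ k : Fun.{u₁, u₂, u₃, w} T (.tensor (.lolli A D) A) D,
      ∀ a b, k.ap (.pair a b) = .app a b := by
  obtain ⟨k, hk⟩ := exists_of_pattern₂ (T := T) (pattern_two (A := .lolli A D) (A' := A))
    ((Typed.fvar 0 (.lolli A D)).app (.fvar 1 A) (.refl _) isCtx_two)
  refine ⟨k, fun a b => ?_⟩
  rcases El.pair_cases a b with h | ⟨Γ, v, Δ, t, h, h', rfl, rfl, hc⟩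
  · rw [h, El.app_eq_undef h, ap_undef]
  · have := hk h h' hc
    simp only [Tm.subst] at this
    rw [El.pair_mk _ _ hc, ap_mk, El.app_mk _ _ hc]
    exact El.mk_eq this (.refl _) _ _

/-- The value at the variable `0` is prescribed as `λ x₁. f (x₁ ⊗ x₀)`. The argument comes first in
the pair because the internal hom is right adjoint to tensoring on the left. -/
theorem exists_curry (f : Fun.{u₁, u₂, u₃, w} T (.tensor A A') D) :
    ∃ k : Fun.{u₁, u₂, u₃, w} T A' (.lolli A D),
      ∀ b a, .app (k.ap b) a = f.ap (.pair a b) := by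
  have hb : Typed [(1, A), (0, A')] (.app f.tm (.pair (.fvar 1) (.fvar 0))) D :=
    f.typed.app ((Typed.fvar 1 A).pair (.fvar 0 A') (.refl _) (by simp [IsCtx]))
      (.refl _) (by simp [IsCtx])
  obtain ⟨k, hk⟩ := exists_of_pattern (T := T) (.var 0 A') hb.abs
  have h₁ := hk.app (.refl (.fvar 1 A)) (.refl _) isCtx_two
  have h₂ := TEq.beta (Ax := T.Ax) hb (.fvar 1 A) (.refl _) isCtx_two
  rw [Tm.subst₁_self] at h₂
  have h₃ := h₁.trans h₂
  refine ⟨k, fun b a => ?_⟩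
  rcases El.pair_cases b a with h | ⟨Γ, v, Δ, t, h, h', rfl, rfl, hc⟩
  · rw [El.pair_comm_eq_undef h, ap_undef]
    rcases b.eq_undef_or with rfl | ⟨Γ, v, hv, rfl⟩
    · exact El.undef_app _
    · rw [ap_mk]
      refine El.app_eq_undef ?_
      -- Only `b` is moved by `k`; the identity serves as the second function.
      have := El.pair_ap_eq_undef (f := k) (g := (exists_id (T := T) A).choose) h
      rwa [(exists_id (T := T) A).choose_spec] at this
  · have := h₃.subst_all (E := Γ ++ Δ) ((k.typed.app (.fvar 0 A') (.refl _) (Typed.fvar 0 A').isCtx).app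
      (.fvar 1 A) (.refl _) isCtx_two) (hb.perm (.swap _ _ _)) (σ := fun | 0 => v | _ => t)
      (θ := fun | (0, _) => Γ | _ => Δ) (by simpa using ⟨h, h'⟩) (by simp) hc
    simp only [Tm.subst, subst_tm] at this
    have hp : (Δ ++ Γ).Perm (Γ ++ Δ) := List.perm_append_comm
    rw [El.pair_mk _ _ (hc.perm hp), ap_mk, ap_mk, El.app_mk _ _ hc]
    exact El.mk_eq this hp.symm _ _

theorem exists_leftUnitor (A : Ty S.Ground) :
    ∃ k : Fun.{u₁, u₂, u₃, w} T (.tensor .unit A) A, ∀ a, k.ap (.pair .star a) = a := by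
  obtain ⟨k, hk⟩ := exists_of_pattern₁ (T := T)
    (.pair .star (.var 0 A) (.refl _) (Typed.fvar 0 A).isCtx) (.fvar 0 A)
  refine ⟨k, fun a => ?_⟩
  rcases a.eq_undef_or with rfl | ⟨Γ, v, h, rfl⟩
  · simp
  · rw [El.star, El.pair_mk _ _ (by exact h.isCtx), ap_mk]
    exact El.mk_eq (hk h) (.refl _) _ _

theorem exists_leftUnitor_inv (A : Ty S.Ground) :
    ∃ k : Fun.{u₁, u₂, u₃, w} T A (.tensor .unit A), ∀ a, k.ap a = .pair .star a := by
  obtain ⟨k, hk⟩ := exists_of_pattern₁ (T := T) (.var 0 A)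
    (Typed.star.pair (.fvar 0 A) (.refl _) (Typed.fvar 0 A).isCtx)
  refine ⟨k, fun a => ?_⟩
  rcases a.eq_undef_or with rfl | ⟨Γ, v, h, rfl⟩
  · simp
  · rw [El.star, El.pair_mk _ _ (by exact h.isCtx), ap_mk]
    exact El.mk_eq (hk h) (.refl _) _ _

theorem exists_rightUnitor (A : Ty S.Ground) :
    ∃ k : Fun.{u₁, u₂, u₃, w} T (.tensor A .unit) A, ∀ a, k.ap (.pair a .star) = a := by
  obtain ⟨f, hf⟩ := exists_braid (T := T) A .unit
  obtain ⟨g, hg⟩ := exists_leftUnitor (T := T) A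
  obtain ⟨k, hk⟩ := exists_comp f g
  exact ⟨k, fun a => by rw [hk, hf, hg]⟩

theorem exists_rightUnitor_inv (A : Ty S.Ground) :
    ∃ k : Fun.{u₁, u₂, u₃, w} T A (.tensor A .unit), ∀ a, k.ap a = .pair a .star := by
  obtain ⟨f, hf⟩ := exists_leftUnitor_inv (T := T) A
  obtain ⟨g, hg⟩ := exists_braid (T := T) .unit A
  obtain ⟨k, hk⟩ := exists_comp f g
  exact ⟨k, fun a => by rw [hk, hf, hg]⟩

theorem isCtx_three : IsCtx [(0, A), (1, A'), (2, A'')] := by simp [IsCtx]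

theorem pattern_three_left : Pattern [(0, A), (1, A'), (2, A'')]
    (.pair (.pair (.fvar 0) (.fvar 1)) (.fvar 2)) (.tensor (.tensor A A') A'') :=
  .pair (.pair (.var 0 A) (.var 1 A') (.refl _) isCtx_two) (.var 2 A'') (.refl _) isCtx_three

theorem pattern_three_right : Pattern [(0, A), (1, A'), (2, A'')]
    (.pair (.fvar 0) (.pair (.fvar 1) (.fvar 2))) (.tensor A (.tensor A' A'')) :=
  .pair (.var 0 A) (.pair (.var 1 A') (.var 2 A'') (.refl _) (by simp [IsCtx])) (.refl _) isCtx_three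

theorem exists_assoc (A A' A'' : Ty S.Ground) :
    ∃ k : Fun.{u₁, u₂, u₃, w} T (.tensor (.tensor A A') A'') (.tensor A (.tensor A' A'')),
      ∀ a b c, k.ap (.pair (.pair a b) c) = .pair a (.pair b c) := by
  obtain ⟨k, hk⟩ := exists_of_pattern₃ (T := T) (pattern_three_left (A := A) (A' := A') (A'' := A''))
    pattern_three_right.typed
  refine ⟨k, fun a b c => ?_⟩
  rcases El.pair_pair_cases a b c with ⟨h, h'⟩ | ⟨Γ, v, Δ, t, Θ, u, h, h', h'', rfl, rfl, rfl, hc⟩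
  · rw [h, h', ap_undef]
  · have hc' : IsCtx ((Γ ++ Δ) ++ Θ) := by rwa [List.append_assoc]
    rw [El.pair_mk _ _ hc'.append_left, El.pair_mk _ _ hc', El.pair_mk _ _ hc.append_right,
      El.pair_mk _ _ hc, ap_mk]
    exact (El.mk_eq (hk h h' h'' hc).symm (.of_eq (List.append_assoc _ _ _).symm) _ _).symm

theorem exists_assoc_inv (A A' A'' : Ty S.Ground) :
    ∃ k : Fun.{u₁, u₂, u₃, w} T (.tensor A (.tensor A' A'')) (.tensor (.tensor A A') A''),
      ∀ a b c, k.ap (.pair a (.pair b c)) = .pair (.pair a b) c := by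
  obtain ⟨k, hk⟩ := exists_of_pattern₃ (T := T) (pattern_three_right (A := A) (A' := A') (A'' := A''))
    pattern_three_left.typed
  refine ⟨k, fun a b c => ?_⟩
  rcases El.pair_pair_cases a b c with ⟨h, h'⟩ | ⟨Γ, v, Δ, t, Θ, u, h, h', h'', rfl, rfl, rfl, hc⟩
  · rw [h, h', ap_undef]
  · have hc' : IsCtx ((Γ ++ Δ) ++ Θ) := by rwa [List.append_assoc]
    rw [El.pair_mk _ _ hc'.append_left, El.pair_mk _ _ hc', El.pair_mk _ _ hc.append_right,
      El.pair_mk _ _ hc, ap_mk]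
    exact El.mk_eq (hk h h' h'' hc) (.of_eq (List.append_assoc _ _ _).symm) _ _

end Fun

end Combinators

end VLambda

namespace VLambda

set_option linter.unusedSectionVars false

/-! ### The term model as a symmetric monoidal closed category. -/

noncomputable section SyntacticCategory

variable {S : Signature.{u₁, u₂}} {V : Type u₃} [CompleteLattice V] [CommMonoid V] [IsQuantale V]
  {B : Set V}

/-- The objects of the term model: the types. -/
structure Syn (T : VTheory S B) : Type (max u₁ c) where
  ty : Ty S.Ground

namespace Syn

variable {T : VTheory S B} [hint : Fact ((1 : V) = ⊤)] [hreg : IsRegular.{u₁, u₂, u₃, w} T]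

/-- The term model. -/
instance : Category.{w} (Syn.{u₁, u₂, u₃, c} T) where
  Hom X Y := Fun.{u₁, u₂, u₃, w} T X.ty Y.ty
  id X := (Fun.exists_id (T := T) X.ty).choose
  comp f g := (Fun.exists_comp f g).choose
  id_comp f := Fun.ext fun a => by
    rw [(Fun.exists_comp _ _).choose_spec, (Fun.exists_id _).choose_spec]
  comp_id f := Fun.ext fun a => by
    rw [(Fun.exists_comp _ _).choose_spec, (Fun.exists_id _).choose_spec]
  assoc f g h := Fun.ext fun a => by
    simp only [(Fun.exists_comp _ _).choose_spec]

/-- The elements of an object. -/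
abbrev Elem (X : Syn.{u₁, u₂, u₃, c} T) := El T X.ty

variable {X X' Y Y' Z Z' W : Syn.{u₁, u₂, u₃, c} T}

/-- The action of a morphism on elements. -/
def act (f : X ⟶ Y) (a : X.Elem) : Y.Elem := Fun.ap (T := T) f a

@[simp] theorem act_id (a : X.Elem) : act (𝟙 X) a = a := (Fun.exists_id (T := T) X.ty).choose_spec a

@[simp] theorem act_comp (f : X ⟶ Y) (g : Y ⟶ Z) (a : X.Elem) : act (f ≫ g) a = act g (act f a) :=
  (Fun.exists_comp (T := T) f g).choose_spec a

theorem ap_comp_eq_ap_id {A D : Ty S.Ground} {f : Fun.{u₁, u₂, u₃, w} T A D} {g : Fun T D A}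
    {a : El T A} {b : El T D} (h : f.ap a = b) (h' : g.ap b = a) :
    (Fun.exists_comp f g).choose.ap a = (Fun.exists_id (T := T) A).choose.ap a := by
  rw [(Fun.exists_comp f g).choose_spec, (Fun.exists_id A).choose_spec, h, h']

instance : MonoidalCategoryStruct (Syn.{u₁, u₂, u₃, c} T) where
  tensorObj X Y := ⟨.tensor X.ty Y.ty⟩
  tensorUnit := ⟨.unit⟩
  tensorHom f g := (Fun.exists_tensor (T := T) f g).choose
  whiskerLeft X _ _ f := (Fun.exists_tensor (T := T) (𝟙 X : X ⟶ X) f).choose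
  whiskerRight f X := (Fun.exists_tensor (T := T) f (𝟙 X : X ⟶ X)).choose
  associator X Y Z :=
    { hom := (Fun.exists_assoc (T := T) X.ty Y.ty Z.ty).choose
      inv := (Fun.exists_assoc_inv (T := T) X.ty Y.ty Z.ty).choose
      hom_inv_id := Fun.ext_pair_left (T := T) fun a b c => ap_comp_eq_ap_id
        ((Fun.exists_assoc _ _ _).choose_spec a b c) ((Fun.exists_assoc_inv _ _ _).choose_spec a b c)
      inv_hom_id := Fun.ext_pair_right (T := T) fun a b c => ap_comp_eq_ap_id
        ((Fun.exists_assoc_inv _ _ _).choose_spec a b c) ((Fun.exists_assoc _ _ _).choose_spec a b c) }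
  leftUnitor X :=
    { hom := (Fun.exists_leftUnitor (T := T) X.ty).choose
      inv := (Fun.exists_leftUnitor_inv (T := T) X.ty).choose
      hom_inv_id := Fun.ext_star_pair (T := T) fun a => ap_comp_eq_ap_id
        ((Fun.exists_leftUnitor _).choose_spec a) ((Fun.exists_leftUnitor_inv _).choose_spec a)
      inv_hom_id := Fun.ext (T := T) fun a => ap_comp_eq_ap_id
        ((Fun.exists_leftUnitor_inv _).choose_spec a) ((Fun.exists_leftUnitor _).choose_spec a) }
  rightUnitor X :=
    { hom := (Fun.exists_rightUnitor (T := T) X.ty).choose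
      inv := (Fun.exists_rightUnitor_inv (T := T) X.ty).choose
      hom_inv_id := Fun.ext_pair_star (T := T) fun a => ap_comp_eq_ap_id
        ((Fun.exists_rightUnitor _).choose_spec a) ((Fun.exists_rightUnitor_inv _).choose_spec a)
      inv_hom_id := Fun.ext (T := T) fun a => ap_comp_eq_ap_id
        ((Fun.exists_rightUnitor_inv _).choose_spec a) ((Fun.exists_rightUnitor _).choose_spec a) }

/-- The pair of two elements. -/
def pair (a : X.Elem) (b : Y.Elem) : (X ⊗ Y).Elem := El.pair a b

/-- The element of the unit object. -/
def star : (𝟙_ (Syn.{u₁, u₂, u₃, c} T)).Elem := El.star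

@[simp] theorem act_tensorHom (f : X ⟶ Y) (g : X' ⟶ Y') (a : X.Elem) (b : X'.Elem) :
    act (f ⊗ₘ g) (pair a b) = pair (act f a) (act g b) :=
  (Fun.exists_tensor (T := T) f g).choose_spec a b

@[simp] theorem act_whiskerLeft (f : X' ⟶ Y') (a : X.Elem) (b : X'.Elem) :
    act (X ◁ f) (pair a b) = pair a (act f b) :=
  ((Fun.exists_tensor (T := T) (𝟙 X : X ⟶ X) f).choose_spec a b).trans
    (congrArg (fun a => pair a (act f b)) (act_id a))

@[simp] theorem act_whiskerRight (f : X ⟶ Y) (a : X.Elem) (b : X'.Elem) :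
    act (f ▷ X') (pair a b) = pair (act f a) b :=
  ((Fun.exists_tensor (T := T) f (𝟙 X' : X' ⟶ X')).choose_spec a b).trans
    (congrArg (fun b => pair (act f a) b) (act_id b))

@[simp] theorem act_associator_hom (a : X.Elem) (b : Y.Elem) (c : Z.Elem) :
    act (α_ X Y Z).hom (pair (pair a b) c) = pair a (pair b c) :=
  (Fun.exists_assoc (T := T) _ _ _).choose_spec a b c

@[simp] theorem act_associator_inv (a : X.Elem) (b : Y.Elem) (c : Z.Elem) :
    act (α_ X Y Z).inv (pair a (pair b c)) = pair (pair a b) c :=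
  (Fun.exists_assoc_inv (T := T) _ _ _).choose_spec a b c

@[simp] theorem act_leftUnitor_hom (a : X.Elem) : act (λ_ X).hom (pair star a) = a :=
  (Fun.exists_leftUnitor (T := T) _).choose_spec a

@[simp] theorem act_leftUnitor_inv (a : X.Elem) : act (λ_ X).inv a = pair star a :=
  (Fun.exists_leftUnitor_inv (T := T) _).choose_spec a

@[simp] theorem act_rightUnitor_hom (a : X.Elem) : act (ρ_ X).hom (pair a star) = a :=
  (Fun.exists_rightUnitor (T := T) _).choose_spec a

theorem hom_ext_pair {f g : X ⊗ Y ⟶ Z} (h : ∀ a b, act f (pair a b) = act g (pair a b)) : f = g :=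
  Fun.ext_pair (T := T) h

theorem hom_ext_pair_left {f g : (X ⊗ Y) ⊗ Z ⟶ W}
    (h : ∀ a b c, act f (pair (pair a b) c) = act g (pair (pair a b) c)) : f = g :=
  Fun.ext_pair_left (T := T) h

theorem hom_ext_pair_right {f g : X ⊗ (Y ⊗ Z) ⟶ W}
    (h : ∀ a b c, act f (pair a (pair b c)) = act g (pair a (pair b c))) : f = g :=
  Fun.ext_pair_right (T := T) h

/-- Every axiom is checked on nested pairs of elements, with `∗` in place of the unit factors. There
the structural morphisms act by rearranging components. -/
instance : MonoidalCategory (Syn.{u₁, u₂, u₃, c} T) :=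
  MonoidalCategory.ofTensorHom
    (id_tensorHom_id := fun X Y => hom_ext_pair fun a b => by simp)
    (id_tensorHom := fun X _ _ f => hom_ext_pair fun a b => by simp)
    (tensorHom_id := fun f X => hom_ext_pair fun a b => by simp)
    (tensorHom_comp_tensorHom := fun f g h k => hom_ext_pair fun a b => by simp)
    (associator_naturality := fun f g h => hom_ext_pair_left fun a b c => by simp)
    (leftUnitor_naturality := fun f => Fun.ext_star_pair (T := T) fun a =>
      show act _ (pair star a) = act _ (pair star a) by simp)
    (rightUnitor_naturality := fun f => Fun.ext_pair_star (T := T) fun a =>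
      show act _ (pair a star) = act _ (pair a star) by simp)
    (pentagon := fun W X Y Z => Fun.ext_four (T := T) fun a b c d =>
      show act _ (pair (pair (pair a b) c) d) = act _ (pair (pair (pair a b) c) d) by simp)
    (triangle := fun X Y => Fun.ext_triangle (T := T) fun a b =>
      show act _ (pair (pair a star) b) = act _ (pair (pair a star) b) by simp)

/-- The symmetry. -/
def braid (X Y : Syn.{u₁, u₂, u₃, c} T) : X ⊗ Y ⟶ Y ⊗ X :=
  (Fun.exists_braid (T := T) X.ty Y.ty).choose

theorem act_braid (a : X.Elem) (b : Y.Elem) : act (braid X Y) (pair a b) = pair b a :=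
  (Fun.exists_braid (T := T) X.ty Y.ty).choose_spec a b

instance : BraidedCategory (Syn.{u₁, u₂, u₃, c} T) where
  braiding X Y :=
    { hom := braid X Y
      inv := braid Y X
      hom_inv_id := hom_ext_pair fun a b => by simp [act_braid]
      inv_hom_id := hom_ext_pair fun a b => by simp [act_braid] }
  braiding_naturality_right X _ _ f := hom_ext_pair fun a b => by simp [act_braid]
  braiding_naturality_left f X := hom_ext_pair fun a b => by simp [act_braid]
  hexagon_forward X Y Z := hom_ext_pair_left fun a b c => by simp [act_braid]
  hexagon_reverse X Y Z := hom_ext_pair_right fun a b c => by simp [act_braid]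

@[simp] theorem act_braiding_hom (a : X.Elem) (b : Y.Elem) :
    act (β_ X Y).hom (pair a b) = pair b a := act_braid a b

instance : SymmetricCategory (Syn.{u₁, u₂, u₃, c} T) where
  symmetry X Y := hom_ext_pair fun a b => by simp

@[simp] theorem act_braiding_inv (a : X.Elem) (b : Y.Elem) :
    act (β_ Y X).inv (pair a b) = pair b a := by
  rw [← SymmetricCategory.braiding_swap_eq_inv_braiding]
  exact act_braid a b

/-- The internal hom. -/
def lolli (X Y : Syn.{u₁, u₂, u₃, c} T) : Syn.{u₁, u₂, u₃, c} T := ⟨.lolli X.ty Y.ty⟩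

/-- Evaluation of elements of the internal hom. -/
def eval (a : (lolli X Y).Elem) (b : X.Elem) : Y.Elem := El.app a b

theorem hom_ext_eval {f g : X ⟶ lolli Y Z} (h : ∀ a b, eval (act f a) b = eval (act g a) b) :
    f = g := Fun.ext_app (T := T) h

/-- The evaluation morphism. -/
def ev (X Y : Syn.{u₁, u₂, u₃, c} T) : lolli X Y ⊗ X ⟶ Y :=
  (Fun.exists_ev (T := T) X.ty Y.ty).choose

@[simp] theorem act_ev (a : (lolli X Y).Elem) (b : X.Elem) : act (ev X Y) (pair a b) = eval a b :=
  (Fun.exists_ev (T := T) X.ty Y.ty).choose_spec a b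

/-- Currying. -/
def curry (f : X ⊗ Y ⟶ Z) : Y ⟶ lolli X Z := (Fun.exists_curry (T := T) f).choose

@[simp] theorem eval_curry (f : X ⊗ Y ⟶ Z) (b : Y.Elem) (a : X.Elem) :
    eval (act (curry f) b) a = act f (pair a b) :=
  (Fun.exists_curry (T := T) f).choose_spec b a

/-- The hom-bijection of the adjunction `(X ⊗ -) ⊣ (X ⊸ -)`. -/
@[simps apply]
def curryEquiv (X Y Z : Syn.{u₁, u₂, u₃, c} T) : (X ⊗ Y ⟶ Z) ≃ (Y ⟶ lolli X Z) where
  toFun f := curry f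
  invFun g := (X ◁ g) ≫ (β_ X (lolli X Z)).hom ≫ ev X Z
  left_inv f := hom_ext_pair fun a b => by simp
  right_inv g := hom_ext_eval fun b a => by simp

theorem curryEquiv_naturality (f : X ⊗ Y ⟶ Z) (g : Y' ⟶ Y) :
    curryEquiv X Y' Z ((X ◁ g) ≫ f) = g ≫ curryEquiv X Y Z f :=
  hom_ext_eval fun b a => by simp

instance : MonoidalClosed (Syn.{u₁, u₂, u₃, c} T) where
  closed X :=
    { rightAdj := Adjunction.rightAdjointOfEquiv (F := tensorLeft X) (G_obj := lolli X)
        (fun Y Z => curryEquiv X Y Z) fun _ _ _ g f => curryEquiv_naturality f g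
      adj := Adjunction.adjunctionOfEquivRight (F := tensorLeft X) (G_obj := lolli X)
        (fun Y Z => curryEquiv X Y Z) fun _ _ _ g f => curryEquiv_naturality f g }

-- Right transposition is currying preceded by the symmetry, which puts the components back in the
-- order `b`, `a`.
@[simp] theorem eval_transpose (f : Y ⊗ X ⟶ Z) (b : Y.Elem) (a : X.Elem) :
    eval (act (transpose Y X Z f) b) a = act f (pair b a) := by
  have h : (ihom.adjunction X).homEquiv Y Z = curryEquiv X Y Z :=
    congrFun (congrFun (Adjunction.mkOfHomEquiv_homEquiv _) Y) Z
  have : transpose Y X Z f = curry ((β_ Y X).inv ≫ f ≫ 𝟙 Z) := DFunLike.congr_fun h _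
  rw [this]
  simp

@[simp] theorem act_transpose_symm (g : Y ⟶ (ihom X).obj Z) (b : Y.Elem) (a : X.Elem) :
    act ((transpose Y X Z).symm g) (pair b a) = eval (act g b) a := by
  rw [← eval_transpose, Equiv.apply_symm_apply]

@[simp] theorem act_appHom (b : ((ihom X).obj Z).Elem) (a : X.Elem) :
    act (appHom X Z) (pair b a) = eval b a := by
  rw [appHom, act_transpose_symm]
  exact congrArg (eval · a) (act_id b)

end Syn

end SyntacticCategory

end VLambda

namespace VLambda

set_option linter.unusedSectionVars false

theorem sSup_mul_sSup_le {V : Type u₃} [CompleteLattice V] [CommMonoid V] [IsQuantale V]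
    {s t : Set V} {x : V} (h : ∀ q ∈ s, ∀ r ∈ t, q * r ≤ x) : sSup s * sSup t ≤ x := by
  rw [IsQuantale.sSup_mul_distrib]
  refine iSup₂_le fun q hq => ?_
  rw [IsQuantale.mul_sSup_distrib]
  exact iSup₂_le fun r hr => h q hq r hr

theorem Pattern.perm {S : Signature.{u₁, u₂}} {Γ E : Ctx S.Ground} {v : Tm S} {A : Ty S.Ground}
    (h : Pattern Γ v A) (hp : E.Perm Γ) : Pattern E v A := by
  cases h with
  | var x A => rw [List.perm_singleton.1 hp]; exact .var x A
  | star => rw [List.perm_nil.1 hp]; exact .star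
  | pair h h' hp' hE => exact .pair h h' (hp.trans hp') (hE.perm hp)

/-! ### Enrichment of the term model. -/

noncomputable section TermModel

variable {S : Signature.{u₁, u₂}} {V : Type u₃} [CompleteLattice V] [CommMonoid V] [IsQuantale V]
  {B : Set V} {T : VTheory S B} [hint : Fact ((1 : V) = ⊤)] [hreg : IsRegular.{u₁, u₂, u₃, w} T]
  {A A' D D' : Ty S.Ground} {Γ Δ E : Ctx S.Ground} {v v' t t' u : Tm S} {q r : V}

namespace Fun

/-- The `V`-category of closed functions. -/
def vcat (A D : Ty S.Ground) : VCat V (Fun.{u₁, u₂, u₃, w} T A D) where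
  hom f g := sSup {q | Thm T.Ax [] f.tm g.tm (.lolli A D) q}
  one_le f := le_top.trans (le_sSup (Thm.refl f.typed))
  mul_le _ _ _ := sSup_mul_sSup_le fun _ h _ h' => le_sSup (h.trans h')

theorem thm_app {f g : Fun.{u₁, u₂, u₃, w} T A D} (h : Thm T.Ax [] f.tm g.tm (.lolli A D) q)
    (ht : Thm T.Ax Γ v t A r) (hΓ : IsCtx Γ) :
    Thm T.Ax Γ (.app f.tm v) (.app g.tm t) D (q * r) :=
  h.app_of_perm ht (.refl _) hΓ

theorem thm_app_refl {f g : Fun.{u₁, u₂, u₃, w} T A D} (h : Thm T.Ax [] f.tm g.tm (.lolli A D) q)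
    (hv : Typed Γ v A) : Thm T.Ax Γ (.app f.tm v) (.app g.tm v) D q := by
  have := thm_app h (.refl hv) hv.isCtx
  rwa [mul_top_eq] at this

/-- Distances between morphisms, too, can be bounded at one pattern, since abstraction over a
pattern preserves labels. -/
theorem thm_of_pattern {P : Tm S} (hP : Pattern Γ P A) {f g : Fun.{u₁, u₂, u₃, w} T A D}
    (hf : TEq T.Ax Γ (.app f.tm P) v D) (hg : TEq T.Ax Γ (.app g.tm P) t D)
    (h : Thm T.Ax Γ v t D q) : Thm T.Ax [] f.tm g.tm (.lolli A D) q :=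
  hP.thm_of_app f.typed g.typed (hf.symm.thm hg.symm h)

end Fun

namespace Syn

variable {X X' Y Y' Z Z' W : Syn.{u₁, u₂, u₃, c} T}

theorem teq_comp (f : X ⟶ Y) (g : Y ⟶ Z) : TEq T.Ax [(0, X.ty)] (.app (Fun.tm (T := T) (f ≫ g)) (.fvar 0))
    (.app (Fun.tm (T := T) g) (.app (Fun.tm (T := T) f) (.fvar 0))) Z.ty :=
  (El.teq_of_mk_eq (act_comp f g (.mk (.fvar 0 X.ty)))).2

theorem teq_tensor (f : X ⟶ Y) (g : X' ⟶ Y') : TEq T.Ax [(0, X.ty), (1, X'.ty)]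
    (.app (Fun.tm (T := T) (f ⊗ₘ g)) (.pair (.fvar 0) (.fvar 1)))
    (.pair (.app (Fun.tm (T := T) f) (.fvar 0)) (.app (Fun.tm (T := T) g) (.fvar 1)))
    (.tensor Y.ty Y'.ty) := by
  have h := act_tensorHom f g (.mk (.fvar 0 X.ty)) (.mk (.fvar 1 X'.ty))
  have hc : IsCtx ([(0, X.ty)] ++ [(1, X'.ty)]) := Fun.isCtx_two
  unfold pair act at h
  rw [El.pair_mk _ _ hc, Fun.ap_mk, Fun.ap_mk, Fun.ap_mk, El.pair_mk _ _ hc] at h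
  exact (El.teq_of_mk_eq h).2

theorem teq_transpose (f : Y ⊗ X ⟶ Z) : TEq T.Ax [(0, Y.ty), (1, X.ty)]
    (.app (.app (Fun.tm (T := T) (transpose Y X Z f)) (.fvar 0)) (.fvar 1))
    (.app (Fun.tm (T := T) f) (.pair (.fvar 0) (.fvar 1))) Z.ty := by
  have h := eval_transpose f (.mk (.fvar 0 Y.ty)) (.mk (.fvar 1 X.ty))
  have hc : IsCtx ([(0, Y.ty)] ++ [(1, X.ty)]) := Fun.isCtx_two
  unfold pair act eval at h
  rw [El.pair_mk _ _ hc, Fun.ap_mk] at h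
  erw [Fun.ap_mk, El.app_mk _ _ hc] at h
  exact (El.teq_of_mk_eq h).2

/-- Compare `f` and `g` at `x₀ ⊗ x₁`, rewrite as the transposes applied to `x₀` and `x₁`, then
abstract over `x₁` and `x₀` in turn. None of these steps changes the label. -/
theorem thm_transpose {f g : Y ⊗ X ⟶ Z}
    (h : Thm T.Ax [] (Fun.tm (T := T) f) (Fun.tm (T := T) g) (.lolli (.tensor Y.ty X.ty) Z.ty) q) :
    Thm T.Ax [] (Fun.tm (T := T) (transpose Y X Z f)) (Fun.tm (T := T) (transpose Y X Z g))
      (.lolli Y.ty (.lolli X.ty Z.ty)) q := by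
  have hc : IsCtx [(1, X.ty), (0, Y.ty)] := by simp [IsCtx]
  have h₁ := ((teq_transpose f).symm.thm (teq_transpose g).symm
    (Fun.thm_app_refl (T := T) h Fun.pattern_two.typed)).perm (.swap _ _ _)
  have hty (f : Y ⊗ X ⟶ Z) : Typed [(0, Y.ty)] (.app (Fun.tm (T := T) (transpose Y X Z f)) (.fvar 0))
      (.lolli X.ty Z.ty) :=
    (Fun.typed (T := T) (transpose Y X Z f)).app (.fvar 0 Y.ty) (.refl _) (Typed.fvar 0 Y.ty).isCtx
  exact Fun.thm_of_pattern (T := T) (.var 0 Y.ty) (.symm (.base (.abs_eta (hty f) hc)))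
    (.symm (.base (.abs_eta (hty g) hc))) h₁.abs

theorem thm_of_transpose {f g : Y ⊗ X ⟶ Z}
    (h : Thm T.Ax [] (Fun.tm (T := T) (transpose Y X Z f)) (Fun.tm (T := T) (transpose Y X Z g))
      (.lolli Y.ty (.lolli X.ty Z.ty)) q) :
    Thm T.Ax [] (Fun.tm (T := T) f) (Fun.tm (T := T) g) (.lolli (.tensor Y.ty X.ty) Z.ty) q := by
  have h₁ := (Fun.thm_app_refl (T := T) h (.fvar 0 Y.ty)).app_of_perm (.refl (.fvar 1 X.ty))
    (.refl _) Fun.isCtx_two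
  rw [mul_top_eq] at h₁
  exact Fun.thm_of_pattern (T := T) Fun.pattern_two (teq_transpose f).symm (teq_transpose g).symm h₁

/-- Evaluated at a variable or a pair of variables, the inequalities become the compatibility rules.
Separation holds because a supremum above the unit makes the label `⊤` itself provable. -/
instance : VCatSepAutonomous (Syn.{u₁, u₂, u₃, c} T) V where
  homVCat X Y := Fun.vcat (T := T) X.ty Y.ty
  separated X Y f g h h' := Fun.ext_tm (T := T)
    (TEq.of_le_sSup hreg.one_mem (Fun.typed (T := T) f) (Fun.typed (T := T) g) h h')
  comp_vfunctor X Y Z p p' := sSup_mul_sSup_le fun q hq r hr => le_sSup <| by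
    -- The composite acts as the second morphism applied to the first, so the application rule
    -- yields the label `r * q`.
    rw [mul_comm q r]
    exact Fun.thm_of_pattern (T := T) (.var 0 X.ty) (teq_comp p.1 p.2) (teq_comp p'.1 p'.2)
      (Fun.thm_app (T := T) hr (Fun.thm_app_refl (T := T) hq (.fvar 0 X.ty))
        (Typed.fvar 0 X.ty).isCtx)
  tensor_vfunctor X Y X' Y' p p' := sSup_mul_sSup_le fun q hq r hr => le_sSup <|
    Fun.thm_of_pattern (T := T) Fun.pattern_two (teq_tensor p.1 p.2) (teq_tensor p'.1 p'.2)
      ((Fun.thm_app_refl (T := T) hq (.fvar 0 X.ty)).pair_of_perm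
        (Fun.thm_app_refl (T := T) hr (.fvar 1 X'.ty)) (.refl _) Fun.isCtx_two)
  adj_viso Y X Z := ⟨fun f g => sSup_le_sSup fun q hq => thm_transpose hq,
    fun f g => sSup_le_sSup fun q hq => thm_of_transpose (by
      rw [Equiv.apply_symm_apply, Equiv.apply_symm_apply]; exact hq)⟩

end Syn

end TermModel

end VLambda

namespace VLambda

set_option linter.unusedSectionVars false

/-! ### Tuples, operation symbols and term formers in the term model. -/

section Tuples

variable {S : Signature.{u₁, u₂}}

/-- The term `(… (v 0 ⊗ v 1) ⊗ …) ⊗ v (n - 1)`. -/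
def nPair : (n : ℕ) → (Fin n → Tm S) → Tm S
  | 0, _ => .star
  | 1, v => v 0
  | n + 2, v => .pair (nPair (n + 1) fun i => v i.castSucc) (v (Fin.last (n + 1)))

theorem subst_nPair (σ : ℕ → Tm S) : ∀ (n : ℕ) (v : Fin n → Tm S),
    (nPair n v).subst σ = nPair n fun i => (v i).subst σ
  | 0, _ => rfl
  | 1, _ => rfl
  | n + 2, v => congrArg (Tm.pair · _) (subst_nPair σ (n + 1) fun i => v i.castSucc)

theorem Shuffles.flatten_perm {α : Type u₁} {n : ℕ} {Γ : Fin n → List α} {E : List α}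
    (s : Shuffles n Γ E) : E.Perm (List.ofFn Γ).flatten := by
  induction s with
  | nil => simp
  | snoc Γ _ s' ih =>
    rw [List.ofFn_succ_last, List.flatten_append]
    simpa using s'.perm.trans (ih.append_right _)

theorem Shuffle.nonempty_left {α : Type u₁} (l : List α) : Nonempty (Shuffle l [] l) := by
  induction l with
  | nil => exact ⟨.nil⟩
  | cons a l ih => exact ih.map (.left a)

/-- This is the generic context of an `n`-ary operation, with variable `i` in position `i`. The
names appear reversed because the head of a context is its rightmost variable. -/
theorem exists_shuffles {G : Type u₁} (n : ℕ) (A : Fin n → Ty G) : ∃ E : Ctx G,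
    Nonempty (Shuffles n (fun i => [((i : ℕ), A i)]) E) ∧ E.map Prod.fst = (List.range n).reverse := by
  induction n with
  | zero => exact ⟨[], ⟨.nil _⟩, rfl⟩
  | succ n ih =>
    obtain ⟨E, ⟨s⟩, hE⟩ := ih fun i => A i.castSucc
    obtain ⟨s'⟩ := Shuffle.nonempty_left E
    exact ⟨(n, A (Fin.last n)) :: E, ⟨.snoc _ s (.right _ s')⟩, by
      simp [hE, List.range_succ]⟩

end Tuples

noncomputable section TermModel

variable {S : Signature.{u₁, u₂}} {V : Type u₃} [CompleteLattice V] [CommMonoid V] [IsQuantale V]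
  {B : Set V} {T : VTheory S B} [hint : Fact ((1 : V) = ⊤)] [hreg : IsRegular.{u₁, u₂, u₃, w} T]
  {A A' D D' : Ty S.Ground} {Γ Δ E : Ctx S.Ground} {v v' t t' u : Tm S} {q r : V}

namespace Syn

variable {X X' Y Y' Z Z' W : Syn.{u₁, u₂, u₃, c} T}

/-- The tuple of some elements. -/
def nTuple : (n : ℕ) → {X : Fin n → Syn.{u₁, u₂, u₃, c} T} → (∀ i, (X i).Elem) → (nTensor n X).Elem
  | 0, _, _ => star
  | 1, _, a => a 0
  | n + 2, _, a => pair (nTuple (n + 1) fun i => a i.castSucc) (a (Fin.last (n + 1)))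

theorem act_nTensorHom : ∀ (n : ℕ) {X Y : Fin n → Syn.{u₁, u₂, u₃, c} T} (f : ∀ i, X i ⟶ Y i)
    (a : ∀ i, (X i).Elem), act (nTensorHom n f) (nTuple n a) = nTuple n fun i => act (f i) (a i)
  | 0, _, _, _, _ => act_id _
  | 1, _, _, _, _ => rfl
  | n + 2, _, _, f, a => (act_tensorHom _ _ _ _).trans
      (congrArg (pair · _) (act_nTensorHom (n + 1) (fun i => f i.castSucc) fun i => a i.castSucc))

theorem act_nTensorSnoc : ∀ (n : ℕ) {X : Fin (n + 1) → Syn.{u₁, u₂, u₃, c} T}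
    (a : ∀ i, (X i).Elem),
    act (nTensorSnoc n X).hom (pair (nTuple n fun i => a i.castSucc) (a (Fin.last n))) =
      nTuple (n + 1) a
  | 0, _, _ => act_leftUnitor_hom _
  | _ + 1, _, _ => act_id _

theorem exists_nTuple_eq {n : ℕ} {Γ : Fin n → Ctx S.Ground} {E : Ctx S.Ground}
    (s : Shuffles n Γ E) (hE : IsCtx E) {X : Fin n → Syn.{u₁, u₂, u₃, c} T} {v : Fin n → Tm S}
    (h : ∀ i, Typed (Γ i) (v i) (X i).ty) :
    ∃ h' : Typed E (nPair n v) (nTensor n X).ty, nTuple n (fun i => (El.mk (h i) : (X i).Elem)) = El.mk h' := by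
  induction s with
  | nil => exact ⟨.star, rfl⟩
  | @snoc n E' E Γ s s' ih =>
    have hE' := hE.perm s'.perm.symm
    cases n with
    | zero =>
      cases s
      refine ⟨(h 0).perm s'.perm, ?_⟩
      exact (El.mk_eq (.refl ((h 0).perm s'.perm)) s'.perm _ _).symm
    | succ n =>
      obtain ⟨h₁, h₂⟩ := ih hE'.append_left (X := fun i => X i.castSucc) fun i => h i.castSucc
      refine ⟨h₁.pair (h (Fin.last (n + 1))) s'.perm hE, ?_⟩
      exact (congrArg (pair (X := nTensor (n + 1) fun i => X i.castSucc) (Y := X (Fin.last (n + 1))) ·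
        (El.mk (h (Fin.last (n + 1))))) h₂).trans ((El.pair_mk h₁ (h (Fin.last (n + 1))) hE').trans
          (El.mk_eq (.refl (h₁.pair (h (Fin.last (n + 1))) (.refl _) hE')) s'.perm.symm _ _))

theorem pattern_nPair {n : ℕ} {Γ : Fin n → Ctx S.Ground} {E : Ctx S.Ground}
    (s : Shuffles n Γ E) (hE : IsCtx E) {X : Fin n → Syn.{u₁, u₂, u₃, c} T} {v : Fin n → Tm S}
    (h : ∀ i, Pattern (Γ i) (v i) (X i).ty) : Pattern E (nPair n v) (nTensor n X).ty := by
  induction s with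
  | nil => exact .star
  | @snoc n E' E Γ s s' ih =>
    have hE' := hE.perm s'.perm.symm
    cases n with
    | zero => cases s; exact (h 0).perm s'.perm
    | succ n =>
      exact (ih hE'.append_left (X := fun i => X i.castSucc) fun i => h i.castSucc).pair
        (h (Fin.last (n + 1))) s'.perm hE

/-- Functional completeness yields a morphism whose value at the generic tuple of variables is the
operation applied to them; substitution gives its values at other tuples of terms. The family `A` is
kept apart from the types of `X`, as for interpreted types the two agree only up to a proved
equality. -/
theorem exists_op (n : ℕ) (X : Fin n → Syn.{u₁, u₂, u₃, c} T) {A : Fin n → Ty S.Ground}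
    (hX : ∀ i, (X i).ty = A i) (Y : Syn.{u₁, u₂, u₃, c} T) {op : (Fin n → Tm S) → Tm S}
    (hop : ∀ (σ : ℕ → Tm S) v, (op v).subst σ = op fun i => (v i).subst σ)
    (hty : ∀ (Γ : Fin n → Ctx S.Ground) (v : Fin n → Tm S) (E : Ctx S.Ground),
      (∀ i, Typed (Γ i) (v i) (A i)) → Shuffles n Γ E → IsCtx E → Typed E (op v) Y.ty) :
    ∃ f : nTensor n X ⟶ Y, ∀ (Γ : Fin n → Ctx S.Ground) (v : Fin n → Tm S) (E : Ctx S.Ground)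
      (h : ∀ i, Typed (Γ i) (v i) (X i).ty) (_ : Shuffles n Γ E) (_ : IsCtx E)
      (h' : Typed E (op v) Y.ty),
      act f (nTuple n fun i => (El.mk (h i) : (X i).Elem)) = El.mk h' := by
  obtain rfl : (fun i => (X i).ty) = A := funext hX
  obtain ⟨F, ⟨s⟩, hF⟩ := exists_shuffles n fun i => (X i).ty
  have hFc : IsCtx F := by rw [IsCtx, hF]; exact List.nodup_reverse.2 List.nodup_range
  have hP := pattern_nPair s hFc (X := X) (v := fun i => .fvar i) fun i => .var i _
  have hv := hty _ (fun i => .fvar i) F (fun i => .fvar i _) s hFc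
  obtain ⟨f, hf⟩ := Fun.exists_of_pattern (T := T) hP hv
  refine ⟨f, fun Γ v E h sE hE h' => ?_⟩
  obtain ⟨h₁, h₂⟩ := exists_nTuple_eq sE hE h
  rw [h₂]
  -- The default values of `σ` and `θ` never matter, since all names in `F` are below `n`.
  let σ : ℕ → Tm S := fun x => if h : x < n then v ⟨x, h⟩ else .star
  let θ : ℕ × Ty S.Ground → Ctx S.Ground := fun p => if h : p.1 < n then Γ ⟨p.1, h⟩ else []
  have hmem : ∀ p ∈ F, ∃ i : Fin n, p = (↑i, (X i).ty) := by
    intro p hp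
    have := s.flatten_perm.mem_iff.1 hp
    simpa [List.mem_flatten, List.mem_ofFn, eq_comm] using this
  have hp : E.Perm (F.flatMap θ) := by
    refine sE.flatten_perm.trans (List.Perm.trans ?_ (s.flatten_perm.flatMap_right θ).symm)
    rw [List.flatMap_def, List.map_flatten, List.flatten_flatten, List.map_map, List.map_ofFn]
    refine .of_eq (congrArg (fun l => (List.ofFn l).flatten) (funext fun i => ?_))
    simp [θ]
  have := f.subst_app_tm (T := T) hP.typed hv hf (σ := σ) (θ := θ) (by
    intro p hp
    obtain ⟨i, rfl⟩ := hmem p hp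
    simpa [σ, θ] using h i) hp hE
  rw [subst_nPair, hop] at this
  simp only [Tm.subst, σ, Fin.is_lt, dite_true, Fin.eta] at this
  exact El.mk_eq this (.refl _) _ _

/-- If `t` is the value of `g` at `(x ⊗ y) ⊗ s`, then η for matching identifies `pm v to x ⊗ y. t`
with the value of `g` at `v ⊗ s`. -/
theorem act_pm {A₁ A₂ : Ty S.Ground} {x y : ℕ} (h₁ : X.ty = A₁) (h₂ : Y.ty = A₂)
    {g : (X ⊗ Y) ⊗ W ⟶ Z} {s : Tm S} (hx : Typed [(x, A₁)] (.fvar x) X.ty)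
    (hy : Typed [(y, A₂)] (.fvar y) Y.ty) (hs : Typed Δ s W.ty)
    (ht : Typed ((y, A₂) :: (x, A₁) :: Δ) t Z.ty)
    (h : act g (pair (pair (El.mk hx) (El.mk hy)) (El.mk hs)) = El.mk ht)
    (hv : Typed Γ v (X ⊗ Y).ty) (hp : E.Perm (Γ ++ Δ)) (hE : IsCtx E)
    (hpm : Typed E (.pm v x y t) Z.ty) :
    act g (pair (El.mk hv) (El.mk hs)) = El.mk hpm := by
  subst h₁ h₂
  have hΓΔ := hE.perm hp.symm
  have hc := ht.isCtx
  have hcxy : IsCtx ([(x, X.ty)] ++ [(y, Y.ty)]) :=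
    IsCtx.perm (IsCtx.append_left (Γ := [_, _]) (Δ := Δ) hc) (.swap _ _ _)
  have hcp : IsCtx (([(x, X.ty)] ++ [(y, Y.ty)]) ++ Δ) := hc.perm (.swap _ _ _)
  obtain ⟨z, hz⟩ := exists_fresh (Δ.map Prod.fst)
  have hcz : IsCtx ((z, (X ⊗ Y).ty) :: Δ) := hΓΔ.append_right.cons hz
  have hg := Fun.typed (T := T) g
  have h₁ : TEq T.Ax ((y, Y.ty) :: (x, X.ty) :: Δ)
      (.app (Fun.tm (T := T) g) (.pair (.pair (.fvar x) (.fvar y)) s)) t Z.ty := by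
    unfold pair act at h
    rw [El.pair_mk _ _ hcxy, El.pair_mk _ _ hcp, Fun.ap_mk] at h
    exact (El.teq_of_mk_eq h).2.perm (.swap _ _ _)
  have hu : Typed ((z, (X ⊗ Y).ty) :: Δ) (.app (Fun.tm (T := T) g) (.pair (.fvar z) s)) Z.ty :=
    hg.app ((Typed.fvar z _).pair hs (.refl _) hcz) (.refl _) hcz
  have h₂ := TEq.base (Ax := T.Ax) (.pm_eta hv hu hc hp hE)
  rw [Tm.subst₁_app, Tm.subst₁_pair, Tm.subst₁_of_not_free (hs.not_free hz), Tm.subst₁_fvar,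
    Tm.subst₁_of_not_free (hg.not_free (by simp)), Tm.subst₁_app, Tm.subst₁_pair,
    Tm.subst₁_of_not_free (hs.not_free hz), Tm.subst₁_fvar,
    Tm.subst₁_of_not_free (hg.not_free (by simp))] at h₂
  have h₃ := ((TEq.refl hv).pm h₁ hp hE).symm.trans h₂
  unfold pair act
  rw [El.pair_mk _ _ hΓΔ, Fun.ap_mk]
  exact (El.mk_eq h₃ hp _ _).symm

/-- The same argument with the η-rule for `∗`. -/
theorem act_letStar {g : 𝟙_ _ ⊗ W ⟶ Z} {s : Tm S} (hs : Typed Δ s W.ty) (ht : Typed Δ t Z.ty)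
    (h : act g (pair star (El.mk hs)) = El.mk ht)
    (hv : Typed Γ v (𝟙_ (Syn.{u₁, u₂, u₃, c} T)).ty) (hp : E.Perm (Γ ++ Δ)) (hE : IsCtx E)
    (hl : Typed E (.letStar v t) Z.ty) :
    act g (pair (El.mk hv) (El.mk hs)) = El.mk hl := by
  have hΓΔ := hE.perm hp.symm
  obtain ⟨z, hz⟩ := exists_fresh (Δ.map Prod.fst)
  have hcz : IsCtx ((z, (.unit : Ty S.Ground)) :: Δ) := hΓΔ.append_right.cons hz
  have hg := Fun.typed (T := T) g
  have h₁ : TEq T.Ax Δ (.app (Fun.tm (T := T) g) (.pair .star s)) t Z.ty := by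
    unfold pair act star El.star at h
    rw [El.pair_mk _ _ (by exact hΓΔ.append_right), Fun.ap_mk] at h
    exact (El.teq_of_mk_eq h).2
  have hu : Typed ((z, .unit) :: Δ) (.app (Fun.tm (T := T) g) (.pair (.fvar z) s)) Z.ty :=
    hg.app ((Typed.fvar z _).pair hs (.refl _) hcz) (.refl _) hcz
  have h₂ := TEq.base (Ax := T.Ax) (.star_eta hv hu hp hE)
  rw [Tm.subst₁_app, Tm.subst₁_pair, Tm.subst₁_of_not_free (hs.not_free hz), Tm.subst₁_fvar,
    Tm.subst₁_of_not_free (hg.not_free (by simp)), Tm.subst₁_app, Tm.subst₁_pair,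
    Tm.subst₁_of_not_free (hs.not_free hz), Tm.subst₁_fvar,
    Tm.subst₁_of_not_free (hg.not_free (by simp))] at h₂
  have h₃ := ((TEq.refl hv).letStar h₁ hp hE).symm.trans h₂
  unfold pair act
  rw [El.pair_mk _ _ hΓΔ, Fun.ap_mk]
  exact (El.mk_eq h₃ hp _ _).symm

theorem mk_eq_mk_abs {A₁ : Ty S.Ground} {x : ℕ} (h₁ : X.ty = A₁) {s : Tm S}
    (hs : Typed Γ s ((ihom X).obj Z).ty)
    (hx : Typed [(x, A₁)] (.fvar x) X.ty) (hv : Typed ((x, A₁) :: Γ) v Z.ty)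
    (h : eval (X := X) (Y := Z) (El.mk hs) (El.mk hx) = El.mk hv)
    (habs : Typed Γ (.abs x A₁ v) ((ihom X).obj Z).ty) :
    (El.mk hs : El T ((ihom X).obj Z).ty) = El.mk habs := by
  subst h₁
  have hc := hv.isCtx
  have hc' : IsCtx (Γ ++ [(x, X.ty)]) := hc.perm (List.perm_append_comm (l₂ := [_]))
  have h := (El.app_mk hs hx hc').symm.trans h
  have h₂ := ((El.teq_of_mk_eq h).2.perm (List.perm_append_comm (l₁ := [_]))).abs
  exact El.mk_eq (TEq.trans (.symm (.base (.abs_eta hs hc))) h₂) (.refl _) _ _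

end Syn

end TermModel

end VLambda

namespace VLambda

set_option linter.unusedSectionVars false

/-! ### The canonical interpretation in the term model. -/

noncomputable section TermModel

variable {S : Signature.{u₁, u₂}} {V : Type u₃} [CompleteLattice V] [CommMonoid V] [IsQuantale V]
  {B : Set V} {T : VTheory S B} [hint : Fact ((1 : V) = ⊤)] [hreg : IsRegular.{u₁, u₂, u₃, w} T]
  {A A' D D' : Ty S.Ground} {Γ Δ E : Ctx S.Ground} {v v' t t' u : Tm S} {q r : V}

namespace Syn

section

variable {X X' Y Y' Z Z' W K : Syn.{u₁, u₂, u₃, c} T}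

theorem act_comp_tensorHom {k : K ⟶ X ⊗ Y} {e : K.Elem} {a : X.Elem} {b : Y.Elem}
    (h : act k e = pair a b) (f : X ⟶ X') (g : Y ⟶ Y') :
    act (k ≫ (f ⊗ₘ g)) e = pair (act f a) (act g b) := by simp [h]

theorem act_comp_whiskerRight_comp {k : K ⟶ X ⊗ Y} {e : K.Elem} {a : X.Elem} {b : Y.Elem}
    (h : act k e = pair a b) (f : X ⟶ X') (g : X' ⊗ Y ⟶ Z) :
    act (k ≫ (f ▷ Y) ≫ g) e = act g (pair (act f a) b) := by simp [h]

theorem act_comp_app {k : K ⟶ X ⊗ Y} {e : K.Elem} {a : X.Elem} {b : Y.Elem}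
    (h : act k e = pair a b) (f : X ⟶ (ihom X').obj Z) (g : Y ⟶ X') :
    act (k ≫ (f ⊗ₘ g) ≫ appHom X' Z) e = eval (act f a) (act g b) := by
  rw [act_comp, act_comp, h, act_tensorHom, act_appHom]
  rfl

theorem act_split_left {k : K ⟶ X ⊗ Y} {e : K.Elem} {a : X.Elem} {b : Y.Elem}
    (h : act k e = pair a b) (i : W ⟶ K ⊗ Z) {d : W.Elem} {p : Z.Elem} (hi : act i d = pair e p)
    (j : X ⊗ Z ⟶ X') {a' : X'.Elem} (hj : act j (pair a p) = a') :
    act (i ≫ (k ▷ Z) ≫ (α_ X Y Z).hom ≫ (X ◁ (β_ Y Z).hom) ≫ (α_ X Z Y).inv ≫ (j ▷ Y)) d =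
      pair a' b := by
  simp [hi, h, hj]

theorem act_split_right {k : K ⟶ X ⊗ Y} {e : K.Elem} {a : X.Elem} {b : Y.Elem}
    (h : act k e = pair a b) (i : W ⟶ K ⊗ Z) {d : W.Elem} {p : Z.Elem} (hi : act i d = pair e p)
    (j : Y ⊗ Z ⟶ Y') {b' : Y'.Elem} (hj : act j (pair b p) = b') :
    act (i ≫ (k ▷ Z) ≫ (α_ X Y Z).hom ≫ (X ◁ j)) d = pair a b' := by
  simp [hi, h, hj]

theorem act_match {K' : Syn.{u₁, u₂, u₃, c} T} (j : K ⊗ X ⟶ W) (j' : W ⊗ Y ⟶ K') (f : K' ⟶ Z)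
    (a : X.Elem) (b : Y.Elem) (e : K.Elem) :
    act ((β_ (X ⊗ Y) K).hom ≫ (α_ K X Y).inv ≫ (j ▷ Y) ≫ j' ≫ f) (pair (pair a b) e) =
      act f (act j' (pair (act j (pair e a)) b)) := by
  simp

theorem act_nSplit_snoc {n : ℕ} {X : Fin (n + 1) → Syn.{u₁, u₂, u₃, c} T}
    {k : K ⟶ W ⊗ X (Fin.last n)} {e : K.Elem} {b : W.Elem} (a : ∀ i, (X i).Elem)
    (h : act k e = pair b (a (Fin.last n))) (k' : W ⟶ nTensor n fun i => X i.castSucc)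
    (h' : act k' b = nTuple n fun i => a i.castSucc) :
    act (k ≫ (k' ▷ X (Fin.last n)) ≫ (nTensorSnoc n X).hom) e = nTuple (n + 1) a := by
  rw [act_comp, act_comp, h, act_whiskerRight, h', act_nTensorSnoc]

end

variable (T) in
/-- The interpretation of the ground types in the term model. -/
def groundObj (g : S.Ground) : Syn.{u₁, u₂, u₃, c} T := ⟨.ground g⟩

/-- The equality requires an induction on `A`, so typing judgements have to be transported along it.
-/
theorem ty_tyObj (A : Ty S.Ground) : (tyObj (groundObj.{u₁, u₂, u₃, c} T) A).ty = A := by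
  induction A with
  | ground g => rfl
  | unit => rfl
  | tensor A A' ih ih' => exact congrArg₂ Ty.tensor ih ih'
  | lolli A A' ih ih' => exact congrArg₂ Ty.lolli ih ih'

theorem typed_tyObj (h : Typed Γ v A) : Typed Γ v (tyObj (groundObj.{u₁, u₂, u₃, c} T) A).ty := by
  rwa [ty_tyObj]

/-- The element of the term model given by a term-in-context. -/
def of (h : Typed Γ v A) : (tyObj (groundObj.{u₁, u₂, u₃, c} T) A).Elem := El.mk (typed_tyObj h)

theorem pair_of (h : Typed Γ v A) (h' : Typed Δ t A') (hp : E.Perm (Γ ++ Δ)) (hE : IsCtx E) :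
    pair (of.{u₁, u₂, u₃, w, c} (T := T) h) (of h') = of (h.pair h' hp hE) :=
  (El.pair_mk _ _ (hE.perm hp.symm)).trans
    (El.mk_eq (.refl (typed_tyObj.{u₁, u₂, u₃, w, c} (h.pair h' (.refl _) (hE.perm hp.symm)))) hp.symm _ _)

theorem eval_of (h : Typed Γ v (.lolli A A')) (h' : Typed Δ t A) (hp : E.Perm (Γ ++ Δ))
    (hE : IsCtx E) :
    eval (of.{u₁, u₂, u₃, w, c} (T := T) h) (of h') = of (h.app h' hp hE) :=
  (El.app_mk _ _ (hE.perm hp.symm)).trans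
    (El.mk_eq (.refl (typed_tyObj.{u₁, u₂, u₃, w, c} (h.app h' (.refl _) (hE.perm hp.symm)))) hp.symm _ _)

variable (T) in
/-- The tuple of the variables of a context. -/
def vars : (Γ : Ctx S.Ground) → (ctxObj (groundObj.{u₁, u₂, u₃, c} T) Γ).Elem
  | [] => star
  | [p] => of (.fvar p.1 p.2)
  | p :: p' :: Γ => pair (vars (p' :: Γ)) (of (.fvar p.1 p.2))

theorem act_ctxSnoc_hom (p : ℕ × Ty S.Ground) : ∀ Γ : Ctx S.Ground,
    act (ctxSnoc (groundObj.{u₁, u₂, u₃, c} T) Γ p).hom (pair (vars T Γ) (of (.fvar p.1 p.2))) =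
      vars T (p :: Γ)
  | [] => act_leftUnitor_hom _
  | _ :: _ => act_id _

theorem act_ctxSnoc_inv (p : ℕ × Ty S.Ground) : ∀ Γ : Ctx S.Ground,
    act (ctxSnoc (groundObj.{u₁, u₂, u₃, c} T) Γ p).inv (vars T (p :: Γ)) =
      pair (vars T Γ) (of (.fvar p.1 p.2))
  | [] => act_leftUnitor_inv _
  | _ :: _ => act_id _

/-- On the generic element of a context, the housekeeping morphism merely sorts the variables. -/
theorem act_split (s : Shuffle Γ Δ E) :
    act (split (groundObj.{u₁, u₂, u₃, c} T) s) (vars T E) = pair (vars T Γ) (vars T Δ) := by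
  induction s with
  | nil => exact act_leftUnitor_inv _
  | left p s ih => exact act_split_left ih _ (act_ctxSnoc_inv p _) _ (act_ctxSnoc_hom p _)
  | right p s ih => exact act_split_right ih _ (act_ctxSnoc_inv p _) _ (act_ctxSnoc_hom p _)

theorem act_nSplit {n : ℕ} {Γ : Fin n → Ctx S.Ground} (s : Shuffles n Γ E) :
    act (nSplit (groundObj.{u₁, u₂, u₃, c} T) s) (vars T E) = nTuple n fun i => vars T (Γ i) := by
  induction s with
  | nil => exact act_id _
  | snoc Γ s s' ih => exact act_nSplit_snoc (fun i => vars T (Γ i)) (act_split s') _ ih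

/-- As the generic element is a pattern, morphisms out of `⟦Γ⟧` and their distances are determined
at it. -/
theorem exists_pattern_vars : ∀ {Γ : Ctx S.Ground}, IsCtx Γ →
    ∃ P, ∃ h : Pattern Γ P (ctxObj (groundObj.{u₁, u₂, u₃, c} T) Γ).ty, vars T Γ = El.mk h.typed
  | [], _ => ⟨_, .star, rfl⟩
  | [p], _ => ⟨.fvar p.1, by
      have : Pattern [p] (.fvar p.1) p.2 := .var _ _
      rwa [← ty_tyObj (T := T) p.2] at this, rfl⟩
  | p :: p' :: Γ, h => by
    obtain ⟨P, hP, e⟩ := exists_pattern_vars (IsCtx.append_right (Γ := [p]) h)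
    have h₁ : Pattern [p] (.fvar p.1) p.2 := .var _ _
    have h₂ : Pattern [p] (.fvar p.1) (tyObj (groundObj.{u₁, u₂, u₃, c} T) p.2).ty := by
      rwa [ty_tyObj]
    have hp : (p :: p' :: Γ).Perm ((p' :: Γ) ++ [p]) := List.perm_append_comm (l₁ := [p])
    refine ⟨_, hP.pair h₂ hp h, ?_⟩
    exact (congrArg (pair · (of (.fvar p.1 p.2))) e).trans
      ((El.pair_mk hP.typed h₂.typed (h.perm hp.symm)).trans
        (El.mk_eq (.refl (hP.typed.pair h₂.typed (.refl _) (h.perm hp.symm))) hp.symm _ _))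

theorem exists_opHom (f : S.Op) :
    ∃ k : nTensor (S.arity f) (fun i => tyObj (groundObj.{u₁, u₂, u₃, c} T) (S.dom f i)) ⟶
        tyObj (groundObj T) (S.cod f),
      ∀ (Γ : Fin (S.arity f) → Ctx S.Ground) (v : Fin (S.arity f) → Tm S) (E : Ctx S.Ground)
        (h : ∀ i, Typed (Γ i) (v i) (S.dom f i)) (_ : Shuffles (S.arity f) Γ E) (_ : IsCtx E)
        (h' : Typed E (.op f v) (S.cod f)),
        act k (nTuple (S.arity f) fun i => of (h i)) = of h' := by
  obtain ⟨k, hk⟩ := exists_op (T := T) (S.arity f)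
    (fun i => tyObj (groundObj.{u₁, u₂, u₃, c} T) (S.dom f i)) (fun i => ty_tyObj (S.dom f i))
    (tyObj (groundObj T) (S.cod f)) (op := .op f) (fun _ _ => rfl) fun Γ v _ h s hE =>
      typed_tyObj ⟨.op f Γ v (fun i => (h i).some) s hE⟩
  exact ⟨k, fun Γ v E h s hE h' => hk Γ v E (fun i => typed_tyObj (h i)) s hE (typed_tyObj h')⟩

variable (T) in
/-- The interpretation of the signature in the term model. -/
def interp : Interp (Syn.{u₁, u₂, u₃, c} T) S where
  obj := groundObj T
  op f := (exists_opHom f).choose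

/-- By induction on the derivation, a term is its own value at the generic element. The term formers
other than binders and eliminations follow from the action of the combinators; matching, elimination
of `∗` and abstraction need the η-rules. -/
theorem act_sem (d : Der Γ v A) (h : Typed Γ v A) :
    act ((interp.{u₁, u₂, u₃, w, c} T).sem d) (vars T Γ) = of h := by
  induction d with
  | var x A => exact act_id _
  | star => exact act_id _
  | @op E f Γ v d s hE ih =>
    refine (act_comp _ _ _).trans ((act_comp _ _ _).trans ?_)
    refine (congrArg (fun e => act _ (act _ e)) (act_nSplit s)).trans ?_
    refine (congrArg (act _) (act_nTensorHom _ _ _)).trans ?_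
    refine (congrArg (fun e => act _ (nTuple _ e)) (funext fun i => ih i ⟨d i⟩)).trans ?_
    exact (exists_opHom (T := T) f).choose_spec Γ v E (fun i => ⟨d i⟩) s hE h
  | @pair Γ Δ E v t A A' d e s hE ih ih' =>
    refine (act_comp_tensorHom (act_split s) _ _).trans ?_
    exact (congrArg₂ pair (ih ⟨d⟩) (ih' ⟨e⟩)).trans (pair_of _ _ s.perm hE)
  | @app Γ Δ E v t A A' d e s hE ih ih' =>
    refine (act_comp_app (act_split s) _ _).trans ?_
    exact (congrArg₂ eval (ih ⟨d⟩) (ih' ⟨e⟩)).trans (eval_of _ _ s.perm hE)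
  | @letStar Γ Δ E v t A d e s hE ih ih' =>
    refine (act_comp_whiskerRight_comp (act_split s) _ _).trans ?_
    refine (congrArg (fun a => act _ (Syn.pair a _)) (ih ⟨d⟩)).trans ?_
    -- The variables of `Δ` are packed into a single term, as required for the passive component of
    -- the η-argument.
    obtain ⟨P, hP, eP⟩ := exists_pattern_vars (T := T) (IsCtx.append_right (hE.perm s.perm.symm))
    rw [eP]
    refine act_letStar hP.typed (typed_tyObj ⟨e⟩) ?_ _ s.perm hE _
    rw [← eP]
    refine (act_comp _ _ _).trans ((congrArg (act _) (act_leftUnitor_hom _)).trans (ih' ⟨e⟩))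
  | @pm Γ Δ E v t A A' D x y d e s hE ih ih' =>
    refine (act_comp_whiskerRight_comp (act_split s) _ _).trans ?_
    refine (congrArg (fun a => act _ (Syn.pair a _)) (ih ⟨d⟩)).trans ?_
    obtain ⟨P, hP, eP⟩ := exists_pattern_vars (T := T) (IsCtx.append_right (hE.perm s.perm.symm))
    rw [eP]
    refine act_pm (ty_tyObj A) (ty_tyObj A') (typed_tyObj (.fvar x A)) (typed_tyObj (.fvar y A'))
      hP.typed (typed_tyObj ⟨e⟩) ?_ _ s.perm hE _
    rw [← eP]
    refine (act_match _ _ _ _ _ _).trans ?_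
    refine (congrArg (fun a => act _ (act _ (Syn.pair a _))) (act_ctxSnoc_hom (x, A) Δ)).trans ?_
    exact (congrArg (act _) (act_ctxSnoc_hom (y, A') ((x, A) :: Δ))).trans (ih' ⟨e⟩)
  | @abs Γ v A A' x d ih =>
    obtain ⟨P, hP, eP⟩ := exists_pattern_vars (T := T) (IsCtx.append_right (Γ := [(x, A)])
      (Typed.isCtx ⟨d⟩))
    have key := eval_transpose ((ctxSnoc (groundObj.{u₁, u₂, u₃, c} T) Γ (x, A)).hom ≫
      (interp T).sem d) (vars T Γ) (of (.fvar x A))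
    have key := key.trans ((act_comp _ _ _).trans
      ((congrArg (act _) (act_ctxSnoc_hom (x, A) Γ)).trans (ih ⟨d⟩)))
    rw [eP] at key ⊢
    exact mk_eq_mk_abs (ty_tyObj A) _ _ (typed_tyObj ⟨d⟩) key _

theorem teq_app_sem {P : Tm S} (hP : Typed Γ P (ctxObj (groundObj.{u₁, u₂, u₃, c} T) Γ).ty)
    (e : vars T Γ = El.mk hP) (d : Der Γ v A) :
    TEq T.Ax Γ (.app (Fun.tm (T := T) ((interp.{u₁, u₂, u₃, w, c} T).sem d)) P) v
      (tyObj (groundObj.{u₁, u₂, u₃, c} T) A).ty := by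
  have h := act_sem.{u₁, u₂, u₃, w, c} (T := T) d ⟨d⟩
  rw [e] at h
  exact (El.teq_of_mk_eq h).2

/-- Applied to the pattern of variables, the two closed functions become `v` and `t`. By functional
completeness this neither gains nor loses provable labels. Both the model property and completeness
follow. -/
theorem homDist_sem (d : Der Γ v A) (d' : Der Γ t A) :
    homDist V ((interp.{u₁, u₂, u₃, w, c} T).sem d) ((interp.{u₁, u₂, u₃, w, c} T).sem d') =
      sSup {q | Thm T.Ax Γ v t A q} := by
  obtain ⟨P, hP, e⟩ := exists_pattern_vars.{u₁, u₂, u₃, w, c} (T := T) (Typed.isCtx ⟨d⟩)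
  have h := teq_app_sem hP.typed e d
  have h' := teq_app_sem hP.typed e d'
  refine congrArg sSup (Set.ext fun q => ⟨fun hq => ?_, fun hq => ?_⟩)
  · have := h.thm h' (Fun.thm_app_refl (T := T) hq hP.typed)
    rwa [ty_tyObj] at this
  · have hq' : Thm T.Ax Γ v t (tyObj (groundObj.{u₁, u₂, u₃, c} T) A).ty q := by rwa [ty_tyObj]
    exact Fun.thm_of_pattern (T := T) hP h h' hq'

theorem isModel_interp : (interp.{u₁, u₂, u₃, w, c} T).IsModel T := fun e he d d' =>
  (le_sSup (Thm.ax e he)).trans (homDist_sem.{u₁, u₂, u₃, w, c} d d').ge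

theorem isTheorem_of_satisfies_interp {e : VEq S B} (h : (interp.{u₁, u₂, u₃, w, c} T).Satisfies e) :
    T.IsTheorem e := by
  obtain ⟨d⟩ := e.lhs_typed
  obtain ⟨d'⟩ := e.rhs_typed
  exact .of_le_sSup e.lhs_typed e.rhs_typed e.label_mem
    ((h d d').trans (homDist_sem.{u₁, u₂, u₃, w, c} d d').le)

end Syn

end TermModel

end VLambda

/-! ### Soundness and completeness. -/

theorem mainTheorem1 {V : Type u₃} [CompleteLattice V] [CommMonoid V] [IsQuantale V]
    (hcont : VLambda.IsContinuousLattice V) (hint : (1 : V) = ⊤)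
    (B : Set V) (hB : VLambda.IsBasis B) (hBops : VLambda.IsClosedUnderOps B)
    (S : VLambda.Signature.{u₁, u₂}) (T : VLambda.VTheory S B)
    (hT : VLambda.VTheory.IsVarietal.{u₁, u₂, u₃, w} T) (e : VLambda.VEq S B) :
    T.IsTheorem e ↔
      ∀ (C : Type (max u₁ c)) [Category.{w} C] [MonoidalCategory C] [SymmetricCategory C]
        [MonoidalClosed C] [VLambda.VCatSepAutonomous C V] (M : VLambda.Interp C S),
        M.IsModel T → M.Satisfies e := by
  constructor
  · intro h C _ _ _ _ _ M hM d d'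
    exact (hM.holds hint hB h).le (M.sem_spec d) (M.sem_spec d')
  · intro h
    have : Fact ((1 : V) = ⊤) := ⟨hint⟩
    have : VLambda.IsRegular.{u₁, u₂, u₃, w} T := ⟨hBops.one_mem, hT⟩
    -- The term model is among the categories quantified over: its objects lie in the universe `max
    -- u₁ c`, and its hom-sets were shrunk to `w` by varietality.
    exact VLambda.Syn.isTheorem_of_satisfies_interp.{u₁, u₂, u₃, w, c}
      (h (VLambda.Syn.{u₁, u₂, u₃, c} T) _ VLambda.Syn.isModel_interp)
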